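/- Let $X$ be a complex threefold with a nowhere vanishing holomorphic $3$-form $\Omega$ (locally $\Omega=s(z)\,dz^1\wedge dz^2\wedge dz^3$) and a Kähler metric $g$ with Kähler form $\omega=i\sum g_{i\bar j}dz^i\wedge d\bar z^{j}$ (not assumed Ricci-flat). Let $\mathcal A=\bigoplus A^{p,q}$ be the space of smooth complex differential forms, $*$ the complex-linear Hodge star with volume form $\omega^3/3!$ (so $a\wedge *\bar b=\langle a,b\rangle\,\omega^3/3!$), and $$\partial^\dagger=-*\bar\partial *,\qquad \bar\partial^\dagger=-*\partial *,\qquad \square=\bar\partial\bar\partial^\dagger+\bar\partial^\dagger\bar\partial .$$ Let $\mathcal B=\bigoplus_{p,q}B^{p,q}$, $B^{p,q}=\Gamma(X,\bigwedge^pTX\otimes\bigwedge^q\overline{T^*X})$ (smooth sections), with its graded-commutative wedge product, in which $\theta_i=\partial/\partial z^i$ and $\eta^{\bar j}=d\bar z^{j}$ all anticommute, and $\bar\partial=\sum\eta^{\bar i}\,\partial/\partial\bar z^{i}$ on $\mathcal B$. For $\alpha\in B^{p,q}$ put $|\alpha|=p+q$; more generally $|\alpha|=n$ for $\alpha\in\bigoplus_{p+q=n}B^{p,q}$.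 Let $\rho:\mathcal B\to\mathcal A$ be the isomorphism $$\rho(v_1\wedge\cdots\wedge v_p\wedge\eta)=\bigl(\iota_{v_1}\cdots\iota_{v_p}\Omega\bigr)\wedge\eta ,$$ for vectors $v_j$ of type $(1,0)$ and $\eta$ a $(0,q)$-form, and for an operator $f$ on $\mathcal A$ let $\hat f=\rho^{-1}\circ f\circ\rho$. Put $\Delta=\hat\partial$, $S=\widehat{\partial^\dagger}$, $R=\widehat{\bar\partial^\dagger}$. These operators, $\bar\partial$ and $\hat *$ preserve smooth sections, and map $B^{p,q}$ as follows: $\bar\partial$ to $B^{p,q+1}$, $\Delta$ to $B^{p-1,q}$, $S$ to $B^{p+1,q}$, $R$ to $B^{p,q-1}$, $\hat *$ to $B^{q,p}$ (with $B^{-1,q}=B^{p,-1}=0$). Define bilinear brackets by $$[\alpha\bullet\beta]=(-1)^{|\alpha|}\Delta(\alpha\wedge\beta)-(-1)^{|\alpha|}\Delta\alpha\wedge\beta-\alpha\wedge\Delta\beta,\qquad [\alpha\star\beta]=(-1)^{|\alpha|}R(\alpha\wedge\beta)-(-1)^{|\alpha|}R\alpha\wedge\beta-\alpha\wedge R\beta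 .$$ Then, for all homogeneous $\alpha,\beta,\gamma\in\mathcal B$: (1) $(\mathcal B,\wedge,[\,\star\,],R,S)$ is a dGBV algebra. That is, $\mathcal B$ is graded-commutative for the ghost number $|\cdot|$; $R$ and $S$ are linear of degrees $-1$ and $+1$, with $R^2=S^2=RS+SR=0$; $S(\alpha\wedge\beta)=S\alpha\wedge\beta+(-1)^{|\alpha|}\alpha\wedge S\beta$; the bracket $[\,\star\,]$ is bilinear of degree $-1$; and $$[\beta\star\alpha]=-(-1)^{(|\alpha|+1)(|\beta|+1)}[\alpha\star\beta],$$ $$[\alpha\star[\beta\star\gamma]]=[[\alpha\star\beta]\star\gamma]+(-1)^{(|\alpha|+1)(|\beta|+1)}[\beta\star[\alpha\star\gamma]],$$ $$[\alpha\star(\beta\wedge\gamma)]=[\alpha\star\beta]\wedge\gamma+(-1)^{(|\alpha|+1)|\beta|}\beta\wedge[\alpha\star\gamma],$$ $$R[\alpha\star\beta]=[R\alpha\star\beta]+(-1)^{|\alpha|+1}[\alpha\star R\beta],\qquad S[\alpha\star\beta]=[S\alpha\star\beta]+(-1)^{|\alpha|+1}[\alpha\star S\beta].$$ (2) $[\alpha\star\beta]=i\,(-1)^{|\alpha||\beta|+1}\,\hat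 *[\hat *\alpha\bullet\hat *\beta]$. (3) $\Delta[\alpha\star\beta]-[\Delta\alpha\star\beta]+(-1)^{|\alpha|}[\alpha\star\Delta\beta]=-R[\alpha\bullet\beta]+[R\alpha\bullet\beta]-(-1)^{|\alpha|}[\alpha\bullet R\beta]$. (4) $S[\alpha\bullet\beta]-[S\alpha\bullet\beta]+(-1)^{|\alpha|}[\alpha\bullet S\beta]=-\bar\partial[\alpha\star\beta]+[\bar\partial\alpha\star\beta]-(-1)^{|\alpha|}[\alpha\star\bar\partial\beta]=(-1)^{|\alpha|}\bigl(\hat\square(\alpha\wedge\beta)-\hat\square\alpha\wedge\beta-\alpha\wedge\hat\square\beta\bigr)$, where $\hat\square=-\bar\partial R-R\bar\partial=\Delta S+S\Delta$. -/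

import Mathlib

open scoped ContDiff Manifold

noncomputable section

namespace KodairaSpencer

/-! # Exterior algebras attached to a complex vector space -/

section Fibre

variable (V : Type*) [AddCommGroup V] [Module ℂ V]

/-- The conjugate dual `V̄*`: conjugate-linear functionals on `V`.  For `V = T_x X` this is the
antiholomorphic cotangent space, spanned by the `d z̄^j`. -/
abbrev ConjDual : Type _ := V →ₛₗ[starRingEnd ℂ] ℂ

/-- `⨁_{p,q} ⋀^p V* ⊗ ⋀^q V̄* = ⋀(V* ⊕ V̄*)`, the complex-valued alternating forms on `V`. -/
abbrev FormAlg : Type _ := ExteriorAlgebra ℂ (Module.Dual ℂ V × ConjDual V)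

/-- `⨁_{p,q} ⋀^p V ⊗ ⋀^q V̄* = ⋀(V ⊕ V̄*)`; the generators from `V` (the variables `θ`) and those
from `V̄*` (the variables `η`) all anticommute. -/
abbrev PolyAlg : Type _ := ExteriorAlgebra ℂ (V × ConjDual V)

variable {V}
variable {W : Type*} [AddCommGroup W] [Module ℂ W]

/-- Restriction of conjugate-linear functionals along a linear map. -/
def conjPull (f : V →ₗ[ℂ] W) : ConjDual W →ₗ[ℂ] ConjDual V where
  toFun k := k.comp f
  map_add' _ _ := rfl
  map_smul' _ _ := rfl

/-- Pullback of forms along a linear map. -/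
def formPull (f : V →ₗ[ℂ] W) : FormAlg W →ₐ[ℂ] FormAlg V :=
  ExteriorAlgebra.map (f.dualMap.prodMap (conjPull f))

/-- Transport along a linear isomorphism `f` with inverse `f'`: vectors are pushed forward by `f`,
conjugate-linear functionals are pulled back by `f'`. -/
def polyMap (f : V →ₗ[ℂ] W) (f' : W →ₗ[ℂ] V) : PolyAlg V →ₐ[ℂ] PolyAlg W :=
  ExteriorAlgebra.map (f.prodMap (conjPull f'))

/-- The element of `⋀(V* ⊕ V̄*)` given by a linear functional. -/
def hol (f : Module.Dual ℂ V) : FormAlg V := ExteriorAlgebra.ι ℂ (f, 0)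

/-- The element of `⋀(V* ⊕ V̄*)` given by a conjugate-linear functional. -/
def antihol (k : ConjDual V) : FormAlg V := ExteriorAlgebra.ι ℂ (0, k)

variable (V) in
/-- `⋀^p V ⊗ ⋀^q V̄*` inside `⋀(V ⊕ V̄*)`: the span of the products of `p` vectors and `q`
conjugate-linear functionals. -/
def polyBidegree (p q : ℕ) : Submodule ℂ (PolyAlg V) :=
  LinearMap.range (ExteriorAlgebra.ι ℂ ∘ₗ LinearMap.inl ℂ V (ConjDual V)) ^ p *
    LinearMap.range (ExteriorAlgebra.ι ℂ ∘ₗ LinearMap.inr ℂ V (ConjDual V)) ^ q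

/-- Contraction `v ⌟ a` of a form with a vector `v ∈ V`: the antiderivation with
`v ⌟ f = f v` for `f ∈ V*` and `v ⌟ k = 0` for `k ∈ V̄*`. -/
def vectorContract : V →ₗ[ℂ] FormAlg V →ₗ[ℂ] FormAlg V :=
  (CliffordAlgebra.contractLeft (Q := (0 : QuadraticForm ℂ (Module.Dual ℂ V × ConjDual V)))) ∘ₗ
    (LinearMap.fst ℂ (Module.Dual ℂ V) (ConjDual V)).dualMap ∘ₗ Module.Dual.eval ℂ V

/-- The operator `a ↦ v ⌟ a - k ∧ a` on forms attached to a generator `(v, k)` of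
`⋀(V ⊕ V̄*)`. -/
def polyAction : (V × ConjDual V) →ₗ[ℂ] Module.End ℂ (FormAlg V) :=
  vectorContract ∘ₗ LinearMap.fst ℂ V (ConjDual V) -
    LinearMap.mul ℂ (FormAlg V) ∘ₗ ExteriorAlgebra.ι ℂ ∘ₗ
      LinearMap.inr ℂ (Module.Dual ℂ V) (ConjDual V) ∘ₗ LinearMap.snd ℂ V (ConjDual V)

theorem polyAction_sq (m : V × ConjDual V) : polyAction m * polyAction m = 0 := by
  obtain ⟨v, k⟩ := m
  refine LinearMap.ext fun x => ?_
  have key : ∀ y : FormAlg V, polyAction (v, k) y =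
      vectorContract v y - ExteriorAlgebra.ι ℂ ((0 : Module.Dual ℂ V), k) * y := fun y => rfl
  have h1 : vectorContract v (vectorContract v x) = 0 :=
    CliffordAlgebra.contractLeft_contractLeft (d :=
      (LinearMap.fst ℂ (Module.Dual ℂ V) (ConjDual V)).dualMap (Module.Dual.eval ℂ V v)) x
  have h2 : ∀ y : FormAlg V,
      vectorContract v (ExteriorAlgebra.ι ℂ ((0 : Module.Dual ℂ V), k) * y) =
        -(ExteriorAlgebra.ι ℂ ((0 : Module.Dual ℂ V), k) * vectorContract v y) := by
    intro y
    refine (CliffordAlgebra.contractLeft_ι_mul (d :=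
      (LinearMap.fst ℂ (Module.Dual ℂ V) (ConjDual V)).dualMap (Module.Dual.eval ℂ V v))
      ((0 : Module.Dual ℂ V), k) y).trans ?_
    have h0 : (LinearMap.fst ℂ (Module.Dual ℂ V) (ConjDual V)).dualMap (Module.Dual.eval ℂ V v)
      ((0 : Module.Dual ℂ V), k) = 0 := by simp
    rw [h0, zero_smul, zero_sub]
    rfl
  rw [Module.End.mul_apply, key, key, map_sub, h1, h2, mul_sub, ← mul_assoc,
    ExteriorAlgebra.ι_sq_zero, zero_mul]
  simp

/-- The map `ρ` defined by a form `Ω` of type `(n,0)` with `n` odd: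
`ρ(v₁ ⋯ v_p k₁ ⋯ k_q) = (v₁ ⌟ ⋯ v_p ⌟ Ω) ∧ k₁ ∧ ⋯ ∧ k_q`.  The sign in `polyAction` is the one from
moving the `k_j` past `Ω`, since `(-k₁) ⋯ (-k_q) ∧ Ω = Ω ∧ k₁ ∧ ⋯ ∧ k_q`. -/
def rhoFibre (Ω : FormAlg V) : PolyAlg V →ₗ[ℂ] FormAlg V :=
  (LinearMap.applyₗ Ω) ∘ₗ (ExteriorAlgebra.lift ℂ ⟨polyAction, polyAction_sq⟩).toLinearMap

/-- The complex-bilinear extension to `V* ⊕ V̄*` of the metric on covectors that is dual to the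
Hermitian metric `g`, regarded as the isomorphism `v ↦ g(v, ·)` of `V` with `V̄*`.
In coordinates `(dz^i, d z̄^j) = g^{i j̄}` and `(dz^i, dz^j) = 0 = (d z̄^i, d z̄^j)`. -/
def covectorPairing (g : V ≃ₗ[ℂ] ConjDual V) :
    (Module.Dual ℂ V × ConjDual V) →ₗ[ℂ] Module.Dual ℂ (Module.Dual ℂ V × ConjDual V) :=
  LinearMap.mk₂ ℂ (fun a b => a.1 (g.symm b.2) + b.1 (g.symm a.2))
    (by intros; simp; ring) (by intros; simp; ring) (by intros; simp; ring)
    (by intros; simp; ring)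

/-- Contraction of forms with the metric dual of a covector. -/
def covectorContract (g : V ≃ₗ[ℂ] ConjDual V) :
    (Module.Dual ℂ V × ConjDual V) →ₗ[ℂ] Module.End ℂ (FormAlg V) :=
  (CliffordAlgebra.contractLeft (Q := (0 : QuadraticForm ℂ (Module.Dual ℂ V × ConjDual V)))) ∘ₗ
    covectorPairing g

theorem covectorContract_sq (g : V ≃ₗ[ℂ] ConjDual V) (m : Module.Dual ℂ V × ConjDual V) :
    covectorContract g m * covectorContract g m = 0 :=
  LinearMap.ext fun x =>
    CliffordAlgebra.contractLeft_contractLeft (d := covectorPairing g m) x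

/-- The complex-linear Hodge star of the metric `g` with volume form `vol`:
`∗(a₁ ∧ ⋯ ∧ a_k) = a_k^♯ ⌟ ⋯ ⌟ a₁^♯ ⌟ vol` for covectors `a_j`, so that
`a ∧ ∗ b̄ = ⟨a, b⟩ vol`. -/
def hodgeFibre (g : V ≃ₗ[ℂ] ConjDual V) (vol : FormAlg V) : FormAlg V →ₗ[ℂ] FormAlg V :=
  (LinearMap.applyₗ vol) ∘ₗ
    (ExteriorAlgebra.lift ℂ ⟨covectorContract g, covectorContract_sq g⟩).toLinearMap ∘ₗ
      CliffordAlgebra.reverse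

/-- `i ∑_i b^i ∧ g(b_i, ·) = i ∑ g_{i j̄} b^i ∧ b̄^j` for a basis `b` of `V`
(independent of `b`). -/
def kahlerFibre {n : ℕ} (b : Module.Basis (Fin n) ℂ V) (g : V ≃ₗ[ℂ] ConjDual V) : FormAlg V :=
  Complex.I • ∑ i, hol (b.coord i) * antihol (g (b i))

end Fibre

/-! # Derivatives of functions on `ℂ³` -/

/-- The model space `ℂ³`. -/
abbrev E : Type := Fin 3 → ℂ

instance instFiniteConjDual : Module.Finite ℂ (ConjDual E) := by
  let f : ConjDual E →ₗ[ℂ] E :=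
    { toFun := fun k i => k (Pi.single i 1)
      map_add' := fun _ _ => rfl
      map_smul' := fun _ _ => rfl }
  refine Module.Finite.of_injective f fun k l h => ?_
  refine LinearMap.ext fun v => ?_
  have hv : v = ∑ i, v i • (Pi.single i 1 : E) := by
    simpa using (Pi.basisFun ℂ (Fin 3)).sum_repr v |>.symm
  rw [hv, map_sum, map_sum]
  refine Finset.sum_congr rfl fun i _ => ?_
  rw [map_smulₛₗ, map_smulₛₗ]
  exact congrArg _ (congrFun h i)

instance instFiniteExteriorAlgebra (M : Type*) [AddCommGroup M] [Module ℂ M]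
    [Module.Finite ℂ M] : Module.Finite ℂ (ExteriorAlgebra ℂ M) :=
  Module.Finite.of_basis (Module.finBasis ℂ M).ExteriorAlgebra

/-- `∂f/∂z^i` for a complex-valued function. -/
def dZ (i : Fin 3) (f : E → ℂ) (z : E) : ℂ :=
  (1 / 2) * (fderiv ℝ f z (Pi.single i 1) - Complex.I * fderiv ℝ f z (Pi.single i Complex.I))

/-- `∂f/∂z̄^i` for a complex-valued function. -/
def dZbar (i : Fin 3) (f : E → ℂ) (z : E) : ℂ :=
  (1 / 2) * (fderiv ℝ f z (Pi.single i 1) + Complex.I * fderiv ℝ f z (Pi.single i Complex.I))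

section VectorValued

variable {F : Type*} [AddCommGroup F] [Module ℂ F]

/-- Smoothness (in the real sense) on `U` of a function with values in a finite-dimensional
complex vector space: all its linear coordinates are smooth. -/
def SmoothOn (f : E → F) (U : Set E) : Prop :=
  ∀ l : Module.Dual ℂ F, ContDiffOn ℝ ∞ (fun z => l (f z)) U

variable [Module.Finite ℂ F]

/-- `∂f/∂z^i` of a vector-valued function, computed on its coordinates in a basis. -/
def vdZ (i : Fin 3) (f : E → F) (z : E) : F :=
  ∑ k, dZ i (fun w => (Module.finBasis ℂ F).coord k (f w)) z • Module.finBasis ℂ F k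

/-- `∂f/∂z̄^i` of a vector-valued function, computed on its coordinates in a basis. -/
def vdZbar (i : Fin 3) (f : E → F) (z : E) : F :=
  ∑ k, dZbar i (fun w => (Module.finBasis ℂ F).coord k (f w)) z • Module.finBasis ℂ F k

end VectorValued

/-- The covector `dz^i` on `ℂ³`. -/
def coordForm (i : Fin 3) : Module.Dual ℂ E := LinearMap.proj i

/-- The conjugate-linear covector `d z̄^i` on `ℂ³`. -/
def coordFormBar (i : Fin 3) : ConjDual E where
  toFun v := starRingEnd ℂ (v i)
  map_add' _ _ := by simp
  map_smul' _ _ := by simp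

/-- `∂ = ∑ dz^i ∧ ∂/∂z^i` on forms on open subsets of `ℂ³`. -/
def delLocal (a : E → FormAlg E) (z : E) : FormAlg E :=
  ∑ i, hol (coordForm i) * vdZ i a z

/-- `∂̄ = ∑ d z̄^i ∧ ∂/∂z̄^i` on forms on open subsets of `ℂ³`. -/
def delbarLocal (a : E → FormAlg E) (z : E) : FormAlg E :=
  ∑ i, antihol (coordFormBar i) * vdZbar i a z

/-- `∂̄ = ∑ η^i ∂/∂z̄^i` on forms with values in polyvectors on open subsets of `ℂ³`. -/
def delbarPolyLocal (α : E → PolyAlg E) (z : E) : PolyAlg E :=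
  ∑ i, ExteriorAlgebra.ι ℂ ((0 : E), coordFormBar i) * vdZbar i α z

/-! # Sections over a complex threefold -/

section Sections

variable (X : Type*) [TopologicalSpace X] [ChartedSpace E X]

variable {X} in
/-- The holomorphic tangent space `T_x X`. -/
abbrev T (x : X) : Type := TangentSpace 𝓘(ℂ, E) x

/-- Sections (not necessarily smooth) of `⨁_{p,q} ⋀^p T*X ⊗ ⋀^q T̄*X`. -/
abbrev FormSection : Type _ := (x : X) → FormAlg (T x)

/-- Sections (not necessarily smooth) of `⨁_{p,q} ⋀^p TX ⊗ ⋀^q T̄*X`; they form an algebra under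
the pointwise exterior product. -/
abbrev PolySection : Type _ := (x : X) → PolyAlg (T x)

variable {X}

/-- The differential `T_x X → ℂ³` of a chart at a point `x` of its domain. -/
def chartD (φ : OpenPartialHomeomorph X E) (x : X) : T x →L[ℂ] E :=
  (NormedSpace.fromTangentSpace (𝕜 := ℂ) (φ x)).toContinuousLinearMap ∘L
    mfderiv 𝓘(ℂ, E) 𝓘(ℂ, E) φ x

/-- The inverse `ℂ³ → T_x X` of the differential of a chart. -/
def chartDInv (φ : OpenPartialHomeomorph X E) (x : X) : E →L[ℂ] T x :=
  (chartD φ x).inverse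

/-- The local expression of a form in a chart, as a function on the target of the chart. -/
def localForm (φ : OpenPartialHomeomorph X E) (a : FormSection X) (z : E) : FormAlg E :=
  formPull (chartDInv φ (φ.symm z)).toLinearMap (a (φ.symm z))

/-- The local expression of a section of `⋀ TX ⊗ ⋀ T̄*X` in a chart. -/
def localPoly (φ : OpenPartialHomeomorph X E) (α : PolySection X) (z : E) : PolyAlg E :=
  polyMap (chartD φ (φ.symm z)).toLinearMap (chartDInv φ (φ.symm z)).toLinearMap (α (φ.symm z))

/-- `∂` on forms on `X`, computed at `x` in the preferred chart at `x`. -/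
def del (a : FormSection X) : FormSection X := fun x =>
  formPull (chartD (chartAt E x) x).toLinearMap
    (delLocal (localForm (chartAt E x) a) (chartAt E x x))

/-- `∂̄` on forms on `X`, computed at `x` in the preferred chart at `x`. -/
def delbar (a : FormSection X) : FormSection X := fun x =>
  formPull (chartD (chartAt E x) x).toLinearMap
    (delbarLocal (localForm (chartAt E x) a) (chartAt E x x))

/-- `∂̄` on sections of `⋀ TX ⊗ ⋀ T̄*X`, computed at `x` in the preferred chart at `x`. -/
def delbarPoly (α : PolySection X) : PolySection X := fun x =>
  polyMap (chartDInv (chartAt E x) x).toLinearMap (chartD (chartAt E x) x).toLinearMap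
    (delbarPolyLocal (localPoly (chartAt E x) α) (chartAt E x x))

/-- The basis of `T_x X` given by the coordinates of the preferred chart at `x`. -/
def tangentBasis (x : X) : Module.Basis (Fin 3) ℂ (T x) := Pi.basisFun ℂ (Fin 3)

variable (X) in
/-- The smooth sections of `⋀ TX ⊗ ⋀ T̄*X` with values in a fibrewise given subspace. -/
def smoothPolyIn (P : (x : X) → Submodule ℂ (PolyAlg (T x))) : Submodule ℂ (PolySection X) where
  carrier := {α | (∀ φ ∈ atlas E X, SmoothOn (localPoly φ α) φ.target) ∧ ∀ x, α x ∈ P x}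
  zero_mem' := by
    refine ⟨fun φ _ l => ?_, fun x => (P x).zero_mem⟩
    simpa [localPoly] using contDiffOn_const
  add_mem' := by
    rintro α β ⟨h1, h2⟩ ⟨h3, h4⟩
    refine ⟨fun φ hφ l => ?_, fun x => (P x).add_mem (h2 x) (h4 x)⟩
    simpa [localPoly] using (h1 φ hφ l).add (h3 φ hφ l)
  smul_mem' := by
    rintro c α ⟨h1, h2⟩
    refine ⟨fun φ hφ l => ?_, fun x => (P x).smul_mem c (h2 x)⟩
    simpa [localPoly] using contDiffOn_const.mul (h1 φ hφ l)

variable (X) in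
/-- `𝓑`, the space of all smooth sections of `⨁_{p,q} ⋀^p TX ⊗ ⋀^q T̄*X`. -/
def smoothPoly : Submodule ℂ (PolySection X) := smoothPolyIn X fun _ => ⊤

variable (X) in
/-- `B^{p,q}`, the smooth sections of `⋀^p TX ⊗ ⋀^q T̄*X`. -/
def bidegree (p q : ℕ) : Submodule ℂ (PolySection X) :=
  smoothPolyIn X fun x => polyBidegree (T x) p q

variable (X) in
/-- The elements of `𝓑` of ghost number `n`: the smooth sections of
`⨁_{p+q=n} ⋀^p TX ⊗ ⋀^q T̄*X = ⋀^n (TX ⊕ T̄*X)`. -/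
def ghost (n : ℕ) : Submodule ℂ (PolySection X) :=
  smoothPolyIn X fun x => ⋀[ℂ]^n (T x × ConjDual (T x))

theorem bidegree_le_ghost (p q : ℕ) : bidegree X p q ≤ ghost X (p + q) := by
  rintro α ⟨h1, h2⟩
  refine ⟨h1, fun x => ?_⟩
  have h : polyBidegree (T x) p q ≤ ⋀[ℂ]^(p + q) (T x × ConjDual (T x)) := by
    rw [polyBidegree, ExteriorAlgebra.exteriorPower, pow_add]
    exact mul_le_mul' (pow_le_pow_left' (LinearMap.range_comp_le_range _ _) p)
      (pow_le_pow_left' (LinearMap.range_comp_le_range _ _) q)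
  exact h (h2 x)

/-- The odd bracket built from an operator `D`.  The involution multiplies elements of ghost number
`n` by `(-1)^n`, so for linear `D` and `|α| = n` this is
`(-1)^n D (α ∧ β) - (-1)^n D α ∧ β - α ∧ D β`. -/
def oddBracket (D : PolySection X → PolySection X) (α β : PolySection X) : PolySection X :=
  let α' : PolySection X := fun x => CliffordAlgebra.involute (α x)
  D (α' * β) - D α' * β - α * D β

end Sections

/-! # Calabi-Yau threefolds -/

variable (X : Type*) [TopologicalSpace X] [ChartedSpace E X]

/-- A nowhere vanishing holomorphic `3`-form and a Kähler metric on a complex threefold `X`. -/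
structure CalabiYau where
  /-- The holomorphic volume form. -/
  vol : FormSection X
  /-- `Ω = s(z) dz^1 ∧ dz^2 ∧ dz^3` with `s` holomorphic and without zeros, in every chart. -/
  vol_holomorphic : ∀ φ ∈ atlas E X, ∃ s : E → ℂ, DifferentiableOn ℂ s φ.target ∧
    ∀ z ∈ φ.target, s z ≠ 0 ∧
      localForm φ vol z = s z • (hol (coordForm 0) * hol (coordForm 1) * hol (coordForm 2))
  /-- The metric, as the map `v ↦ g(v, ·)`, linear in `v` and conjugate-linear in the other
  argument; it is bijective because the metric is positive definite. -/
  metric : (x : X) → T x ≃ₗ[ℂ] ConjDual (T x)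
  /-- `g` is Hermitian. -/
  metric_symm : ∀ (x : X) (v w : T x), metric x w v = starRingEnd ℂ (metric x v w)
  /-- `g` is positive definite. -/
  metric_pos : ∀ (x : X) (v : T x), v ≠ 0 → 0 < (metric x v v).re
  /-- The components `g_{i j̄}` are smooth in every chart. -/
  metric_smooth : ∀ φ ∈ atlas E X, ∀ i j : Fin 3, ContDiffOn ℝ ∞
    (fun z => metric (φ.symm z) (chartDInv φ (φ.symm z) (Pi.single i 1))
      (chartDInv φ (φ.symm z) (Pi.single j 1))) φ.target
  /-- The Kähler form `ω = i ∑ g_{i j̄} dz^i ∧ d z̄^j` is closed. -/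
  kahler : del (fun x => kahlerFibre (tangentBasis x) (metric x)) +
    delbar (fun x => kahlerFibre (tangentBasis x) (metric x)) = 0

namespace CalabiYau

variable {X} (Y : CalabiYau X)

/-- The Kähler form. -/
def omega : FormSection X := fun x => kahlerFibre (tangentBasis x) (Y.metric x)

/-- The Hodge star on forms, with volume form `ω³/3!`. -/
def star (a : FormSection X) : FormSection X := fun x =>
  hodgeFibre (Y.metric x) ((1 / 6 : ℂ) • Y.omega x ^ 3) (a x)

/-- `∂† = -∗ ∂̄ ∗`. -/
def delDagger (a : FormSection X) : FormSection X := -Y.star (delbar (Y.star a))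

/-- `∂̄† = -∗ ∂ ∗`. -/
def delbarDagger (a : FormSection X) : FormSection X := -Y.star (del (Y.star a))

/-- The Laplacian `□ = ∂̄ ∂̄† + ∂̄† ∂̄` on forms. -/
def laplacian (a : FormSection X) : FormSection X :=
  delbar (Y.delbarDagger a) + Y.delbarDagger (delbar a)

/-- The isomorphism `ρ` from sections of `⋀ TX ⊗ ⋀ T̄*X` to forms. -/
def rho (α : PolySection X) : FormSection X := fun x => rhoFibre (Y.vol x) (α x)

/-- The inverse of `ρ` (which is bijective on each fibre). -/
def rhoInv (a : FormSection X) : PolySection X := fun x =>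
  Function.invFun (rhoFibre (Y.vol x)) (a x)

/-- The transport `ρ⁻¹ ∘ f ∘ ρ` of an operator on forms. -/
def hat (f : FormSection X → FormSection X) (α : PolySection X) : PolySection X :=
  Y.rhoInv (f (Y.rho α))

/-- `Δ`, the transport of `∂`. -/
def Delta : PolySection X → PolySection X := Y.hat del

/-- `S`, the transport of `∂†`. -/
def S : PolySection X → PolySection X := Y.hat Y.delDagger

/-- `R`, the transport of `∂̄†`. -/
def R : PolySection X → PolySection X := Y.hat Y.delbarDagger

/-- The transported Hodge star. -/
def starHat : PolySection X → PolySection X := Y.hat Y.star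

/-- The transported Laplacian. -/
def laplacianHat : PolySection X → PolySection X := Y.hat Y.laplacian

/-- `[α • β]`, built from `Δ`. -/
def bulletBracket : PolySection X → PolySection X → PolySection X := oddBracket Y.Delta

/-- `[α ⋆ β]`, built from `R`. -/
def starBracket : PolySection X → PolySection X → PolySection X := oddBracket Y.R

end CalabiYau

/-- A dGBV (differential Gerstenhaber-Batalin-Vilkovisky) algebra: a subspace `B` of an associative
algebra with grading `𝓑`, the product of the algebra, an odd bracket `br` of degree `-1`, and
operators `D` (of degree `-1`) and `d` (of degree `+1`) on `B`. -/
structure IsDGBVAlgebra {M : Type*} [Ring M] [Algebra ℂ M] (B : Submodule ℂ M)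
    (𝓑 : ℕ → Submodule ℂ M) (br : M → M → M) (D d : M → M) : Prop where
  /-- `B = ⨁ 𝓑 n` is a graded, graded-commutative algebra. -/
  iSup_eq : ⨆ n, 𝓑 n = B
  iSupIndep : iSupIndep 𝓑
  one_mem : 1 ∈ 𝓑 0
  mul_mem : ∀ m n, ∀ α ∈ 𝓑 m, ∀ β ∈ 𝓑 n, α * β ∈ 𝓑 (m + n)
  mul_comm : ∀ m n, ∀ α ∈ 𝓑 m, ∀ β ∈ 𝓑 n, β * α = (-1 : ℂ) ^ (m * n) • (α * β)
  /-- `d` is a differential of degree `+1` and a derivation of the product. -/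
  d_linear : ∀ c : ℂ, ∀ α ∈ B, ∀ β ∈ B, d (c • α + β) = c • d α + d β
  d_mem : ∀ n, ∀ α ∈ 𝓑 n, d α ∈ 𝓑 (n + 1)
  d_d : ∀ α ∈ B, d (d α) = 0
  d_mul : ∀ n, ∀ α ∈ 𝓑 n, ∀ β ∈ B, d (α * β) = d α * β + (-1 : ℂ) ^ n • (α * d β)
  /-- `D` is a differential of degree `-1` that anticommutes with `d`. -/
  D_linear : ∀ c : ℂ, ∀ α ∈ B, ∀ β ∈ B, D (c • α + β) = c • D α + D β
  D_mem : ∀ n, ∀ α ∈ 𝓑 (n + 1), D α ∈ 𝓑 n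
  D_zero : ∀ α ∈ 𝓑 0, D α = 0
  D_D : ∀ α ∈ B, D (D α) = 0
  D_d : ∀ α ∈ B, D (d α) + d (D α) = 0
  /-- The bracket is bilinear, of degree `-1`, and measures the failure of `D` to be a
  derivation of the product. -/
  br_linear_left : ∀ c : ℂ, ∀ α ∈ B, ∀ β ∈ B, ∀ γ ∈ B,
    br (c • α + β) γ = c • br α γ + br β γ
  br_linear_right : ∀ c : ℂ, ∀ α ∈ B, ∀ β ∈ B, ∀ γ ∈ B,
    br γ (c • α + β) = c • br γ α + br γ β
  br_mem : ∀ m n k, m + n = k + 1 → ∀ α ∈ 𝓑 m, ∀ β ∈ 𝓑 n, br α β ∈ 𝓑 k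
  br_zero : ∀ α ∈ 𝓑 0, ∀ β ∈ 𝓑 0, br α β = 0
  br_eq : ∀ n, ∀ α ∈ 𝓑 n, ∀ β ∈ B,
    br α β = (-1 : ℂ) ^ n • D (α * β) - (-1 : ℂ) ^ n • (D α * β) - α * D β
  /-- The bracket is an odd Lie bracket. -/
  br_symm : ∀ m n, ∀ α ∈ 𝓑 m, ∀ β ∈ 𝓑 n,
    br β α = -((-1 : ℂ) ^ ((m + 1) * (n + 1)) • br α β)
  br_jacobi : ∀ m n, ∀ α ∈ 𝓑 m, ∀ β ∈ 𝓑 n, ∀ γ ∈ B,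
    br α (br β γ) = br (br α β) γ + (-1 : ℂ) ^ ((m + 1) * (n + 1)) • br β (br α γ)
  /-- `br α ·` is a derivation of the product. -/
  br_mul : ∀ m n, ∀ α ∈ 𝓑 m, ∀ β ∈ 𝓑 n, ∀ γ ∈ B,
    br α (β * γ) = br α β * γ + (-1 : ℂ) ^ ((m + 1) * n) • (β * br α γ)
  /-- `D` and `d` are derivations of the bracket. -/
  D_br : ∀ n, ∀ α ∈ 𝓑 n, ∀ β ∈ B,
    D (br α β) = br (D α) β + (-1 : ℂ) ^ (n + 1) • br α (D β)
  d_br : ∀ n, ∀ α ∈ 𝓑 n, ∀ β ∈ B,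
    d (br α β) = br (d α) β + (-1 : ℂ) ^ (n + 1) • br α (d β)

end KodairaSpencer

end

open KodairaSpencer

noncomputable section

namespace KodairaSpencer

/-! # Calculus of functions with values in a finite-dimensional space -/

open Filter Topology Complex

/-! Everything is moved to polyvector fields by `ρ`. There `∂` becomes the divergence `Δ = s⁻¹ ∑
∂/∂θ_i ∂/∂z^i s` (`localPoly_Delta`), and `∂̄` on forms becomes `-∂̄` (`hat_delbar`). In these
coordinates `Δ² = 0`, `Δ` anticommutes with `∂̄`, `∂̄` is a derivation, and `Δ` is of second order:
its bracket is of Schouten type, a derivation of the product (`isBV_deltaEnd`).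

The metric enters through an `sl₂` acting on each fibre by derivations of `⋀(V ⊕ V̄*)`: `e` sends
`v` to `g v`, `f` sends `k` to `g⁻¹ k`, and their commutator has weight `-1` on `V` and `+1` on
`V̄*`. Three facts connect it with the geometry. Multiplication by `ω` is transported to `i e`
(`kahlerFibre_mul_rhoFibre`). The Hodge star is transported to `-i τ ∘ rev`, where `rev` reverses
products and `τ` is the algebra automorphism `v ↦ -g v`, `k ↦ g⁻¹ k` (`hodgeFibre_rhoFibre`).
Finally `τ = exp(-e) exp(f) exp(-e)` is the Weyl element (`tau_eq`).

The formula for the star gives `R = -τ Δ τ⁻¹` and `S = -τ ∂̄ τ⁻¹`. Conjugation by an algebra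
automorphism preserves second-order operators and derivations, so `(R, S)` inherits from `(Δ, ∂̄)`
the whole dGBV structure, and the two brackets are exchanged by the star up to the signs produced by
`rev`.

The Kähler condition says that `e` commutes with `Δ` and `∂̄`. Both operators have weight one, so
each is a highest weight vector for the adjoint action; nilpotency of `f` forces `[f, [f, d]] = 0`,
and the Weyl element carries `d` to `[f, d]` (`weyl_mul`). Hence `R = -[f, Δ]` and `S = -[f, ∂̄]`,
which are the Kähler identities. Commuting `f` with `Δ² = 0` and `Δ ∂̄ + ∂̄ Δ = 0` gives `ΔR + RΔ =
0` and `ΔS + SΔ = -(∂̄R + R∂̄)`.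

The mixed identities are then formal. For any two odd operators, the failures to be derivations of
each other's brackets add up to the failure of their anticommutator to be a derivation of the
product (`bracket_anticommutator`). For `(Δ, R)` the anticommutator is zero; for `(S, Δ)` and `(∂̄,
R)` one of the two brackets is zero and the anticommutator is the Laplacian up to sign.

The analytic work consists of the independence of `∂` and `∂̄` of the chart, the smoothness of the
holomorphic coefficient `s`, and the smoothness of the inverse metric. -/

/-- The operator `½ (∂_{e_i} + c ∂_{i e_i})`, which is `∂/∂z^i` for `c = -i` and `∂/∂z̄^i` for
`c = i`. -/
def dC (c : ℂ) (i : Fin 3) (f : E → ℂ) (z : E) : ℂ :=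
  (1 / 2) * (fderiv ℝ f z (Pi.single i 1) + c * fderiv ℝ f z (Pi.single i I))

theorem dZ_eq_dC : dZ = dC (-I) := by
  funext i f z
  simp only [dZ, dC]
  ring

theorem dC_congr {c : ℂ} {i : Fin 3} {f g : E → ℂ} {z : E} (h : f =ᶠ[𝓝 z] g) :
    dC c i f z = dC c i g z := by
  simp only [dC, h.fderiv_eq]

theorem dC_const (c : ℂ) (i : Fin 3) (a : ℂ) (z : E) : dC c i (fun _ => a) z = 0 := by
  simp [dC]

theorem dC_add {c : ℂ} {i : Fin 3} {f g : E → ℂ} {z : E} (hf : DifferentiableAt ℝ f z)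
    (hg : DifferentiableAt ℝ g z) :
    dC c i (fun w => f w + g w) z = dC c i f z + dC c i g z := by
  simp only [dC, fderiv_fun_add hf hg, add_apply]
  ring

theorem dC_mul {c : ℂ} {i : Fin 3} {f g : E → ℂ} {z : E} (hf : DifferentiableAt ℝ f z)
    (hg : DifferentiableAt ℝ g z) :
    dC c i (fun w => f w * g w) z = dC c i f z * g z + f z * dC c i g z := by
  simp only [dC, fderiv_fun_mul hf hg, add_apply,
    smul_apply, smul_eq_mul]
  ring

theorem dC_sum {ι : Type*} (s : Finset ι) {c : ℂ} {i : Fin 3} {f : ι → E → ℂ} {z : E}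
    (hf : ∀ k ∈ s, DifferentiableAt ℝ (f k) z) :
    dC c i (fun w => ∑ k ∈ s, f k w) z = ∑ k ∈ s, dC c i (f k) z := by
  simp only [dC, fderiv_fun_sum hf, sum_apply, Finset.mul_sum,
    ← Finset.sum_add_distrib]

theorem contDiffAt_dC {c : ℂ} {i : Fin 3} {f : E → ℂ} {z : E} (hf : ContDiffAt ℝ ∞ f z) :
    ContDiffAt ℝ ∞ (dC c i f) z := by
  have h : ContDiffAt ℝ ∞ (fderiv ℝ f) z := hf.fderiv_right (m := ∞) le_rfl
  exact contDiffAt_const.mul ((h.clm_apply contDiffAt_const).add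
    (contDiffAt_const.mul (h.clm_apply contDiffAt_const)))

/-- The second real derivative is symmetric, and both operators are combinations of real derivatives
with constant coefficients. One statement covers the pairs `∂∂`, `∂̄∂̄` and `∂∂̄`. -/
theorem dC_dC {c c' : ℂ} {i j : Fin 3} {f : E → ℂ} {z : E} (hf : ContDiffAt ℝ ∞ f z) :
    dC c i (dC c' j f) z = dC c' j (dC c i f) z := by
  have h : DifferentiableAt ℝ (fderiv ℝ f) z :=
    (hf.fderiv_right (m := ∞) le_rfl).differentiableAt (by simp)
  have hs : IsSymmSndFDerivAt ℝ f z := hf.isSymmSndFDerivAt (by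
    simpa using WithTop.coe_le_coe.2 (le_top : (2 : ℕ∞) ≤ ⊤))
  have key : ∀ (c : ℂ) (j : Fin 3) (v : E), fderiv ℝ (dC c j f) z v =
      (1 / 2) * (fderiv ℝ (fderiv ℝ f) z v (Pi.single j 1) +
        c * fderiv ℝ (fderiv ℝ f) z v (Pi.single j I)) := by
    intro c j v
    have h1 : ∀ u : E, HasFDerivAt (fun w => fderiv ℝ f w u)
        ((fderiv ℝ (fderiv ℝ f) z).flip u) z := fun u => by
      simpa using h.hasFDerivAt.clm_apply (hasFDerivAt_const u z)
    have h2 := ((h1 (Pi.single j 1)).add ((h1 (Pi.single j I)).const_mul c)).const_mul (1 / 2 : ℂ)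
    have h3 : HasFDerivAt (dC c j f) _ z := h2
    rw [h3.fderiv]
    simp
    ring
  rw [dC, key, key, dC, key, key]
  rw [hs.eq (Pi.single i 1) (Pi.single j 1), hs.eq (Pi.single i I) (Pi.single j 1),
    hs.eq (Pi.single i 1) (Pi.single j I), hs.eq (Pi.single i I) (Pi.single j I)]
  ring

/-- The real-linear map `x + iy ↦ x - c y`: the identity for `c = -i` and the conjugation for
`c = i`. -/
def twist (c a : ℂ) : ℂ := a.re - c * a.im

theorem twist_neg_I (a : ℂ) : twist (-I) a = a := by
  conv_rhs => rw [← re_add_im a]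
  simp only [twist]
  ring

theorem twist_I (a : ℂ) : twist I a = starRingEnd ℂ a := by
  rw [← Complex.re_add_im (starRingEnd ℂ a)]
  simp only [twist, conj_re, conj_im]
  push_cast
  ring

theorem dC_comp {c : ℂ} (hc : c ^ 2 = -1) {i : Fin 3} {f : E → ℂ} {t : E → E} {t' : E →L[ℂ] E}
    {z : E} (ht : HasFDerivAt t t' z) (hf : DifferentiableAt ℝ f (t z)) :
    dC c i (fun w => f (t w)) z = ∑ j, twist c (t' (Pi.single i 1) j) * dC c j f (t z) := by
  have h1 : fderiv ℝ (fun w => f (t w)) z = (fderiv ℝ f (t z)).comp (t'.restrictScalars ℝ) :=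
    (hf.hasFDerivAt.comp z (ht.restrictScalars ℝ)).fderiv
  have h2 : (Pi.single i I : E) = I • Pi.single i 1 := by
    rw [← Pi.single_smul]; simp
  have h3 : ∀ v : E,
      v = ∑ j, ((v j).re • (Pi.single j 1 : E) + (v j).im • (Pi.single j I : E)) := by
    intro v
    funext k
    simp only [Finset.sum_apply, Pi.add_apply, Pi.smul_apply, Pi.single_apply]
    rw [Finset.sum_eq_single k]
    · simp [re_add_im]
    · intro b _ hb; simp [hb.symm]
    · simp
  have h4 : ∀ v : E, fderiv ℝ f (t z) v = ∑ j, ((v j).re * fderiv ℝ f (t z) (Pi.single j 1) +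
      (v j).im * fderiv ℝ f (t z) (Pi.single j I)) := by
    intro v
    conv_lhs => rw [h3 v]
    simp [map_sum]
  simp only [dC]
  rw [h1, ContinuousLinearMap.comp_apply, ContinuousLinearMap.comp_apply,
    ContinuousLinearMap.coe_restrictScalars', h2, map_smul, h4, h4, Finset.mul_sum,
    ← Finset.sum_add_distrib, Finset.mul_sum]
  refine Finset.sum_congr rfl fun j _ => ?_
  simp only [twist, Pi.smul_apply, smul_eq_mul, I_mul_re, I_mul_im]
  push_cast
  -- The two sides differ by a multiple of `c² + 1`; this is where `c = ±i` is needed.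
  linear_combination (1 / 2 * ((t' (Pi.single i 1) j).im : ℂ) *
    fderiv ℝ f (t z) (Pi.single j I)) * hc

/-- The Cauchy-Riemann equations: the factor is `1` for `c = -i` and `0` for `c = i`. In `dC_conj`
the two values are exchanged. -/
theorem dC_holomorphic {c : ℂ} {i : Fin 3} {f : E → ℂ} {f' : E →L[ℂ] ℂ} {z : E}
    (hf : HasFDerivAt f f' z) : dC c i f z = (1 + c * I) / 2 * f' (Pi.single i 1) := by
  have h2 : (Pi.single i I : E) = I • Pi.single i 1 := by
    rw [← Pi.single_smul]; simp
  rw [dC, (hf.restrictScalars ℝ).fderiv, ContinuousLinearMap.coe_restrictScalars', h2, map_smul,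
    smul_eq_mul]
  ring

theorem dC_conj {c : ℂ} {i : Fin 3} {f : E → ℂ} {f' : E →L[ℂ] ℂ} {z : E}
    (hf : HasFDerivAt f f' z) :
    dC c i (fun w => starRingEnd ℂ (f w)) z =
      (1 - c * I) / 2 * starRingEnd ℂ (f' (Pi.single i 1)) := by
  have h2 : (Pi.single i I : E) = I • Pi.single i 1 := by
    rw [← Pi.single_smul]; simp
  have h := (conjCLE : ℂ →L[ℝ] ℂ).hasFDerivAt.comp z (hf.restrictScalars ℝ)
  have h1 : HasFDerivAt (fun w => starRingEnd ℂ (f w)) _ z := h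
  rw [dC, h1.fderiv]
  simp [h2]
  ring

/-! ### Smoothness and derivatives of vector-valued functions -/

section VectorValued

variable {F G H : Type*} [AddCommGroup F] [Module ℂ F] [AddCommGroup G] [Module ℂ G]
  [AddCommGroup H] [Module ℂ H]

/-- Smoothness at a point, tested on linear functionals. -/
def SmoothAt (f : E → F) (z : E) : Prop :=
  ∀ l : Module.Dual ℂ F, ContDiffAt ℝ ∞ (fun w => l (f w)) z

theorem smoothOn_iff {f : E → F} {U : Set E} (hU : IsOpen U) :
    SmoothOn f U ↔ ∀ z ∈ U, SmoothAt f z :=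
  ⟨fun h _ hz l => (h l).contDiffAt (hU.mem_nhds hz), fun h l _ hz => (h _ hz l).contDiffWithinAt⟩

namespace SmoothAt

variable {f g : E → F} {z : E}

theorem differentiableAt (hf : SmoothAt f z) (l : Module.Dual ℂ F) :
    DifferentiableAt ℝ (fun w => l (f w)) z := (hf l).differentiableAt (by simp)

theorem congr (hf : SmoothAt f z) (h : g =ᶠ[𝓝 z] f) : SmoothAt g z := fun l =>
  (hf l).congr_of_eventuallyEq (h.fun_comp l)

theorem const (a : F) : SmoothAt (fun _ => a) z := fun _ => contDiffAt_const

theorem add (hf : SmoothAt f z) (hg : SmoothAt g z) : SmoothAt (fun w => f w + g w) z := fun l => by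
  simpa using (hf l).add (hg l)

theorem sum {ι : Type*} {s : Finset ι} {f : ι → E → F} (hf : ∀ k ∈ s, SmoothAt (f k) z) :
    SmoothAt (fun w => ∑ k ∈ s, f k w) z := fun l => by
  simpa using ContDiffAt.sum fun k hk => hf k hk l

theorem linear (hf : SmoothAt f z) (L : F →ₗ[ℂ] G) : SmoothAt (fun w => L (f w)) z := fun l =>
  hf (l ∘ₗ L)

theorem smul {r : E → ℂ} (hr : ContDiffAt ℝ ∞ r z) (hf : SmoothAt f z) :
    SmoothAt (fun w => r w • f w) z := fun l => by
  simpa using hr.mul (hf l)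

/-- A smooth function is a combination of constant vectors with smooth coefficients. -/
theorem family [Module.Finite ℂ F] {P : E → F →ₗ[ℂ] G} (hP : ∀ x, SmoothAt (fun w => P w x) z)
    (hf : SmoothAt f z) : SmoothAt (fun w => P w (f w)) z := by
  have h : (fun w => P w (f w)) = fun w => ∑ k, (Module.finBasis ℂ F).coord k (f w) •
      P w (Module.finBasis ℂ F k) := funext fun w => by
    conv_lhs => rw [← (Module.finBasis ℂ F).sum_repr (f w), map_sum]
    simp
  rw [h]
  exact sum fun k _ => smul (hf _) (hP _)

theorem bilin [Module.Finite ℂ F] (B : F →ₗ[ℂ] G →ₗ[ℂ] H) {g : E → G} (hf : SmoothAt f z)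
    (hg : SmoothAt g z) : SmoothAt (fun w => B (f w) (g w)) z :=
  family (P := fun w => B.flip (g w)) (fun x => hg.linear (B x)) hf

theorem mul {A : Type*} [Ring A] [Algebra ℂ A] [Module.Finite ℂ A] {f g : E → A}
    (hf : SmoothAt f z) (hg : SmoothAt g z) : SmoothAt (fun w => f w * g w) z :=
  bilin (LinearMap.mul ℂ A) hf hg

end SmoothAt

variable [Module.Finite ℂ F] [Module.Finite ℂ G] [Module.Finite ℂ H]

/-- `vdZ` for `c = -i` and `vdZbar` for `c = i`. -/
def vdC (c : ℂ) (i : Fin 3) (f : E → F) (z : E) : F :=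
  ∑ k, dC c i (fun w => (Module.finBasis ℂ F).coord k (f w)) z • Module.finBasis ℂ F k

theorem vdZ_eq_vdC : (vdZ : Fin 3 → (E → F) → E → F) = vdC (-I) := by
  funext i f z
  simp only [vdZ, vdC, dZ_eq_dC]

theorem coord_vdC (c : ℂ) (i : Fin 3) (f : E → F) (z : E) (k) :
    (Module.finBasis ℂ F).coord k (vdC c i f z) =
      dC c i (fun w => (Module.finBasis ℂ F).coord k (f w)) z := by
  simp [vdC, Finsupp.single_apply]

/-- Frees `vdC` from the basis chosen in its definition; the calculus rules below reduce to scalar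
ones by testing on functionals. -/
theorem dual_vdC {c : ℂ} {i : Fin 3} {f : E → F} {z : E} (hf : SmoothAt f z)
    (l : Module.Dual ℂ F) : l (vdC c i f z) = dC c i (fun w => l (f w)) z := by
  have h : (fun w => l (f w)) = fun w => ∑ k, (Module.finBasis ℂ F).coord k (f w) *
      l (Module.finBasis ℂ F k) := funext fun w => by
    conv_lhs => rw [← (Module.finBasis ℂ F).sum_repr (f w), map_sum]
    simp
  rw [h, dC_sum _ fun k _ => (hf.differentiableAt _).mul_const _, vdC, map_sum]
  refine Finset.sum_congr rfl fun k _ => ?_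
  rw [dC_mul (hf.differentiableAt _) (differentiableAt_const _), dC_const]
  simp

theorem ext_dual {x y : F} (h : ∀ l : Module.Dual ℂ F, l x = l y) : x = y :=
  (Module.finBasis ℂ F).ext_elem fun k => h ((Module.finBasis ℂ F).coord k)

theorem vdC_congr {c : ℂ} {i : Fin 3} {f g : E → F} {z : E} (h : f =ᶠ[𝓝 z] g) :
    vdC c i f z = vdC c i g z := by
  simp only [vdC]
  exact Finset.sum_congr rfl fun k _ => congrArg (· • _)
    (dC_congr (h.fun_comp ((Module.finBasis ℂ F).coord k)))

theorem vdC_const (c : ℂ) (i : Fin 3) (a : F) (z : E) : vdC c i (fun _ => a) z = 0 := by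
  simp [vdC, dC_const]

theorem vdC_linear {c : ℂ} {i : Fin 3} {f : E → F} {z : E} (hf : SmoothAt f z) (L : F →ₗ[ℂ] G) :
    vdC c i (fun w => L (f w)) z = L (vdC c i f z) := by
  refine ext_dual fun l => ?_
  rw [dual_vdC (hf.linear L), ← LinearMap.comp_apply, dual_vdC hf]
  rfl

theorem vdC_add {c : ℂ} {i : Fin 3} {f g : E → F} {z : E} (hf : SmoothAt f z) (hg : SmoothAt g z) :
    vdC c i (fun w => f w + g w) z = vdC c i f z + vdC c i g z := by
  refine ext_dual fun l => ?_
  rw [dual_vdC (hf.add hg), map_add, dual_vdC hf, dual_vdC hg,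
    ← dC_add (hf.differentiableAt l) (hg.differentiableAt l)]
  simp

theorem vdC_sum {ι : Type*} {s : Finset ι} {c : ℂ} {i : Fin 3} {f : ι → E → F} {z : E}
    (hf : ∀ k ∈ s, SmoothAt (f k) z) :
    vdC c i (fun w => ∑ k ∈ s, f k w) z = ∑ k ∈ s, vdC c i (f k) z := by
  refine ext_dual fun l => ?_
  rw [dual_vdC (SmoothAt.sum hf), map_sum, Finset.sum_congr rfl fun k hk => dual_vdC (hf k hk) l,
    ← dC_sum _ fun k hk => (hf k hk).differentiableAt l]
  simp

theorem vdC_smul {c : ℂ} {i : Fin 3} {r : E → ℂ} {f : E → F} {z : E} (hr : ContDiffAt ℝ ∞ r z)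
    (hf : SmoothAt f z) :
    vdC c i (fun w => r w • f w) z = dC c i r z • f z + r z • vdC c i f z := by
  refine ext_dual fun l => ?_
  rw [dual_vdC (hf.smul hr), map_add, map_smul, map_smul, dual_vdC hf, smul_eq_mul, smul_eq_mul,
    ← dC_mul (hr.differentiableAt (by simp)) (hf.differentiableAt l)]
  simp

theorem vdC_const_smul {c : ℂ} {i : Fin 3} (r : ℂ) {f : E → F} {z : E} (hf : SmoothAt f z) :
    vdC c i (fun w => r • f w) z = r • vdC c i f z := by
  rw [vdC_smul contDiffAt_const hf, dC_const, zero_smul, zero_add]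

theorem vdC_bilin {c : ℂ} {i : Fin 3} {f : E → F} {g : E → G} {z : E} (B : F →ₗ[ℂ] G →ₗ[ℂ] H)
    (hf : SmoothAt f z) (hg : SmoothAt g z) :
    vdC c i (fun w => B (f w) (g w)) z = B (vdC c i f z) (g z) + B (f z) (vdC c i g z) := by
  have h : ∀ (x : F) (y : G), B x y = ∑ k, (Module.finBasis ℂ F).coord k x •
      B (Module.finBasis ℂ F k) y := fun x y => by
    conv_lhs => rw [← (Module.finBasis ℂ F).sum_repr x, map_sum]
    simp
  rw [show (fun w => B (f w) (g w)) = _ from funext fun w => h (f w) (g w),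
    vdC_sum fun k _ => (hg.linear _).smul (hf _), h (vdC c i f z), h (f z),
    ← Finset.sum_add_distrib]
  refine Finset.sum_congr rfl fun k _ => ?_
  rw [vdC_smul (hf _) (hg.linear _), vdC_linear hg, coord_vdC]

theorem vdC_mul {A : Type*} [Ring A] [Algebra ℂ A] [Module.Finite ℂ A] {c : ℂ} {i : Fin 3}
    {f g : E → A} {z : E} (hf : SmoothAt f z) (hg : SmoothAt g z) :
    vdC c i (fun w => f w * g w) z = vdC c i f z * g z + f z * vdC c i g z :=
  vdC_bilin (LinearMap.mul ℂ A) hf hg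

theorem SmoothAt.vdC {f : E → F} {z : E} (hf : SmoothAt f z) (c : ℂ) (i : Fin 3) :
    SmoothAt (vdC c i f) z :=
  SmoothAt.sum fun _ _ => SmoothAt.smul (contDiffAt_dC (hf _)) (SmoothAt.const _)

theorem vdC_vdC {c c' : ℂ} {i j : Fin 3} {f : E → F} {z : E} (hf : SmoothAt f z) :
    vdC c i (vdC c' j f) z = vdC c' j (vdC c i f) z := by
  refine (Module.finBasis ℂ F).ext_elem fun k => ?_
  have h := fun c c' i j => (coord_vdC c i (vdC c' j f) z k).trans
    (congrArg (fun u => dC c i u z) (funext fun w => coord_vdC c' j f w k))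
  exact (h c c' i j).trans ((dC_dC (hf _)).trans (h c' c j i).symm)

/-- In the quotient by `P` the function is locally zero, and so is its derivative. -/
theorem vdC_mem {c : ℂ} {i : Fin 3} {f : E → F} {z : E} (hf : SmoothAt f z) (P : Submodule ℂ F)
    (h : ∀ᶠ w in 𝓝 z, f w ∈ P) : vdC c i f z ∈ P := by
  rw [← Submodule.Quotient.mk_eq_zero, ← Submodule.mkQ_apply, ← vdC_linear hf,
    vdC_congr (g := fun _ => 0), vdC_const]
  filter_upwards [h] with w hw
  simpa using hw

theorem vdC_comp {c : ℂ} (hc : c ^ 2 = -1) {i : Fin 3} {f : E → F} {t : E → E} {t' : E →L[ℂ] E}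
    {z : E} (ht : HasFDerivAt t t' z) (ht' : ContDiffAt ℝ ∞ t z) (hf : SmoothAt f (t z)) :
    vdC c i (fun w => f (t w)) z = ∑ j, twist c (t' (Pi.single i 1) j) • vdC c j f (t z) := by
  refine ext_dual fun l => ?_
  have h : SmoothAt (fun w => f (t w)) z := fun l => (hf l).comp z ht'
  rw [dual_vdC h, dC_comp hc ht (hf.differentiableAt l), map_sum]
  simp [dual_vdC hf]

end VectorValued

/-! # Exterior algebras -/

section Exterior

variable {M N : Type*} [AddCommGroup M] [Module ℂ M] [AddCommGroup N] [Module ℂ N]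

open ExteriorAlgebra

@[elab_as_elim]
theorem exterior_induction {P : ExteriorAlgebra ℂ M → Prop} (one : P 1)
    (smul : ∀ (r : ℂ) x, P x → P (r • x)) (add : ∀ x y, P x → P y → P (x + y))
    (ι_mul : ∀ m x, P x → P (ι ℂ m * x)) (x : ExteriorAlgebra ℂ M) : P x := by
  induction x using CliffordAlgebra.left_induction with
  | algebraMap r => rw [Algebra.algebraMap_eq_smul_one]; exact smul r 1 one
  | add x y hx hy => exact add x y hx hy
  | ι_mul x m hx => exact ι_mul m x hx

@[elab_as_elim]
theorem exterior_induction_right {P : ExteriorAlgebra ℂ M → Prop} (one : P 1)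
    (smul : ∀ (r : ℂ) x, P x → P (r • x)) (add : ∀ x y, P x → P y → P (x + y))
    (mul_ι : ∀ m x, P x → P (x * ι ℂ m)) (x : ExteriorAlgebra ℂ M) : P x := by
  induction x using CliffordAlgebra.right_induction with
  | algebraMap r => rw [Algebra.algebraMap_eq_smul_one]; exact smul r 1 one
  | add x y hx hy => exact add x y hx hy
  | mul_ι m x hx => exact mul_ι m x hx

/-- Contraction of an exterior algebra with a functional. -/
def contr (d : Module.Dual ℂ M) : ExteriorAlgebra ℂ M →ₗ[ℂ] ExteriorAlgebra ℂ M :=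
  CliffordAlgebra.contractLeft (Q := (0 : QuadraticForm ℂ M)) d

@[simp] theorem contr_one (d : Module.Dual ℂ M) : contr d 1 = 0 :=
  CliffordAlgebra.contractLeft_one (Q := (0 : QuadraticForm ℂ M)) (d := d)

@[simp] theorem contr_ι (d : Module.Dual ℂ M) (m : M) :
    contr d (ι ℂ m) = algebraMap ℂ _ (d m) := CliffordAlgebra.contractLeft_ι _ d m

theorem contr_ι_mul (d : Module.Dual ℂ M) (m : M) (x : ExteriorAlgebra ℂ M) :
    contr d (ι ℂ m * x) = d m • x - ι ℂ m * contr d x :=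
  CliffordAlgebra.contractLeft_ι_mul d m x

theorem contr_contr (d d' : Module.Dual ℂ M) (x : ExteriorAlgebra ℂ M) :
    contr d (contr d' x) = -contr d' (contr d x) :=
  CliffordAlgebra.contractLeft_comm _ d' x

theorem ι_mul_ι (a b : M) : ι ℂ a * ι ℂ b = -(ι ℂ b * ι ℂ a) :=
  eq_neg_of_add_eq_zero_left (ι_add_mul_swap a b)

/-- The parity involution. -/
abbrev inv : ExteriorAlgebra ℂ M →ₐ[ℂ] ExteriorAlgebra ℂ M := CliffordAlgebra.involute

@[simp] theorem inv_ι (m : M) : inv (ι ℂ m) = -ι ℂ m := CliffordAlgebra.involute_ι m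

@[simp] theorem inv_inv (x : ExteriorAlgebra ℂ M) : inv (inv x) = x :=
  CliffordAlgebra.involute_involute x

/-- Writing the sign of graded commutativity through `inv` makes it valid for inhomogeneous `x`, so
that no degrees need to be tracked. -/
theorem ι_mul_eq (m : M) (x : ExteriorAlgebra ℂ M) : ι ℂ m * x = inv x * ι ℂ m := by
  induction x using exterior_induction with
  | one => simp
  | smul r x hx => simp [hx]
  | add x y hx hy => simp [mul_add, add_mul, hx, hy]
  | ι_mul a x hx => rw [← mul_assoc, ι_mul_ι, map_mul, inv_ι, neg_mul, mul_assoc, hx, neg_mul,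
      neg_mul, mul_assoc]

theorem contr_mul (d : Module.Dual ℂ M) (x y : ExteriorAlgebra ℂ M) :
    contr d (x * y) = contr d x * y + inv x * contr d y := by
  induction x using exterior_induction with
  | one => simp
  | smul r x hx => simp [hx]
  | add x y hx hy => simp only [add_mul, map_add, hx, hy]; abel
  | ι_mul m x hx =>
    rw [mul_assoc, contr_ι_mul, hx, contr_ι_mul, map_mul, inv_ι]
    simp only [sub_mul, smul_mul_assoc, mul_add, mul_assoc, neg_mul]
    abel

theorem inv_contr (d : Module.Dual ℂ M) (x : ExteriorAlgebra ℂ M) :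
    inv (contr d x) = -contr d (inv x) := by
  induction x using exterior_induction with
  | one => simp
  | smul r x hx => simp [hx]
  | add x y hx hy => simp only [map_add, hx, hy]; abel
  | ι_mul m x hx => simp [contr_ι_mul, hx]

theorem map_contr (A : M →ₗ[ℂ] N) (d : Module.Dual ℂ N) (x : ExteriorAlgebra ℂ M) :
    ExteriorAlgebra.map A (contr (d ∘ₗ A) x) = contr d (ExteriorAlgebra.map A x) := by
  induction x using exterior_induction with
  | one => simp
  | smul r x hx => simp [hx]
  | add x y hx hy => simp only [map_add, hx, hy]
  | ι_mul m x hx => simp [contr_ι_mul, hx]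

theorem map_inv (A : M →ₗ[ℂ] N) (x : ExteriorAlgebra ℂ M) :
    ExteriorAlgebra.map A (inv x) = inv (ExteriorAlgebra.map A x) := by
  induction x using exterior_induction with
  | one => simp
  | smul r x hx => simp [hx]
  | add x y hx hy => simp only [map_add, hx, hy]
  | ι_mul m x hx => simp [hx]

/-- The reversal of products. -/
abbrev rev : ExteriorAlgebra ℂ M →ₗ[ℂ] ExteriorAlgebra ℂ M := CliffordAlgebra.reverse

@[simp] theorem rev_one : rev (1 : ExteriorAlgebra ℂ M) = 1 := CliffordAlgebra.reverse.map_one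

theorem rev_ι_mul (m : M) (x : ExteriorAlgebra ℂ M) : rev (ι ℂ m * x) = ι ℂ m * rev (inv x) := by
  rw [ι_mul_eq m (rev (inv x))]
  refine (CliffordAlgebra.reverse.map_mul _ _).trans ?_
  refine congrArg₂ _ ?_ (CliffordAlgebra.reverse_ι m)
  have h := CliffordAlgebra.reverse_involute (Q := (0 : QuadraticForm ℂ M)) x
  refine Eq.trans ?_ (congrArg inv h).symm
  exact (inv_inv _).symm

theorem map_rev (A : M →ₗ[ℂ] N) (x : ExteriorAlgebra ℂ M) :
    ExteriorAlgebra.map A (rev x) = rev (ExteriorAlgebra.map A x) := by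
  -- Splitting a generator off `rev` introduces `inv`, so the induction must carry the claim for
  -- `inv x` as well.
  suffices h : ExteriorAlgebra.map A (rev x) = rev (ExteriorAlgebra.map A x) ∧
      ExteriorAlgebra.map A (rev (inv x)) = rev (ExteriorAlgebra.map A (inv x)) from h.1
  induction x using exterior_induction with
  | one => simp
  | smul r x hx => simp [hx]
  | add x y hx hy => simp [hx, hy]
  | ι_mul m x hx =>
    constructor
    · rw [rev_ι_mul, map_mul, map_mul, map_apply_ι, rev_ι_mul, hx.2, map_inv]
    · rw [map_mul, inv_ι, neg_mul, map_neg, map_neg, map_neg, map_neg, rev_ι_mul, map_mul, map_mul,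
        map_apply_ι, rev_ι_mul, inv_inv, hx.1, map_inv, inv_inv]

/-! ### Derivations of the exterior algebra -/

/-- The operator with which `derExt` is defined by recursion. -/
def derAction (u : Module.End ℂ M) :
    M →ₗ[ℂ] Module.End ℂ (ExteriorAlgebra ℂ M × ExteriorAlgebra ℂ M) where
  toFun m :=
    -- The pair stands for `(x, D x)`; multiplying `x` by `m` from the left changes it according to
    -- the Leibniz rule.
    { toFun := fun p => (ι ℂ m * p.1, ι ℂ (u m) * p.1 + ι ℂ m * p.2)
      map_add' := fun p q => by
        ext <;> simp only [Prod.fst_add, Prod.snd_add, mul_add]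
        abel
      map_smul' := fun r p => by ext <;> simp }
  map_add' m n := by
    refine LinearMap.ext fun p => ?_
    ext
    · simp [add_mul]
    · simp only [map_add, add_mul, LinearMap.coe_mk, AddHom.coe_mk, LinearMap.add_apply,
        Prod.snd_add]
      abel
  map_smul' r m := by
    refine LinearMap.ext fun p => ?_
    ext <;> simp

theorem derAction_sq (u : Module.End ℂ M) (m : M) : derAction u m * derAction u m = 0 := by
  refine LinearMap.ext fun p => ?_
  have h : ∀ q, derAction u m q = (ι ℂ m * q.1, ι ℂ (u m) * q.1 + ι ℂ m * q.2) := fun _ => rfl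
  rw [Module.End.mul_apply, h, h]
  ext
  · simp [← mul_assoc]
  · simp only [mul_add, ← mul_assoc, ι_sq_zero, zero_mul, add_zero, ι_mul_ι (u m) m]
    simp

/-- The derivation of the exterior algebra which extends an endomorphism. -/
def derExt (u : Module.End ℂ M) : Module.End ℂ (ExteriorAlgebra ℂ M) :=
  LinearMap.snd ℂ _ _ ∘ₗ LinearMap.applyₗ (1, 0) ∘ₗ
    (ExteriorAlgebra.lift ℂ ⟨derAction u, derAction_sq u⟩).toLinearMap

@[simp] theorem derExt_one (u : Module.End ℂ M) : derExt u 1 = 0 := by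
  simp [derExt]

theorem derExt_ι_mul (u : Module.End ℂ M) (m : M) (x : ExteriorAlgebra ℂ M) :
    derExt u (ι ℂ m * x) = ι ℂ (u m) * x + ι ℂ m * derExt u x := by
  -- Acting on `(1, 0)`, the first component just reproduces `x`, which the recursion for the second
  -- component needs.
  have h : ∀ x : ExteriorAlgebra ℂ M,
      (ExteriorAlgebra.lift ℂ ⟨derAction u, derAction_sq u⟩ x (1, 0)).1 = x := by
    intro x
    induction x using exterior_induction with
    | one => simp
    | smul r x hx => simp [hx]
    | add x y hx hy => simp [hx, hy]
    | ι_mul m x hx => rw [map_mul, lift_ι_apply, Module.End.mul_apply]; exact congrArg _ hx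
  have h2 : derExt u (ι ℂ m * x) =
      (derAction u m (ExteriorAlgebra.lift ℂ ⟨derAction u, derAction_sq u⟩ x (1, 0))).2 := by
    simp [derExt]
  rw [h2]
  exact congrArg (fun y => ι ℂ (u m) * y + ι ℂ m * derExt u x) (h x)

theorem derExt_contr (u : Module.End ℂ M) (d : Module.Dual ℂ M) (x : ExteriorAlgebra ℂ M) :
    derExt u (contr d x) = contr d (derExt u x) - contr (d ∘ₗ u) x := by
  induction x using exterior_induction with
  | one => simp
  | smul r x hx => simp [hx, smul_sub]
  | add x y hx hy => simp only [map_add, hx, hy]; abel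
  | ι_mul m x hx =>
    simp only [contr_ι_mul, derExt_ι_mul, map_sub, map_add, map_smul, hx, LinearMap.comp_apply,
      mul_sub]
    abel

theorem map_derExt {u : Module.End ℂ M} {w : Module.End ℂ N} {A : M →ₗ[ℂ] N}
    (h : A ∘ₗ u = w ∘ₗ A) (x : ExteriorAlgebra ℂ M) :
    ExteriorAlgebra.map A (derExt u x) = derExt w (ExteriorAlgebra.map A x) := by
  induction x using exterior_induction with
  | one => simp
  | smul r x hx => simp [hx]
  | add x y hx hy => simp only [map_add, hx, hy]
  | ι_mul m x hx =>
    have h' : A (u m) = w (A m) := LinearMap.congr_fun h m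
    simp [derExt_ι_mul, hx, h']

theorem derExt_commutator (u w : Module.End ℂ M) :
    derExt u * derExt w - derExt w * derExt u = derExt (u * w - w * u) := by
  refine LinearMap.ext fun x => ?_
  induction x using exterior_induction with
  | one => simp
  | smul r x hx => rw [map_smul, hx, map_smul]
  | add x y hx hy => rw [map_add, hx, hy, map_add]
  | ι_mul m x hx =>
    rw [derExt_ι_mul, ← hx]
    simp only [LinearMap.sub_apply, Module.End.mul_apply, derExt_ι_mul, map_add, mul_sub, map_sub,
      sub_mul]
    abel

theorem derExt_neg (u : Module.End ℂ M) : derExt (-u) = -derExt u := by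
  refine LinearMap.ext fun x => ?_
  induction x using exterior_induction with
  | one => simp
  | smul r x hx => rw [map_smul, hx, map_smul]
  | add x y hx hy => rw [map_add, hx, hy, map_add]
  | ι_mul m x hx =>
    rw [derExt_ι_mul, hx]
    simp only [LinearMap.neg_apply, derExt_ι_mul, map_neg]
    noncomm_ring

/-! ### Truncated exponentials and exponentials of square-zero derivations -/

/-- The exponential series of an operator, cut off after `N + 1` terms. -/
def expSum {A : Type*} [Ring A] [Algebra ℂ A] (N : ℕ) (F : A) : A :=
  ∑ k ∈ Finset.range (N + 1), (k.factorial : ℂ)⁻¹ • F ^ k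

/-- If `[F, a] = b` commutes with `F`, then `exp(F) a exp(-F) = a + b`. -/
theorem expSum_mul {A : Type*} [Ring A] [Algebra ℂ A] {N : ℕ} {F a b : A} (hF : F ^ N = 0)
    (h : F * a = a * F + b) (hb : Commute F b) :
    expSum N F * a = (a + b) * expSum N F := by
  -- Since `b` commutes with `F`, moving `a` past a power of `F` behaves like differentiating that
  -- power.
  have hk : ∀ k : ℕ, F ^ (k + 1) * a = a * F ^ (k + 1) + ((k + 1 : ℕ) : ℂ) • (b * F ^ k) := by
    intro k
    induction k with
    | zero => simpa using h
    | succ k ih =>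
      rw [pow_succ' F (k + 1), mul_assoc, ih, mul_add, ← mul_assoc, h, mul_smul_comm, ← mul_assoc,
        hb.eq, mul_assoc b F, ← pow_succ', add_mul, mul_assoc a F, ← pow_succ', Nat.cast_succ (k+1),
        add_smul, one_smul]
      abel
  rw [expSum, Finset.sum_mul, Finset.sum_range_succ', add_mul, Finset.mul_sum]
  conv_rhs => arg 1; rw [Finset.sum_range_succ']
  -- After the shift of the index, `b` multiplies one term more on the right than on the left; it
  -- contains `F ^ N` and vanishes.
  rw [Finset.mul_sum, Finset.sum_range_succ, hF]
  have h1 : ∀ k : ℕ, (((k + 1).factorial : ℂ)⁻¹ • F ^ (k + 1)) * a =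
      a * (((k + 1).factorial : ℂ)⁻¹ • F ^ (k + 1)) + b * ((k.factorial : ℂ)⁻¹ • F ^ k) := by
    intro k
    rw [smul_mul_assoc, hk, smul_add, mul_smul_comm, mul_smul_comm, smul_smul]
    congr 2
    rw [Nat.factorial_succ, Nat.cast_mul, mul_inv, mul_comm, ← mul_assoc, mul_inv_cancel₀
      (Nat.cast_ne_zero.2 (Nat.succ_ne_zero k)), one_mul]
  simp only [h1, Finset.sum_add_distrib]
  simp only [pow_zero, smul_zero, mul_zero, add_zero, smul_mul_assoc, mul_smul_comm, one_mul,
    mul_one]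
  abel

theorem derExt_pow_mul_comm {u : Module.End ℂ M} (hu : u * u = 0) (m : M) :
    Commute (derExt u) (LinearMap.mulLeft ℂ (ι ℂ (u m))) := by
  refine LinearMap.ext fun x => ?_
  have h : u (u m) = 0 := LinearMap.congr_fun hu m
  simp [derExt_ι_mul, h]

theorem derExt_pow_eq_zero {u : Module.End ℂ M} (hu : u * u = 0)
    [Module.Finite ℂ (ExteriorAlgebra ℂ M)] :
    derExt u ^ Module.finrank ℂ (ExteriorAlgebra ℂ M) = 0 := by
  -- Local nilpotency: each further generator costs one more power, because `u` kills `u m`.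
  have h1 : ∀ x, ∃ k, (derExt u ^ k) x = 0 := by
    have hle : ∀ {x : ExteriorAlgebra ℂ M} {k l : ℕ}, k ≤ l → (derExt u ^ k) x = 0 →
        (derExt u ^ l) x = 0 := by
      intro x k l hkl h
      obtain ⟨j, rfl⟩ := Nat.exists_eq_add_of_le' hkl
      rw [pow_add, Module.End.mul_apply, h, map_zero]
    intro x
    induction x using exterior_induction with
    | one => exact ⟨1, by simp⟩
    | smul r x hx => exact hx.imp fun k hk => by rw [map_smul, hk, smul_zero]
    | add x y hx hy =>
      obtain ⟨k, hk⟩ := hx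
      obtain ⟨l, hl⟩ := hy
      exact ⟨k + l, by rw [map_add, hle (Nat.le_add_right k l) hk, hle (Nat.le_add_left l k) hl,
        add_zero]⟩
    | ι_mul m x hx =>
      obtain ⟨k, hk⟩ := hx
      refine ⟨k + 1, ?_⟩
      have key : ∀ j : ℕ, (derExt u ^ (j + 1)) (ι ℂ m * x) = ι ℂ m * (derExt u ^ (j + 1)) x +
          ((j + 1 : ℕ) : ℂ) • (ι ℂ (u m) * (derExt u ^ j) x) := by
        intro j
        induction j with
        | zero => simp [derExt_ι_mul, add_comm]
        | succ j ih =>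
          have h : u (u m) = 0 := LinearMap.congr_fun hu m
          rw [pow_succ' (derExt u) (j + 1), Module.End.mul_apply, ih, Module.End.mul_apply, map_add,
            map_smul, derExt_ι_mul, derExt_ι_mul, h, pow_succ' (derExt u) j, Module.End.mul_apply,
            Nat.cast_succ (j + 1), add_smul, one_smul, map_zero, zero_mul, zero_add]
          abel
      rw [key, hk, pow_succ', Module.End.mul_apply, hk]
      simp
  have h2 : IsNilpotent (derExt u) := by
    rw [Module.End.isNilpotent_iff_of_finite]
    exact h1
  -- The characteristic polynomial is a pure power of `X`, so Cayley-Hamilton bounds the order by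
  -- the dimension. The bound is thus the same in all fibres.
  have h3 := (LinearMap.isNilpotent_iff_charpoly _).1 h2
  have h4 := LinearMap.aeval_self_charpoly (derExt u)
  rw [h3] at h4
  simpa using h4

/-- The exponential of a derivation is the algebra automorphism that extends the exponential of `u`,
and the latter is `1 + u` as `u² = 0`. -/
theorem map_one_add {u : Module.End ℂ M} (hu : u * u = 0) {N : ℕ} (hN : derExt u ^ N = 0) :
    (ExteriorAlgebra.map (1 + u)).toLinearMap = expSum N (derExt u) := by
  refine LinearMap.ext fun x => ?_
  induction x using exterior_induction with
  | one =>
    rw [expSum, Finset.sum_range_succ']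
    simp [pow_succ]
  | smul r x hx => rw [map_smul, hx, map_smul]
  | add x y hx hy => rw [map_add, hx, hy, map_add]
  | ι_mul m x hx =>
    have h := expSum_mul (a := LinearMap.mulLeft ℂ (ι ℂ m)) (b := LinearMap.mulLeft ℂ (ι ℂ (u m)))
      hN (by refine LinearMap.ext fun x => ?_; simp [derExt_ι_mul, add_comm])
      (derExt_pow_mul_comm hu m)
    have h' := LinearMap.congr_fun h x
    simp only [Module.End.mul_apply, LinearMap.mulLeft_apply, LinearMap.add_apply] at h'
    rw [h', ← hx]
    simp [add_mul]

end Exterior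

/-! # The fibrewise isomorphism `ρ` and the fibrewise Hodge star -/

section FibreMaps

open ExteriorAlgebra Complex

variable {V W : Type*} [AddCommGroup V] [Module ℂ V] [AddCommGroup W] [Module ℂ W]

/-- Evaluation of the first component at a vector. -/
def evalFst (v : V) : Module.Dual ℂ (Module.Dual ℂ V × ConjDual V) :=
  (LinearMap.fst ℂ (Module.Dual ℂ V) (ConjDual V)).dualMap (Module.Dual.eval ℂ V v)

@[simp] theorem evalFst_apply (v : V) (m : Module.Dual ℂ V × ConjDual V) :
    evalFst v m = m.1 v := rfl

@[simp] theorem covectorPairing_apply (g : V ≃ₗ[ℂ] ConjDual V)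
    (a b : Module.Dual ℂ V × ConjDual V) :
    covectorPairing g a b = a.1 (g.symm b.2) + b.1 (g.symm a.2) := rfl

theorem rhoFibre_one (Ω : FormAlg V) : rhoFibre Ω 1 = Ω := by
  simp [rhoFibre]

theorem rhoFibre_ι_mul (Ω : FormAlg V) (m : V × ConjDual V) (α : PolyAlg V) :
    rhoFibre Ω (ι ℂ m * α) =
      contr (evalFst m.1) (rhoFibre Ω α) - antihol m.2 * rhoFibre Ω α := by
  simp only [rhoFibre, LinearMap.comp_apply, AlgHom.toLinearMap_apply, map_mul,
    ExteriorAlgebra.lift_ι_apply, LinearMap.applyₗ_apply_apply, Module.End.mul_apply]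
  rfl

@[simp] theorem antihol_zero : antihol (0 : ConjDual V) = 0 :=
  (ι ℂ : Module.Dual ℂ V × ConjDual V →ₗ[ℂ] FormAlg V).map_zero

theorem antihol_mul_rhoFibre (Ω : FormAlg V) (k : ConjDual V) (α : PolyAlg V) :
    antihol k * rhoFibre Ω α = -rhoFibre Ω (ι ℂ (0, k) * α) := by
  rw [rhoFibre_ι_mul]
  have h : evalFst (0 : V) = 0 := by ext <;> simp
  simp [h, contr]

theorem contr_rhoFibre (Ω : FormAlg V) (v : V) (α : PolyAlg V) :
    contr (evalFst v) (rhoFibre Ω α) = rhoFibre Ω (ι ℂ (v, 0) * α) := by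
  rw [rhoFibre_ι_mul, antihol_zero, zero_mul, sub_zero]

/-- Both operators anticommute in the same way past the generators, so it is enough that they agree
on `1`, which holds as `Ω` has top holomorphic degree. This turns `dz^i ∧` into `∂/∂θ_i`, and so `∂`
into a divergence. -/
theorem hol_mul_rhoFibre {Ω : FormAlg V} {f : Module.Dual ℂ V} (h : hol f * Ω = 0)
    (α : PolyAlg V) :
    hol f * rhoFibre Ω α = rhoFibre Ω (contr (f ∘ₗ LinearMap.fst ℂ V (ConjDual V)) α) := by
  induction α using exterior_induction with
  | one => rw [rhoFibre_one, h, contr_one, map_zero]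
  | smul r x hx => simp [hx]
  | add x y hx hy => simp [mul_add, hx, hy]
  | ι_mul m x hx =>
    have h1 : ∀ y, contr (evalFst m.1) (hol f * y) = f m.1 • y - hol f * contr (evalFst m.1) y :=
      fun y => contr_ι_mul _ _ _
    have h2 : hol f * antihol m.2 = -(antihol m.2 * hol f) := ι_mul_ι _ _
    have h3 := h1 (rhoFibre Ω x)
    rw [hx] at h3
    rw [contr_ι_mul, map_sub, rhoFibre_ι_mul, rhoFibre_ι_mul, h3, mul_sub, ← mul_assoc, h2, neg_mul,
      mul_assoc, hx, map_smul]
    simp only [LinearMap.comp_apply, LinearMap.fst_apply]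
    abel

theorem inv_rhoFibre {Ω : FormAlg V} (h : inv Ω = -Ω) (α : PolyAlg V) :
    inv (rhoFibre Ω α) = -rhoFibre Ω (inv α) := by
  induction α using exterior_induction with
  | one => simp [rhoFibre_one, h]
  | smul r x hx => simp [hx]
  | add x y hx hy => simp only [map_add, hx, hy]; abel
  | ι_mul m x hx =>
    rw [rhoFibre_ι_mul, map_sub, inv_contr, map_mul, hx, map_mul, inv_ι, neg_mul, map_neg,
      map_neg, rhoFibre_ι_mul, antihol, inv_ι]
    simp

/-- Naturality of `ρ` under isomorphisms; it is what allows `ρ` to be computed in a chart. -/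
theorem formPull_rhoFibre {f : V →ₗ[ℂ] W} {f' : W →ₗ[ℂ] V} (hf : f' ∘ₗ f = LinearMap.id)
    (Ω : FormAlg V) (α : PolyAlg V) :
    formPull f' (rhoFibre Ω α) = rhoFibre (formPull f' Ω) (polyMap f f' α) := by
  induction α using exterior_induction with
  | one => simp [rhoFibre_one]
  | smul r x hx => simp [hx]
  | add x y hx hy => simp only [map_add, hx, hy]
  | ι_mul m x hx =>
    have h : evalFst m.1 = evalFst (f m.1) ∘ₗ f'.dualMap.prodMap (conjPull f') := by
      refine LinearMap.ext fun a => ?_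
      simp [show f' (f m.1) = m.1 from LinearMap.congr_fun hf m.1]
    have h1 : ∀ y, formPull f' (contr (evalFst m.1) y) =
        contr (evalFst (f m.1)) (formPull f' y) := by
      intro y
      rw [h]
      exact map_contr _ _ _
    rw [rhoFibre_ι_mul, map_sub, h1, map_mul, map_mul, hx, polyMap, ExteriorAlgebra.map_apply_ι,
      rhoFibre_ι_mul]
    simp [antihol, formPull]

/-- The form `b⁰ ∧ b¹ ∧ b²`. -/
def topForm (b : Module.Basis (Fin 3) ℂ V) : FormAlg V :=
  hol (b.coord 0) * hol (b.coord 1) * hol (b.coord 2)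

theorem hol_mul_self (f : Module.Dual ℂ V) : hol f * hol f = 0 := ι_sq_zero _

theorem hol_mul_hol (f f' : Module.Dual ℂ V) : hol f * hol f' = -(hol f' * hol f) := ι_mul_ι _ _

theorem hol_add (f f' : Module.Dual ℂ V) : hol (f + f') = hol f + hol f' := by
  rw [hol, hol, hol, ← map_add, Prod.mk_add_mk, add_zero]

theorem hol_smul (r : ℂ) (f : Module.Dual ℂ V) : hol (r • f) = r • hol f := by
  rw [hol, hol, ← map_smul, Prod.smul_mk, smul_zero]

theorem antihol_smul (r : ℂ) (f : ConjDual V) : antihol (r • f) = r • antihol f := by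
  rw [antihol, antihol, ← map_smul, Prod.smul_mk, smul_zero]

theorem hol_mul_topForm (b : Module.Basis (Fin 3) ℂ V) (f : Module.Dual ℂ V) :
    hol f * topForm b = 0 := by
  have h : ∀ i, hol (b.coord i) * topForm b = 0 := by
    intro i
    fin_cases i
    · simp [topForm, ← mul_assoc, hol_mul_self]
    · simp only [topForm, ← mul_assoc, Fin.mk_one]
      rw [hol_mul_hol (b.coord 1), neg_mul, mul_assoc (hol _), hol_mul_self]
      simp
    · simp only [topForm, Fin.reduceFinMk]
      rw [← mul_assoc, ← mul_assoc, hol_mul_hol (b.coord 2), neg_mul, mul_assoc (hol _),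
        hol_mul_hol (b.coord 2), mul_neg, neg_neg, mul_assoc, mul_assoc, hol_mul_self]
      simp
  rw [← b.sum_dual_apply_smul_coord f, Fin.sum_univ_three]
  simp [hol_add, hol_smul, add_mul, h]

theorem inv_topForm (b : Module.Basis (Fin 3) ℂ V) : inv (topForm b) = -topForm b := by
  simp [topForm, hol]

/-- The image contains `1`, by contracting `Ω` completely, and is closed under multiplication by
covectors of both types. Surjectivity gives injectivity because the dimensions agree. -/
theorem rhoFibre_bijective [Module.Finite ℂ (ConjDual V)] (b : Module.Basis (Fin 3) ℂ V) {s : ℂ}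
    (hs : s ≠ 0) : Function.Bijective (rhoFibre (s • topForm b)) := by
  have hΩ : ∀ f, hol f * (s • topForm b) = 0 := fun f => by
    rw [mul_smul_comm, hol_mul_topForm, smul_zero]
  have hfin : Module.Finite ℂ V := Module.Finite.of_basis b
  have hsurj : Function.Surjective (rhoFibre (s • topForm b)) := by
    intro x
    induction x using exterior_induction with
    | one =>
      -- Contracting `b⁰ ∧ b¹ ∧ b²` with `b 2`, `b 1` and `b 0` in turn gives `-1`.
      refine ⟨(-s⁻¹) • (ι ℂ (b 0, 0) * (ι ℂ (b 1, 0) * (ι ℂ (b 2, 0) * 1))), ?_⟩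
      rw [map_smul]
      simp only [← contr_rhoFibre, rhoFibre_one, topForm, hol, mul_assoc, map_smul, contr_ι_mul,
        contr_ι, evalFst_apply, Module.Basis.coord_apply, Module.Basis.repr_self]
      simp [contr_ι_mul, smul_smul, hs]
    | smul r x hx =>
      obtain ⟨a, rfl⟩ := hx
      exact ⟨r • a, map_smul _ _ _⟩
    | add x y hx hy =>
      obtain ⟨a, rfl⟩ := hx
      obtain ⟨c, rfl⟩ := hy
      exact ⟨a + c, map_add _ _ _⟩
    | ι_mul m x hx =>
      obtain ⟨a, rfl⟩ := hx
      have hm : ι ℂ m = hol m.1 + antihol m.2 := by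
        rw [hol, antihol, ← map_add, Prod.mk_add_mk, add_zero, zero_add]
      refine ⟨contr (m.1 ∘ₗ LinearMap.fst ℂ V (ConjDual V)) a - ι ℂ (0, m.2) * a, ?_⟩
      rw [map_sub, ← hol_mul_rhoFibre (hΩ m.1), hm, add_mul, antihol_mul_rhoFibre, sub_eq_add_neg]
  let e : (V × ConjDual V) ≃ₗ[ℂ] (Module.Dual ℂ V × ConjDual V) :=
    b.toDualEquiv.prodCongr (LinearEquiv.refl ℂ _)
  have hrank : Module.finrank ℂ (PolyAlg V) = Module.finrank ℂ (FormAlg V) := by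
    refine LinearEquiv.finrank_eq (LinearEquiv.ofLinearMap
      (ExteriorAlgebra.map e.toLinearMap).toLinearMap
      (ExteriorAlgebra.map e.symm.toLinearMap).toLinearMap ?_ ?_)
    · refine LinearMap.ext fun x => ?_
      have h := ExteriorAlgebra.map_comp_map e.symm.toLinearMap e.toLinearMap
      rw [LinearEquiv.comp_symm, ExteriorAlgebra.map_id] at h
      exact DFunLike.congr_fun h x
    · refine LinearMap.ext fun x => ?_
      have h := ExteriorAlgebra.map_comp_map e.toLinearMap e.symm.toLinearMap
      rw [LinearEquiv.symm_comp, ExteriorAlgebra.map_id] at h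
      exact DFunLike.congr_fun h x
  exact ⟨(LinearMap.injective_iff_surjective_of_finrank_eq_finrank hrank).2 hsurj, hsurj⟩

/-! ### The metric -/

theorem commute_ι_mul_ι {M : Type*} [AddCommGroup M] [Module ℂ M] (a b : M)
    (x : ExteriorAlgebra ℂ M) : Commute (ι ℂ a * ι ℂ b) x := by
  rw [commute_iff_eq, mul_assoc, ι_mul_eq b, ← mul_assoc, ι_mul_eq a, inv_inv, mul_assoc]

theorem antihol_metric {n : ℕ} (b : Module.Basis (Fin n) ℂ V) (g : V ≃ₗ[ℂ] ConjDual V) (v : V) :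
    antihol (g v) = ∑ i, b.coord i v • antihol (g (b i)) := by
  have h1 : v = ∑ i, b.coord i v • b i := by simp
  let L : V →ₗ[ℂ] FormAlg V :=
    ExteriorAlgebra.ι ℂ ∘ₗ LinearMap.inr ℂ (Module.Dual ℂ V) (ConjDual V) ∘ₗ g.toLinearMap
  have h2 := congrArg L h1
  rw [map_sum] at h2
  refine h2.trans (Finset.sum_congr rfl fun i _ => map_smul L _ _)

/-- `ω` is defined with the basis of the preferred chart, while its computation elsewhere needs
bases adapted to another chart or to `Ω`. -/
theorem kahlerFibre_eq {n m : ℕ} (b : Module.Basis (Fin n) ℂ V) (b' : Module.Basis (Fin m) ℂ V)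
    (g : V ≃ₗ[ℂ] ConjDual V) : kahlerFibre b g = kahlerFibre b' g := by
  have h := fun j => antihol_metric b g (b' j)
  have h' : ∀ i, hol (b.coord i) = ∑ j, b.coord i (b' j) • hol (b'.coord j) := by
    intro i
    let L : Module.Dual ℂ V →ₗ[ℂ] FormAlg V :=
      ExteriorAlgebra.ι ℂ ∘ₗ LinearMap.inl ℂ (Module.Dual ℂ V) (ConjDual V)
    have h2 := congrArg L (b'.sum_dual_apply_smul_coord (b.coord i)).symm
    rw [map_sum] at h2
    refine h2.trans (Finset.sum_congr rfl fun i _ => map_smul L _ _)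
  simp only [kahlerFibre, h, h', Finset.sum_mul, Finset.mul_sum, smul_mul_assoc, mul_smul_comm]
  rw [Finset.sum_comm]

theorem antihol_mul_hol_mul_antihol (f : Module.Dual ℂ V) (k : ConjDual V) :
    antihol k * (hol f * antihol k) = 0 := by
  have h : hol f * antihol k = -(antihol k * hol f) := ι_mul_ι _ _
  have h' : antihol k * antihol k = 0 := ι_sq_zero _
  rw [h, mul_neg, ← mul_assoc, h', zero_mul, neg_zero]

/-- The three summands of `ω` commute and have square zero, so their sum has cube six times their
product; the scalar is `i³ = -i`. -/
theorem kahlerFibre_pow (b : Module.Basis (Fin 3) ℂ V) (g : V ≃ₗ[ℂ] ConjDual V) :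
    (1 / 6 : ℂ) • kahlerFibre b g ^ 3 = (-I) • ((hol (b.coord 0) * antihol (g (b 0))) *
      ((hol (b.coord 1) * antihol (g (b 1))) * (hol (b.coord 2) * antihol (g (b 2))))) := by
  have hc : ∀ i (y : FormAlg V), (hol (b.coord i) * antihol (g (b i))) * y =
      y * (hol (b.coord i) * antihol (g (b i))) := fun i y => commute_ι_mul_ι _ _ y
  have hs : ∀ i, (hol (b.coord i) * antihol (g (b i))) * (hol (b.coord i) * antihol (g (b i))) =
      0 := fun i => by rw [mul_assoc, antihol_mul_hol_mul_antihol, mul_zero]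
  have hx := hs 0
  have hy := hs 1
  have hz := hs 2
  have cy := hc 1 (hol (b.coord 0) * antihol (g (b 0)))
  have cx := hc 2 (hol (b.coord 0) * antihol (g (b 0)))
  have cz := hc 2 (hol (b.coord 1) * antihol (g (b 1)))
  clear hs hc
  rw [kahlerFibre, Fin.sum_univ_three]
  generalize hol (b.coord 0) * antihol (g (b 0)) = x at *
  generalize hol (b.coord 1) * antihol (g (b 1)) = y at *
  generalize hol (b.coord 2) * antihol (g (b 2)) = z at *
  have cy' : ∀ w, y * (x * w) = x * (y * w) := fun w => by rw [← mul_assoc, cy, mul_assoc]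
  have hx' : ∀ w, x * (x * w) = 0 := fun w => by rw [← mul_assoc, hx, zero_mul]
  have hy' : ∀ w, y * (y * w) = 0 := fun w => by rw [← mul_assoc, hy, zero_mul]
  have h : (x + y + z) ^ 3 = (6 : ℂ) • (x * (y * z)) := by
    simp only [pow_succ, pow_zero, one_mul, mul_add, add_mul, mul_assoc, cy, cx, cz, cy', hx, hy, hz, hx', hy',
      mul_zero, zero_add, add_zero]
    module
  rw [smul_pow, h, smul_smul, smul_smul, I_pow_three]
  congr 1
  ring

/-- Every `k` is a combination of the `g (b i)`, all of which already occur in the volume form. -/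
theorem antihol_mul_volume (b : Module.Basis (Fin 3) ℂ V) (g : V ≃ₗ[ℂ] ConjDual V)
    (k : ConjDual V) : antihol k * ((1 / 6 : ℂ) • kahlerFibre b g ^ 3) = 0 := by
  have hc : ∀ i (y : FormAlg V), (hol (b.coord i) * antihol (g (b i))) * y =
      y * (hol (b.coord i) * antihol (g (b i))) := fun i y => commute_ι_mul_ι _ _ y
  obtain ⟨v, rfl⟩ := g.surjective k
  rw [kahlerFibre_pow, antihol_metric b, Fin.sum_univ_three]
  have h0 := antihol_mul_hol_mul_antihol (b.coord 0) (g (b 0))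
  have h1 := antihol_mul_hol_mul_antihol (b.coord 1) (g (b 1))
  have h2 := antihol_mul_hol_mul_antihol (b.coord 2) (g (b 2))
  simp only [add_mul, smul_mul_assoc, mul_smul_comm]
  rw [← mul_assoc (antihol (g (b 0))), h0, hc 0, ← mul_assoc (antihol (g (b 1))),
    ← mul_assoc (antihol (g (b 1))), h1, hc 1, ← mul_assoc (antihol (g (b 2))),
    ← mul_assoc (antihol (g (b 2))), h2]
  simp

theorem hodgeFibre_one (g : V ≃ₗ[ℂ] ConjDual V) (vol : FormAlg V) : hodgeFibre g vol 1 = vol := by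
  simp [hodgeFibre]

theorem hodgeFibre_mul_ι (g : V ≃ₗ[ℂ] ConjDual V) (vol x : FormAlg V)
    (m : Module.Dual ℂ V × ConjDual V) :
    hodgeFibre g vol (x * ι ℂ m) = contr (covectorPairing g m) (hodgeFibre g vol x) := by
  have h : CliffordAlgebra.reverse (x * ι ℂ m) = ι ℂ m * CliffordAlgebra.reverse x :=
    (CliffordAlgebra.reverse.map_mul _ _).trans
      (congrArg (· * _) (CliffordAlgebra.reverse_ι m))
  simp only [hodgeFibre, LinearMap.comp_apply, h, AlgHom.toLinearMap_apply, map_mul,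
    ExteriorAlgebra.lift_ι_apply, LinearMap.applyₗ_apply_apply, Module.End.mul_apply]
  rfl

/-- Forms of type `(3,0)` are eigenvectors of the star. The eigenvalue `-i` is the origin of the
scalar in the formula for the transported star. -/
theorem hodgeFibre_topForm (b : Module.Basis (Fin 3) ℂ V) (g : V ≃ₗ[ℂ] ConjDual V) :
    hodgeFibre g ((1 / 6 : ℂ) • kahlerFibre b g ^ 3) (topForm b) = (-I) • topForm b := by
  have h : topForm b = 1 * hol (b.coord 0) * hol (b.coord 1) * hol (b.coord 2) := by
    rw [one_mul, topForm]
  conv_lhs => rw [h, kahlerFibre_pow]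
  simp only [hol, hodgeFibre_mul_ι, hodgeFibre_one]
  simp only [antihol, mul_assoc, contr_ι_mul, contr_ι, map_smul, covectorPairing_apply,
    LinearEquiv.symm_apply_apply, Module.Basis.coord_apply, Module.Basis.repr_self]
  simp [contr_ι_mul, topForm, hol, mul_assoc]

/-! ### The `sl₂` triple of the metric and the transported Hodge star -/

/-- The endomorphism `(v, k) ↦ (g⁻¹ k, -g v)`. -/
def jMap (g : V ≃ₗ[ℂ] ConjDual V) : Module.End ℂ (V × ConjDual V) :=
  LinearMap.prod (g.symm.toLinearMap ∘ₗ LinearMap.snd ℂ V (ConjDual V))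
    (-(g.toLinearMap ∘ₗ LinearMap.fst ℂ V (ConjDual V)))

@[simp] theorem jMap_apply (g : V ≃ₗ[ℂ] ConjDual V) (m : V × ConjDual V) :
    jMap g m = (g.symm m.2, -g m.1) := rfl

/-- The endomorphism `(v, k) ↦ (0, g v)`. -/
def eMap (g : V ≃ₗ[ℂ] ConjDual V) : Module.End ℂ (V × ConjDual V) :=
  LinearMap.prod 0 (g.toLinearMap ∘ₗ LinearMap.fst ℂ V (ConjDual V))

@[simp] theorem eMap_apply (g : V ≃ₗ[ℂ] ConjDual V) (m : V × ConjDual V) :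
    eMap g m = (0, g m.1) := rfl

/-- The endomorphism `(v, k) ↦ (g⁻¹ k, 0)`. -/
def fMap (g : V ≃ₗ[ℂ] ConjDual V) : Module.End ℂ (V × ConjDual V) :=
  LinearMap.prod (g.symm.toLinearMap ∘ₗ LinearMap.snd ℂ V (ConjDual V)) 0

@[simp] theorem fMap_apply (g : V ≃ₗ[ℂ] ConjDual V) (m : V × ConjDual V) :
    fMap g m = (g.symm m.2, 0) := rfl

variable (V) in
/-- The endomorphism `(v, k) ↦ (-v, k)`. -/
def kMap : Module.End ℂ (V × ConjDual V) :=
  LinearMap.prod (-LinearMap.fst ℂ V (ConjDual V)) (LinearMap.snd ℂ V (ConjDual V))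

@[simp] theorem kMap_apply (m : V × ConjDual V) : kMap V m = (-m.1, m.2) := rfl

variable (g : V ≃ₗ[ℂ] ConjDual V)

theorem eMap_sq : eMap g * eMap g = 0 := LinearMap.ext fun m => by simp

theorem fMap_sq : fMap g * fMap g = 0 := LinearMap.ext fun m => by simp

theorem eMap_fMap : eMap g * fMap g - fMap g * eMap g = kMap V := LinearMap.ext fun m => by simp

/-- The factorisation of the Weyl element of `SL₂` into elementary matrices. -/
theorem jMap_eq : jMap g = (1 + -eMap g) * (1 + fMap g) * (1 + -eMap g) :=
  LinearMap.ext fun m => by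
    simp only [Module.End.mul_apply, LinearMap.add_apply, LinearMap.neg_apply, eMap_apply,
      fMap_apply, Module.End.one_apply, jMap_apply]
    ext <;> simp

theorem map_jMap_jMap (x : PolyAlg V) :
    ExteriorAlgebra.map (jMap g) (ExteriorAlgebra.map (jMap g) x) = inv x := by
  induction x using exterior_induction with
  | one => simp
  | smul r x hx => simp [hx]
  | add x y hx hy => simp only [map_add, hx, hy]
  | ι_mul m x hx =>
    rw [map_mul, map_mul, hx, map_mul, map_apply_ι, map_apply_ι, inv_ι, ← map_neg]
    congr 2
    exact Prod.ext (by simp) (by simp)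

theorem hodgeFibre_ι_mul (vol y : FormAlg V) (m : Module.Dual ℂ V × ConjDual V) :
    hodgeFibre g vol (ι ℂ m * y) = contr (covectorPairing g m) (hodgeFibre g vol (inv y)) := by
  rw [ι_mul_eq, hodgeFibre_mul_ι]

/-- The dual of `hodgeFibre_mul_ι`: the star also turns contractions into products, because the
pairing is symmetric and `k ∧ vol = 0`. The induction splits off factors on the right, where the
star is defined recursively. -/
theorem hodgeFibre_contr {vol : FormAlg V} {k : ConjDual V} (hk : antihol k * vol = 0)
    (y : FormAlg V) : hodgeFibre g vol (contr (covectorPairing g (0, k)) y) =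
      -(antihol k * hodgeFibre g vol (inv y)) := by
  induction y using exterior_induction_right with
  | one => simp [hodgeFibre_one, hk]
  | smul r x hx => simp [hx]
  | add x y hx hy => simp only [map_add, hx, hy, mul_add]; abel
  | mul_ι m x hx =>
    have h : covectorPairing g (0, k) m = covectorPairing g m (0, k) := by simp
    rw [contr_mul, map_add, hodgeFibre_mul_ι, hx, contr_ι, ← Algebra.commutes,
      ← Algebra.smul_def, map_smul, map_mul inv, inv_ι, mul_neg, map_neg, map_neg,
      hodgeFibre_mul_ι, antihol, contr_ι_mul, h]
    simp

/-- Under `ρ` a vector acts by contraction and a conjugate covector by multiplication. The star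
exchanges these two kinds of operators by means of `g`, which is the effect of `jMap g` on
generators, and it reverses their order. -/
theorem hodgeFibre_rhoFibre {Ω vol : FormAlg V} {c : ℂ} (hΩ : hodgeFibre g vol Ω = c • Ω)
    (hinv : inv Ω = -Ω) (hk : ∀ k, antihol k * vol = 0) (α : PolyAlg V) :
    hodgeFibre g vol (rhoFibre Ω α) =
      c • rhoFibre Ω (ExteriorAlgebra.map (jMap g) (rev α)) := by
  suffices h : (hodgeFibre g vol (rhoFibre Ω α) =
      c • rhoFibre Ω (ExteriorAlgebra.map (jMap g) (rev α))) ∧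
      hodgeFibre g vol (rhoFibre Ω (inv α)) =
      c • rhoFibre Ω (ExteriorAlgebra.map (jMap g) (rev (inv α))) from h.1
  have key : ∀ (m : V × ConjDual V) (x : PolyAlg V), (hodgeFibre g vol (rhoFibre Ω (inv x)) =
      c • rhoFibre Ω (ExteriorAlgebra.map (jMap g) (rev (inv x)))) →
      hodgeFibre g vol (rhoFibre Ω (ι ℂ m * x)) =
      c • rhoFibre Ω (ExteriorAlgebra.map (jMap g) (rev (ι ℂ m * x))) := by
    intro m x hx
    have h1 : evalFst m.1 = covectorPairing g (0, g m.1) := LinearMap.ext fun a => by simp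
    have h2 : covectorPairing g (0, m.2) = evalFst (g.symm m.2) := LinearMap.ext fun a => by simp
    rw [rhoFibre_ι_mul, map_sub, h1, hodgeFibre_contr g (hk _), antihol, antihol,
      hodgeFibre_ι_mul, inv_rhoFibre hinv, map_neg, hx, h2, rev_ι_mul, map_mul, map_apply_ι,
      rhoFibre_ι_mul, jMap_apply]
    simp only [antihol]
    have h3 : ι ℂ ((0 : Module.Dual ℂ V), -g m.1) = -ι ℂ ((0 : Module.Dual ℂ V), g m.1) := by
      rw [← LinearMap.map_neg (ι ℂ)]
      exact congrArg _ (Prod.ext neg_zero.symm rfl)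
    rw [h3]
    simp only [map_neg, map_smul, mul_neg, neg_mul, mul_smul_comm, smul_sub, smul_neg]
    abel
  induction α using exterior_induction with
  | one => simp [rhoFibre_one, hΩ]
  | smul r x hx => simp [hx, smul_comm r c]
  | add x y hx hy => simp [hx, hy]
  | ι_mul m x hx =>
    refine ⟨key m x hx.2, ?_⟩
    have h := key (-m) (inv x) (by simpa using hx.1)
    rw [map_neg, ← inv_ι, ← map_mul] at h
    exact h

/-- The Lefschetz operator of the metric is, up to `i`, the raising operator of the `sl₂` triple.
This is how closedness of `ω` becomes a commutation relation. -/
theorem kahlerFibre_mul_rhoFibre {n : ℕ} (b : Module.Basis (Fin n) ℂ V) {Ω : FormAlg V}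
    (hΩ : ∀ f, hol f * Ω = 0) (α : PolyAlg V) :
    kahlerFibre b g * rhoFibre Ω α = I • rhoFibre Ω (derExt (eMap g) α) := by
  -- The derivation is written as the first-order operator `∑ g(b_i) ∂/∂θ_i`, the form in which `ω
  -- ∧` appears.
  have h : ∀ x, derExt (eMap g) x =
      ∑ i, ι ℂ (0, g (b i)) * contr (b.coord i ∘ₗ LinearMap.fst ℂ V (ConjDual V)) x := by
    intro x
    induction x using exterior_induction with
    | one => simp
    | smul r x hx => rw [map_smul, hx, Finset.smul_sum]; simp
    | add x y hx hy => rw [map_add, hx, hy, ← Finset.sum_add_distrib]; simp [mul_add]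
    | ι_mul m x hx =>
      rw [derExt_ι_mul, hx]
      simp only [contr_ι_mul, mul_sub, Finset.sum_sub_distrib, Finset.mul_sum, ← mul_assoc,
        ι_mul_ι m, neg_mul, Finset.sum_neg_distrib]
      rw [sub_eq_add_neg, add_left_inj]
      have h1 : eMap g m = ∑ i, b.coord i m.1 • ((0 : V), g (b i)) := by
        have h2 : m.1 = ∑ i, b.coord i m.1 • b i := by simp
        let L : V →ₗ[ℂ] V × ConjDual V := LinearMap.inr ℂ V (ConjDual V) ∘ₗ g.toLinearMap
        have h3 := congrArg L h2
        rw [map_sum] at h3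
        exact h3.trans (Finset.sum_congr rfl fun i _ => map_smul L _ _)
      rw [h1, map_sum, Finset.sum_mul]
      exact Finset.sum_congr rfl fun i _ => by
        rw [map_smul, smul_mul_assoc, mul_smul_comm]; rfl
  rw [h, map_sum, kahlerFibre, smul_mul_assoc, Finset.sum_mul]
  congr 1
  refine Finset.sum_congr rfl fun i _ => ?_
  rw [mul_assoc, antihol_mul_rhoFibre, mul_neg, hol_mul_rhoFibre (hΩ _), contr_ι_mul]
  simp

end FibreMaps

/-! # Gradings of the fibres -/

section Gradings

open ExteriorAlgebra

variable {M N : Type*} [AddCommGroup M] [Module ℂ M] [AddCommGroup N] [Module ℂ N]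

/-- The subspace `L` is left general so that the same induction serves `⋀^p V`, `⋀^q V̄*` and the
full exterior power. -/
theorem mem_pow_induction {L : Submodule ℂ M} {P : ℕ → ExteriorAlgebra ℂ M → Prop} (one : P 0 1)
    (smul : ∀ n (r : ℂ) x, P n x → P n (r • x)) (add : ∀ n x y, P n x → P n y → P n (x + y))
    (ι_mul : ∀ n, ∀ m ∈ L, ∀ x ∈ L.map (ι ℂ) ^ n, P n x → P (n + 1) (ι ℂ m * x)) {n : ℕ}
    {x : ExteriorAlgebra ℂ M} (hx : x ∈ L.map (ι ℂ) ^ n) : P n x := by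
  induction hx using Submodule.pow_induction_on_left' with
  | algebraMap r => rw [Algebra.algebraMap_eq_smul_one]; exact smul 0 r 1 one
  | add x y i hx hy h h' => exact add i x y h h'
  | mem_mul m hm i x hx h =>
    obtain ⟨m, hm, rfl⟩ := hm
    exact ι_mul i m hm x hx h

theorem exteriorPower_eq (n : ℕ) :
    (⋀[ℂ]^n M : Submodule ℂ (ExteriorAlgebra ℂ M)) = (⊤ : Submodule ℂ M).map (ι ℂ) ^ n := by
  rw [Submodule.map_top]

theorem inv_of_mem {L : Submodule ℂ M} {n : ℕ} {x : ExteriorAlgebra ℂ M}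
    (hx : x ∈ L.map (ι ℂ) ^ n) : inv x = (-1 : ℂ) ^ n • x := by
  refine mem_pow_induction (P := fun n x => inv x = (-1 : ℂ) ^ n • x) (by simp) ?_ ?_ ?_ hx
  · intro n r x h; rw [map_smul, h, smul_comm]
  · intro n x y h h'; rw [map_add, h, h', smul_add]
  · intro n m _ x _ h; rw [map_mul, h, inv_ι, pow_succ]; simp

theorem graded_comm {L L' : Submodule ℂ M} {m n : ℕ} {x y : ExteriorAlgebra ℂ M}
    (hx : x ∈ L.map (ι ℂ) ^ m) (hy : y ∈ L'.map (ι ℂ) ^ n) :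
    y * x = (-1 : ℂ) ^ (m * n) • (x * y) := by
  refine mem_pow_induction (P := fun m x => y * x = (-1 : ℂ) ^ (m * n) • (x * y)) (by simp)
    ?_ ?_ ?_ hx
  · intro m r x h; rw [mul_smul_comm, h, smul_mul_assoc, smul_comm]
  · intro m x z h h'; rw [mul_add, h, h', add_mul, smul_add]
  · intro m a _ x _ h
    have h1 : y * ι ℂ a = (-1 : ℂ) ^ n • (ι ℂ a * y) := by
      rw [ι_mul_eq, inv_of_mem hy, smul_mul_assoc, smul_smul, ← mul_pow]
      simp
    rw [← mul_assoc, h1, smul_mul_assoc, mul_assoc, h, mul_smul_comm, smul_smul, ← pow_add,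
      ← mul_assoc]
    ring_nf

theorem exists_rev_eq {L : Submodule ℂ M} {n : ℕ} {x : ExteriorAlgebra ℂ M}
    (hx : x ∈ L.map (ι ℂ) ^ n) : rev x ∈ L.map (ι ℂ) ^ n := by
  refine mem_pow_induction (P := fun n x => rev x ∈ L.map (ι ℂ) ^ n) (by simp) ?_ ?_ ?_ hx
  · intro n r x h; rw [map_smul]; exact Submodule.smul_mem _ _ h
  · intro n x y h h'; rw [map_add]; exact Submodule.add_mem _ h h'
  · intro n m hm x hx h
    rw [rev_ι_mul, inv_of_mem hx, map_smul, mul_smul_comm, pow_succ']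
    exact Submodule.smul_mem _ _ (Submodule.mul_mem_mul (Submodule.mem_map_of_mem hm) h)

theorem map_mem {L : Submodule ℂ M} {L' : Submodule ℂ N} {A : M →ₗ[ℂ] N}
    (hA : ∀ m ∈ L, A m ∈ L') {n : ℕ} {x : ExteriorAlgebra ℂ M} (hx : x ∈ L.map (ι ℂ) ^ n) :
    ExteriorAlgebra.map A x ∈ L'.map (ι ℂ) ^ n := by
  refine mem_pow_induction (P := fun n x => ExteriorAlgebra.map A x ∈ L'.map (ι ℂ) ^ n) (by simp)
    ?_ ?_ ?_ hx
  · intro n r x h; rw [map_smul]; exact Submodule.smul_mem _ _ h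
  · intro n x y h h'; rw [map_add]; exact Submodule.add_mem _ h h'
  · intro n m hm x hx h
    rw [map_mul, map_apply_ι, pow_succ']
    exact Submodule.mul_mem_mul (Submodule.mem_map_of_mem (hA m hm)) h

/-- The subtraction in `n - 1` is truncated; the second clause records what happens in degree zero
and is needed in the inductive step. -/
theorem contr_mem {L : Submodule ℂ M} (d : Module.Dual ℂ M) {n : ℕ} {x : ExteriorAlgebra ℂ M}
    (hx : x ∈ L.map (ι ℂ) ^ n) : contr d x ∈ L.map (ι ℂ) ^ (n - 1) ∧ (n = 0 → contr d x = 0) := by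
  refine mem_pow_induction (P := fun n x => contr d x ∈ L.map (ι ℂ) ^ (n - 1) ∧
    (n = 0 → contr d x = 0)) (by simp) ?_ ?_ ?_ hx
  · intro n r x h
    rw [map_smul]
    exact ⟨Submodule.smul_mem _ _ h.1, fun hn => by rw [h.2 hn, smul_zero]⟩
  · intro n x y h h'
    rw [map_add]
    exact ⟨Submodule.add_mem _ h.1 h'.1, fun hn => by rw [h.2 hn, h'.2 hn, zero_add]⟩
  · intro n m hm x hx h
    refine ⟨?_, fun hn => (Nat.succ_ne_zero n hn).elim⟩
    rw [contr_ι_mul, Nat.add_sub_cancel]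
    refine Submodule.sub_mem _ (Submodule.smul_mem _ _ hx) ?_
    rcases Nat.eq_zero_or_pos n with hn | hn
    · rw [h.2 hn, mul_zero]; exact Submodule.zero_mem _
    · conv in _ ^ n => rw [← Nat.sub_add_cancel hn, pow_succ']
      exact Submodule.mul_mem_mul (Submodule.mem_map_of_mem hm) h.1

theorem contr_eq_zero {L : Submodule ℂ M} {d : Module.Dual ℂ M} (hd : ∀ m ∈ L, d m = 0) {n : ℕ}
    {x : ExteriorAlgebra ℂ M} (hx : x ∈ L.map (ι ℂ) ^ n) : contr d x = 0 := by
  refine mem_pow_induction (P := fun n x => contr d x = 0) (by simp) ?_ ?_ ?_ hx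
  · intro n r x h; rw [map_smul, h, smul_zero]
  · intro n x y h h'; rw [map_add, h, h', zero_add]
  · intro n m hm x hx h; rw [contr_ι_mul, h, hd m hm, zero_smul, mul_zero, sub_zero]

variable {V W : Type*} [AddCommGroup V] [Module ℂ V] [AddCommGroup W] [Module ℂ W]

variable (V) in
/-- The subspace `V` of `V ⊕ V̄*`. -/
abbrev holPart : Submodule ℂ (V × ConjDual V) := LinearMap.range (LinearMap.inl ℂ V (ConjDual V))

variable (V) in
/-- The subspace `V̄*` of `V ⊕ V̄*`. -/
abbrev antiPart : Submodule ℂ (V × ConjDual V) := LinearMap.range (LinearMap.inr ℂ V (ConjDual V))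

theorem polyBidegree_eq (p q : ℕ) :
    polyBidegree V p q = (holPart V).map (ι ℂ) ^ p * (antiPart V).map (ι ℂ) ^ q := by
  rw [polyBidegree, LinearMap.range_comp, LinearMap.range_comp]

@[elab_as_elim]
theorem polyBidegree_induction {p q : ℕ} {P : PolyAlg V → Prop}
    (add : ∀ x y, P x → P y → P (x + y))
    (mul : ∀ x ∈ (holPart V).map (ι ℂ) ^ p, ∀ y ∈ (antiPart V).map (ι ℂ) ^ q, P (x * y))
    {x : PolyAlg V} (hx : x ∈ polyBidegree V p q) : P x := by
  rw [polyBidegree_eq] at hx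
  exact Submodule.mul_induction_on hx mul add

theorem mul_mem_polyBidegree {p q : ℕ} {x y : PolyAlg V} (hx : x ∈ (holPart V).map (ι ℂ) ^ p)
    (hy : y ∈ (antiPart V).map (ι ℂ) ^ q) : x * y ∈ polyBidegree V p q := by
  rw [polyBidegree_eq]
  exact Submodule.mul_mem_mul hx hy

theorem contr_fst_eq_zero (f : Module.Dual ℂ V) {n : ℕ} {x : PolyAlg V}
    (hx : x ∈ (antiPart V).map (ι ℂ) ^ n) :
    contr (f ∘ₗ LinearMap.fst ℂ V (ConjDual V)) x = 0 := by
  refine contr_eq_zero ?_ hx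
  rintro _ ⟨k, rfl⟩
  simp

theorem contr_mem_polyBidegree (f : Module.Dual ℂ V) {p q : ℕ} {x : PolyAlg V}
    (hx : x ∈ polyBidegree V (p + 1) q) :
    contr (f ∘ₗ LinearMap.fst ℂ V (ConjDual V)) x ∈ polyBidegree V p q := by
  refine polyBidegree_induction (fun x y hx hy => ?_) (fun x hx y hy => ?_) hx
  · rw [map_add]; exact Submodule.add_mem _ hx hy
  · rw [contr_mul, contr_fst_eq_zero f hy, mul_zero, add_zero]
    exact mul_mem_polyBidegree (contr_mem _ hx).1 hy

theorem contr_polyBidegree_zero (f : Module.Dual ℂ V) {q : ℕ} {x : PolyAlg V}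
    (hx : x ∈ polyBidegree V 0 q) : contr (f ∘ₗ LinearMap.fst ℂ V (ConjDual V)) x = 0 := by
  refine polyBidegree_induction (fun x y hx hy => ?_) (fun x hx y hy => ?_) hx
  · rw [map_add, hx, hy, add_zero]
  · rw [contr_mul, contr_fst_eq_zero f hy, mul_zero, add_zero, (contr_mem _ hx).2 rfl, zero_mul]

theorem ι_mul_mem_polyBidegree (k : ConjDual V) {p q : ℕ} {x : PolyAlg V}
    (hx : x ∈ polyBidegree V p q) : ι ℂ ((0 : V), k) * x ∈ polyBidegree V p (q + 1) := by
  refine polyBidegree_induction (fun x y hx hy => ?_) (fun x hx y hy => ?_) hx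
  · rw [mul_add]; exact Submodule.add_mem _ hx hy
  · rw [← mul_assoc, ι_mul_eq, inv_of_mem hx, smul_mul_assoc, smul_mul_assoc, mul_assoc]
    refine Submodule.smul_mem _ _ (mul_mem_polyBidegree hx ?_)
    rw [pow_succ']
    exact Submodule.mul_mem_mul (Submodule.mem_map_of_mem ⟨k, rfl⟩) hy

theorem jMap_mem_polyBidegree (g : V ≃ₗ[ℂ] ConjDual V) {p q : ℕ} {x : PolyAlg V}
    (hx : x ∈ polyBidegree V p q) :
    ExteriorAlgebra.map (jMap g) (rev x) ∈ polyBidegree V q p := by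
  refine polyBidegree_induction (fun x y hx hy => ?_) (fun x hx y hy => ?_) hx
  · rw [map_add, map_add]; exact Submodule.add_mem _ hx hy
  · have h : rev (x * y) = rev y * rev x := CliffordAlgebra.reverse.map_mul _ _
    rw [h, map_mul]
    refine mul_mem_polyBidegree (map_mem ?_ (exists_rev_eq hy)) (map_mem ?_ (exists_rev_eq hx))
    · rintro _ ⟨k, rfl⟩
      exact ⟨g.symm k, by ext <;> simp⟩
    · rintro _ ⟨v, rfl⟩
      exact ⟨-g v, by ext <;> simp⟩

theorem polyMap_mem_polyBidegree (f : V →ₗ[ℂ] W) (f' : W →ₗ[ℂ] V) {p q : ℕ} {x : PolyAlg V}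
    (hx : x ∈ polyBidegree V p q) : polyMap f f' x ∈ polyBidegree W p q := by
  refine polyBidegree_induction (fun x y hx hy => ?_) (fun x hx y hy => ?_) hx
  · rw [map_add]; exact Submodule.add_mem _ hx hy
  · rw [map_mul]
    refine mul_mem_polyBidegree (map_mem ?_ hx) (map_mem ?_ hy)
    · rintro _ ⟨v, rfl⟩
      exact ⟨f v, by ext <;> simp⟩
    · rintro _ ⟨k, rfl⟩
      exact ⟨conjPull f' k, by ext <;> simp⟩

theorem map_mem_exteriorPower (A : M →ₗ[ℂ] N) {n : ℕ} {x : ExteriorAlgebra ℂ M}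
    (hx : x ∈ ⋀[ℂ]^n M) : ExteriorAlgebra.map A x ∈ ⋀[ℂ]^n N := by
  rw [exteriorPower_eq] at hx ⊢
  exact map_mem (fun _ _ => Submodule.mem_top) hx

theorem rev_mem_exteriorPower {n : ℕ} {x : ExteriorAlgebra ℂ M} (hx : x ∈ ⋀[ℂ]^n M) :
    rev x ∈ ⋀[ℂ]^n M := by
  rw [exteriorPower_eq] at hx ⊢
  exact exists_rev_eq hx

/-- The homogeneous component of an element of the exterior algebra. -/
def component (n : ℕ) : ExteriorAlgebra ℂ M →ₗ[ℂ] ExteriorAlgebra ℂ M :=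
  GradedAlgebra.proj (fun i : ℕ => ⋀[ℂ]^i M) n

theorem component_mem (n : ℕ) (x : ExteriorAlgebra ℂ M) : component n x ∈ ⋀[ℂ]^n M :=
  Submodule.coe_mem _

/-- Naturality of the grading, from which the homogeneous components of a smooth section are smooth.
-/
theorem map_component (A : M →ₗ[ℂ] N) (n : ℕ) (x : ExteriorAlgebra ℂ M) :
    ExteriorAlgebra.map A (component n x) = component n (ExteriorAlgebra.map A x) := by
  induction x using DirectSum.Decomposition.inductionOn (fun i : ℕ => ⋀[ℂ]^i M) with
  | zero => simp
  | @homogeneous i x =>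
    have hx := map_mem_exteriorPower A x.2
    simp only [component, GradedAlgebra.proj_apply]
    by_cases h : i = n
    · subst h
      rw [DirectSum.decompose_of_mem_same (fun i : ℕ => ⋀[ℂ]^i M) x.2,
        DirectSum.decompose_of_mem_same (fun i : ℕ => ⋀[ℂ]^i N) hx]
    · rw [DirectSum.decompose_of_mem_ne (fun i : ℕ => ⋀[ℂ]^i M) x.2 h,
        DirectSum.decompose_of_mem_ne (fun i : ℕ => ⋀[ℂ]^i N) hx h, map_zero]
  | add x y hx hy => simp only [map_add, hx, hy]

theorem iSupIndep_exteriorPower : iSupIndep fun n : ℕ => ⋀[ℂ]^n M :=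
  (DirectSum.Decomposition.isInternal fun i : ℕ => ⋀[ℂ]^i M).submodule_iSupIndep

/-- In a finite-dimensional algebra only finitely many of the independent graded pieces are nonzero,
so one finite set of degrees works for all elements. -/
theorem exists_sum_component [Module.Finite ℂ (ExteriorAlgebra ℂ M)] :
    ∃ s : Finset ℕ, ∀ x : ExteriorAlgebra ℂ M, ∑ n ∈ s, component n x = x := by
  have hfin := WellFoundedGT.finite_ne_bot_of_iSupIndep (iSupIndep_exteriorPower (M := M))
  refine ⟨hfin.toFinset, fun x => ?_⟩
  classical
  conv_rhs => rw [← DirectSum.sum_support_decompose (fun i : ℕ => ⋀[ℂ]^i M) x]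
  symm
  refine Finset.sum_subset ?_ ?_
  · intro n hn
    rw [Set.Finite.mem_toFinset]
    intro h
    have hn' := DFinsupp.mem_support_iff.1 hn
    refine hn' (Subtype.ext ?_)
    have h2 := (DirectSum.decompose (fun i : ℕ => ⋀[ℂ]^i M) x n).2
    exact (Submodule.mem_bot ℂ).1 (h.le h2)
  · intro n _ hn
    rw [DFinsupp.notMem_support_iff] at hn
    exact congrArg Subtype.val hn

end Gradings

/-! # Holomorphic functions of several variables are smooth -/

section Holomorphic

open Metric Filter Topology MeasureTheory Complex

variable {G : Type*} [NormedAddCommGroup G] [NormedSpace ℂ G]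

theorem hasDerivAt_line {f : G → ℂ} {y w : G} {t : ℂ} (h : DifferentiableAt ℂ f (y + t • w)) :
    HasDerivAt (fun t : ℂ => f (y + t • w)) (fderiv ℂ f (y + t • w) w) t := by
  have h1 : HasDerivAt (fun t : ℂ => y + t • w) w t := by
    simpa using ((hasDerivAt_id t).smul_const w).const_add y
  exact h.hasFDerivAt.comp_hasDerivAt t h1

/-- Cauchy's estimate on the complex line through `y` in the direction `w`, on the disc of radius `ε
/ ‖w‖`. -/
theorem norm_fderiv_le_of_bounded {f : G → ℂ} {y : G} {ε C : ℝ} (hε : 0 < ε)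
    (hf : ∀ x ∈ closedBall y ε, DifferentiableAt ℂ f x) (hC : ∀ x ∈ closedBall y ε, ‖f x‖ ≤ C) :
    ‖fderiv ℂ f y‖ ≤ C / ε := by
  have hC0 : 0 ≤ C := (norm_nonneg _).trans (hC y (mem_closedBall_self hε.le))
  refine ContinuousLinearMap.opNorm_le_bound _ (by positivity) fun w => ?_
  rcases eq_or_ne w 0 with rfl | hw
  · simp
  have hw' : 0 < ‖w‖ := norm_pos_iff.2 hw
  have hr : 0 < ε / ‖w‖ := by positivity
  have hmem : ∀ t ∈ closedBall (0 : ℂ) (ε / ‖w‖), y + t • w ∈ closedBall y ε := by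
    intro t ht
    rw [mem_closedBall, dist_zero_right] at ht
    rw [mem_closedBall, dist_eq_norm, add_sub_cancel_left, norm_smul]
    calc ‖t‖ * ‖w‖ ≤ ε / ‖w‖ * ‖w‖ := by gcongr
      _ = ε := by field_simp
  have hd : DiffContOnCl ℂ (fun t : ℂ => f (y + t • w)) (ball 0 (ε / ‖w‖)) := by
    refine DifferentiableOn.diffContOnCl fun t ht => ?_
    rw [closure_ball _ hr.ne'] at ht
    exact (hasDerivAt_line (hf _ (hmem t ht))).differentiableAt.differentiableWithinAt
  have h := Complex.norm_deriv_le_of_forall_mem_sphere_norm_le hr hd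
    fun t ht => hC _ (hmem t (sphere_subset_closedBall ht))
  have h0 := hasDerivAt_line (f := f) (y := y) (w := w) (t := 0)
    (hf _ (hmem 0 (mem_closedBall_self hr.le)))
  rw [h0.deriv] at h
  simp only [zero_smul, add_zero] at h
  refine h.trans (le_of_eq ?_)
  field_simp

/-- Cauchy's formula on complex lines writes the directional derivative as an integral of values of
`f`. It can be differentiated under the integral sign using only first derivatives of `f`, which
Cauchy's estimate bounds. -/
theorem differentiableAt_fderiv_apply [FiniteDimensional ℂ G]
    {f : G → ℂ} {U : Set G} (hU : IsOpen U) (hf : DifferentiableOn ℂ f U) (v : G) {z₀ : G}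
    (hz : z₀ ∈ U) : DifferentiableAt ℂ (fun z => fderiv ℂ f z v) z₀ := by
  borelize G
  have hproper : ProperSpace G := FiniteDimensional.proper ℂ G
  have hproper' : ProperSpace (G →L[ℂ] ℂ) := FiniteDimensional.proper ℂ _
  obtain ⟨ε', hε', hball⟩ := Metric.nhds_basis_closedBall.mem_iff.1 (hU.mem_nhds hz)
  -- Three radii are spent: moving the base point, going round the circle, and applying Cauchy's
  -- estimate.
  obtain ⟨ε, hε, rfl⟩ : ∃ ε, 0 < ε ∧ ε' = 3 * ε := ⟨ε' / 3, by positivity, by ring⟩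
  have hda : ∀ x ∈ closedBall z₀ (3 * ε), DifferentiableAt ℂ f x := fun x hx =>
    hf.differentiableAt (hU.mem_nhds (hball hx))
  obtain ⟨C, hC⟩ := (isCompact_closedBall z₀ (3 * ε)).exists_bound_of_continuousOn
    fun x hx => (hda x hx).continuousAt.continuousWithinAt
  -- The `+ 1` avoids division by zero and still gives `δ * ‖v‖ ≤ ε`.
  set δ : ℝ := ε / (‖v‖ + 1) with hδ
  have hv : 0 < ‖v‖ + 1 := by positivity
  have hδ0 : 0 < δ := by positivity
  have hδv : δ * ‖v‖ ≤ ε := by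
    rw [hδ, div_mul_eq_mul_div, div_le_iff₀ hv]
    nlinarith [norm_nonneg v]
  have hmem : ∀ z ∈ ball z₀ ε, ∀ t ∈ closedBall (0 : ℂ) δ, z + t • v ∈ closedBall z₀ (2 * ε) := by
    intro z hz t ht
    rw [mem_ball, dist_eq_norm] at hz
    rw [mem_closedBall, dist_zero_right] at ht
    rw [mem_closedBall, dist_eq_norm]
    calc ‖z + t • v - z₀‖ = ‖(z - z₀) + t • v‖ := by congr 1; abel
      _ ≤ ‖z - z₀‖ + ‖t • v‖ := norm_add_le _ _
      _ ≤ ε + δ * ‖v‖ := by rw [norm_smul]; gcongr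
      _ ≤ 2 * ε := by linarith
  have hcirc : ∀ θ : ℝ, circleMap 0 δ θ ∈ closedBall (0 : ℂ) δ := fun θ =>
    circleMap_mem_closedBall 0 hδ0.le θ
  set a : ℝ → ℂ := fun θ => deriv (circleMap 0 δ) θ * ((circleMap 0 δ θ) ^ 2)⁻¹ with ha
  have hne : ∀ θ, circleMap 0 δ θ ≠ 0 := fun θ => circleMap_ne_center hδ0.ne'
  have hacont : Continuous a := by
    simp only [ha, deriv_circleMap]
    exact ((continuous_circleMap 0 δ).mul continuous_const).mul
      (((continuous_circleMap 0 δ).pow 2).inv₀ fun θ => pow_ne_zero 2 (hne θ))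
  have hcauchy : ∀ z ∈ ball z₀ ε, fderiv ℂ f z v = (2 * Real.pi * I : ℂ)⁻¹ •
      ∫ θ in (0 : ℝ)..2 * Real.pi, a θ * f (z + circleMap 0 δ θ • v) := by
    intro z hz
    have hopen : IsOpen {t : ℂ | z + t • v ∈ U} :=
      hU.preimage (by fun_prop : Continuous fun t : ℂ => z + t • v)
    have h1 : DifferentiableOn ℂ (fun t : ℂ => f (z + t • v)) {t : ℂ | z + t • v ∈ U} :=
      fun t ht => (hasDerivAt_line
        (hf.differentiableAt (hU.mem_nhds ht))).differentiableAt.differentiableWithinAt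
    have hsub : closedBall z₀ (2 * ε) ⊆ U :=
      (closedBall_subset_closedBall (by linarith)).trans hball
    have h2 := two_pi_I_inv_smul_circleIntegral_sub_sq_inv_smul_of_differentiable hopen
      (fun t ht => hsub (hmem z hz t ht)) h1 (mem_ball_self hδ0 : (0 : ℂ) ∈ ball 0 δ)
    have h3 := hasDerivAt_line (f := f) (y := z) (w := v) (t := 0)
      (hf.differentiableAt (hU.mem_nhds (hsub (hmem z hz 0 (mem_closedBall_self hδ0.le)))))
    rw [h3.deriv] at h2
    simp only [zero_smul, add_zero, sub_zero] at h2
    rw [← h2, circleIntegral]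
    congr 1
    refine intervalIntegral.integral_congr fun θ _ => ?_
    simp only [ha, smul_eq_mul]
    ring
  have hder : HasFDerivAt (fun z => ∫ θ in (0 : ℝ)..2 * Real.pi, a θ * f (z + circleMap 0 δ θ • v))
      (∫ θ in (0 : ℝ)..2 * Real.pi, a θ • fderiv ℂ f (z₀ + circleMap 0 δ θ • v)) z₀ := by
    refine intervalIntegral.hasFDerivAt_integral_of_dominated_of_fderiv_le
      (F := fun z θ => a θ * f (z + circleMap 0 δ θ • v))
      (F' := fun z θ => a θ • fderiv ℂ f (z + circleMap 0 δ θ • v))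
      (bound := fun θ => ‖a θ‖ * (C / ε)) (ball_mem_nhds z₀ hε) ?_ ?_ ?_ ?_ ?_ ?_
    · filter_upwards [ball_mem_nhds z₀ hε] with z hz
      refine Continuous.aestronglyMeasurable (hacont.mul ?_)
      refine continuous_iff_continuousAt.2 fun θ => ?_
      have h1 := hda _ (closedBall_subset_closedBall (by linarith) (hmem z hz _ (hcirc θ)))
      exact ContinuousAt.comp (f := fun θ => z + circleMap 0 δ θ • v) h1.continuousAt
        (continuous_const.add ((continuous_circleMap 0 δ).smul continuous_const)).continuousAt
    · refine Continuous.intervalIntegrable (hacont.mul ?_) _ _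
      refine continuous_iff_continuousAt.2 fun θ => ?_
      have h1 := hda _ (closedBall_subset_closedBall (by linarith)
        (hmem z₀ (mem_ball_self hε) _ (hcirc θ)))
      exact ContinuousAt.comp (f := fun θ => z₀ + circleMap 0 δ θ • v) h1.continuousAt
        (continuous_const.add ((continuous_circleMap 0 δ).smul continuous_const)).continuousAt
    -- Continuity of `fderiv ℂ f` is not yet known, but a derivative is always measurable.
    · refine hacont.aestronglyMeasurable.smul ?_
      refine StronglyMeasurable.aestronglyMeasurable ?_
      have h1 : StronglyMeasurable (fderiv ℂ f) := (measurable_fderiv ℂ f).stronglyMeasurable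
      exact h1.comp_measurable (g := fun θ => z₀ + circleMap 0 δ θ • v)
        (continuous_const.add ((continuous_circleMap 0 δ).smul continuous_const)).measurable
    · refine Eventually.of_forall fun θ _ z hz => ?_
      rw [norm_smul]
      gcongr
      have hb : closedBall (z + circleMap 0 δ θ • v) ε ⊆ closedBall z₀ (3 * ε) := by
        have := mem_closedBall.1 (hmem z hz _ (hcirc θ))
        exact closedBall_subset_closedBall' (by linarith)
      exact norm_fderiv_le_of_bounded hε (fun x hx => hda x (hb hx)) fun x hx => hC x (hb hx)
    · exact (Continuous.intervalIntegrable (hacont.norm.mul continuous_const) _ _)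
    · refine Eventually.of_forall fun θ _ z hz => ?_
      have h1 := hda _ (closedBall_subset_closedBall (by linarith) (hmem z hz _ (hcirc θ)))
      have h2 : HasFDerivAt (fun z => f (z + circleMap 0 δ θ • v))
          (fderiv ℂ f (z + circleMap 0 δ θ • v)) z :=
        h1.hasFDerivAt.comp z ((hasFDerivAt_id z).add_const _)
      exact h2.const_mul (a θ)
  have h4 := (hder.differentiableAt.const_smul ((2 * Real.pi * I : ℂ)⁻¹))
  refine h4.congr_of_eventuallyEq ?_
  filter_upwards [ball_mem_nhds z₀ hε] with z hz
  exact hcauchy z hz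

/-- Bootstrapping: the directional derivatives of `f` are again complex differentiable. It applies
to the coefficient `s` of `Ω`, about which only complex differentiability is assumed. -/
theorem contDiffOn_of_differentiableOn [FiniteDimensional ℂ G] {f : G → ℂ} {U : Set G}
    (hU : IsOpen U) (hf : DifferentiableOn ℂ f U) (n : ℕ) : ContDiffOn ℂ n f U := by
  induction n generalizing f with
  | zero => exact contDiffOn_zero.2 hf.continuousOn
  | succ n ih =>
    rw [Nat.cast_add, Nat.cast_one, contDiffOn_succ_iff_fderiv_of_isOpen hU]
    refine ⟨hf, by simp, contDiffOn_clm_apply.2 fun v => ih fun z hz => ?_⟩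
    exact (differentiableAt_fderiv_apply hU hf v hz).differentiableWithinAt

theorem contDiffAt_of_differentiableOn [FiniteDimensional ℂ G] {f : G → ℂ} {U : Set G}
    (hU : IsOpen U) (hf : DifferentiableOn ℂ f U) {z : G} (hz : z ∈ U) : ContDiffAt ℂ ∞ f z :=
  (contDiffOn_infty.2 (contDiffOn_of_differentiableOn hU hf)).contDiffAt (hU.mem_nhds hz)

end Holomorphic

/-! # Holomorphic changes of coordinates -/

section Pullback

open Filter Topology Complex ExteriorAlgebra

section Family

variable {F G : Type*} [AddCommGroup F] [Module ℂ F] [AddCommGroup G] [Module ℂ G]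

theorem SmoothAt.of_apply [Module.Finite ℂ F] {P : E → F →ₗ[ℂ] G} {z : E}
    (hP : ∀ x, SmoothAt (fun w => P w x) z) :
    SmoothAt P z := by
  have h : P = fun w => ∑ k, (LinearMap.smulRightₗ ((Module.finBasis ℂ F).coord k))
      (P w (Module.finBasis ℂ F k)) := funext fun w => by
    refine (Module.finBasis ℂ F).ext fun j => ?_
    simp [LinearMap.smulRightₗ_apply, Finsupp.single_apply]
  rw [h]
  exact SmoothAt.sum fun k _ => (hP _).linear _

theorem smoothAt_sum_smul {h : Fin 3 → Fin 3 → E → ℂ} {z : E}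
    (hh : ∀ i j, ContDiffAt ℝ ∞ (h i j) z) (r : Fin 3 → ℂ) (u : Fin 3 → F) :
    SmoothAt (fun w => ∑ j, r j • ∑ i, h i j w • u i) z :=
  SmoothAt.sum fun _ _ => SmoothAt.smul contDiffAt_const (SmoothAt.sum fun i _ =>
    SmoothAt.smul (hh i _) (SmoothAt.const (u i)))

variable [Module.Finite ℂ F]

theorem vdC_sum_smul {h : Fin 3 → Fin 3 → E → ℂ} {z : E} (hh : ∀ i j, ContDiffAt ℝ ∞ (h i j) z)
    (r : Fin 3 → ℂ) (u : Fin 3 → F) (c : ℂ) (k : Fin 3) :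
    vdC c k (fun w => ∑ j, r j • ∑ i, h i j w • u i) z =
      ∑ i, (∑ j, r j * dC c k (h i j) z) • u i := by
  have h1 : ∀ i j, SmoothAt (fun w => h i j w • u i) z :=
    fun i j => SmoothAt.smul (hh i j) (SmoothAt.const (u i))
  have h3 : ∀ j, SmoothAt (fun w => ∑ i, h i j w • u i) z := fun j => SmoothAt.sum fun i _ => h1 i j
  rw [vdC_sum fun j _ => (h3 j).smul contDiffAt_const]
  simp only [Finset.sum_smul]
  rw [Finset.sum_comm (s := Finset.univ) (t := Finset.univ)
    (f := fun i j => (r j * dC c k (h i j) z) • u i)]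
  refine Finset.sum_congr rfl fun j _ => ?_
  rw [vdC_smul contDiffAt_const (h3 j), dC_const, zero_smul, zero_add, vdC_sum fun i _ => h1 i j,
    Finset.smul_sum]
  refine Finset.sum_congr rfl fun i _ => ?_
  rw [vdC_smul (hh i j) (SmoothAt.const _), vdC_const, smul_zero, add_zero, smul_smul]

variable [Module.Finite ℂ G]

/-- The product rule for a varying linear map applied to a varying vector, with the vector frozen in
the first term. -/
theorem vdC_family {c : ℂ} {i : Fin 3} {P : E → F →ₗ[ℂ] G} {f : E → F} {z : E}
    (hP : ∀ x, SmoothAt (fun w => P w x) z) (hf : SmoothAt f z) :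
    vdC c i (fun w => P w (f w)) z = vdC c i (fun w => P w (f z)) z + P z (vdC c i f z) := by
  have h := vdC_bilin (c := c) (i := i) (LinearMap.id : (F →ₗ[ℂ] G) →ₗ[ℂ] F →ₗ[ℂ] G)
    (SmoothAt.of_apply hP) hf
  have h2 := vdC_linear (c := c) (i := i) (SmoothAt.of_apply hP)
    (LinearMap.applyₗ (f z) : (F →ₗ[ℂ] G) →ₗ[ℂ] G)
  exact h.trans (congrArg (· + P z (vdC c i f z)) h2.symm)

end Family

variable {V W : Type*} [AddCommGroup V] [Module ℂ V] [AddCommGroup W] [Module ℂ W]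

theorem formPull_ι (f : V →ₗ[ℂ] W) (m : Module.Dual ℂ W × ConjDual W) :
    formPull f (ι ℂ m) = ι ℂ (m.1 ∘ₗ f, conjPull f m.2) :=
  ExteriorAlgebra.map_apply_ι _ _

theorem formPull_hol (f : V →ₗ[ℂ] W) (a : Module.Dual ℂ W) :
    formPull f (hol a) = hol (a ∘ₗ f) := formPull_ι f _

theorem formPull_antihol (f : V →ₗ[ℂ] W) (k : ConjDual W) :
    formPull f (antihol k) = antihol (conjPull f k) := by
  rw [antihol, formPull_ι]
  rfl

theorem hol_sum {κ : Type*} (s : Finset κ) (f : κ → Module.Dual ℂ V) :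
    hol (∑ i ∈ s, f i) = ∑ i ∈ s, hol (f i) :=
  map_sum (ExteriorAlgebra.ι ℂ ∘ₗ LinearMap.inl ℂ (Module.Dual ℂ V) (ConjDual V)) f s

theorem antihol_sum {κ : Type*} (s : Finset κ) (f : κ → ConjDual V) :
    antihol (∑ i ∈ s, f i) = ∑ i ∈ s, antihol (f i) :=
  map_sum (ExteriorAlgebra.ι ℂ ∘ₗ LinearMap.inr ℂ (Module.Dual ℂ V) (ConjDual V)) f s

theorem ι_eq_hol_add_antihol (m : Module.Dual ℂ V × ConjDual V) :
    ι ℂ m = hol m.1 + antihol m.2 := by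
  rw [hol, antihol, ← map_add, Prod.mk_add_mk, add_zero, zero_add]

theorem vec_eq_sum (v : E) : v = ∑ i, v i • (Pi.single i 1 : E) :=
  (by simpa using ((Pi.basisFun ℂ (Fin 3)).sum_repr v).symm)

theorem dual_eq_sum (f : Module.Dual ℂ E) :
    f = ∑ i, f (Pi.single i 1) • coordForm i := by
  refine LinearMap.ext fun v => ?_
  conv_lhs => rw [vec_eq_sum v, map_sum]
  simp [coordForm, mul_comm]

theorem conjDual_eq_sum (k : ConjDual E) :
    k = ∑ i, k (Pi.single i 1) • coordFormBar i := by
  refine LinearMap.ext fun v => ?_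
  conv_lhs => rw [vec_eq_sum v, map_sum]
  simp only [LinearMap.sum_apply, LinearMap.smul_apply, map_smulₛₗ, smul_eq_mul, coordFormBar]
  exact Finset.sum_congr rfl fun i _ => mul_comm _ _

theorem formPull_coordForm (f : E →L[ℂ] E) (j : Fin 3) :
    formPull f.toLinearMap (hol (coordForm j)) =
      ∑ i, f (Pi.single i 1) j • hol (coordForm i) := by
  rw [formPull_hol, dual_eq_sum (coordForm j ∘ₗ f.toLinearMap), hol_sum]
  exact Finset.sum_congr rfl fun i _ => hol_smul _ _

theorem formPull_coordFormBar (f : E →L[ℂ] E) (j : Fin 3) :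
    formPull f.toLinearMap (antihol (coordFormBar j)) =
      ∑ i, starRingEnd ℂ (f (Pi.single i 1) j) • antihol (coordFormBar i) := by
  rw [formPull_antihol, conjDual_eq_sum (conjPull f.toLinearMap (coordFormBar j)), antihol_sum]
  exact Finset.sum_congr rfl fun i _ => antihol_smul _ _

/-- The components of the derivative of a holomorphic map. -/
theorem hasFDerivAt_component {t : E → E} {z : E} (ht : ContDiffAt ℂ ∞ t z) (i j : Fin 3) :
    ∃ f' : E →L[ℂ] ℂ, HasFDerivAt (fun w => fderiv ℂ t w (Pi.single i 1) j) f' z ∧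
      ∀ k, f' (Pi.single k 1) = fderiv ℂ (fderiv ℂ t) z (Pi.single k 1) (Pi.single i 1) j := by
  have h : DifferentiableAt ℂ (fderiv ℂ t) z :=
    (ht.fderiv_right (m := ∞) le_rfl).differentiableAt (by simp)
  have h1 : HasFDerivAt (fun w => fderiv ℂ t w (Pi.single i 1))
      ((fderiv ℂ (fderiv ℂ t) z).flip (Pi.single i 1)) z := by
    simpa using h.hasFDerivAt.clm_apply (hasFDerivAt_const (Pi.single i 1 : E) z)
  exact ⟨_, ((ContinuousLinearMap.proj (R := ℂ) (φ := fun _ : Fin 3 => ℂ) j).hasFDerivAt.comp z h1),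
    fun k => rfl⟩

theorem contDiffAt_component {t : E → E} {z : E} (ht : ContDiffAt ℂ ∞ t z) (i j : Fin 3) :
    ContDiffAt ℝ ∞ (fun w => fderiv ℂ t w (Pi.single i 1) j) z := by
  have h : ContDiffAt ℂ ∞ (fderiv ℂ t) z := ht.fderiv_right (m := ∞) le_rfl
  have h1 := contDiffAt_pi.1 (h.clm_apply (contDiffAt_const (c := (Pi.single i 1 : E)))) j
  exact h1.restrict_scalars ℝ

/-- Symmetric coefficients against anticommuting generators. With second derivatives as
coefficients, it says that pulled-back coordinate forms are closed. -/
theorem sum_symm_mul_eq_zero {M : Type*} [AddCommGroup M] [Module ℂ M] {H : Fin 3 → Fin 3 → ℂ}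
    (hH : ∀ i j, H i j = H j i) (e : Fin 3 → M) :
    ∑ i, ι ℂ (e i) * ∑ j, H i j • ι ℂ (e j) = 0 := by
  have h : ∑ i, ι ℂ (e i) * ∑ j, H i j • ι ℂ (e j) =
      -∑ i, ι ℂ (e i) * ∑ j, H i j • ι ℂ (e j) := by
    conv_lhs => simp only [Finset.mul_sum]
    rw [Finset.sum_comm]
    simp only [Finset.mul_sum, ← Finset.sum_neg_distrib]
    refine Finset.sum_congr rfl fun i _ => Finset.sum_congr rfl fun j _ => ?_
    rw [hH, mul_smul_comm, mul_smul_comm, ι_mul_ι, smul_neg]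
  have h2 : (2 : ℂ) • ∑ i, ι ℂ (e i) * ∑ j, H i j • ι ℂ (e j) = 0 := by
    rw [two_smul]
    exact eq_neg_iff_add_eq_zero.1 h
  exact (smul_eq_zero.1 h2).resolve_left two_ne_zero

/-- A first-order operator `∑ ε^i ∧ ½(∂_{e_i} + c ∂_{i e_i})` on forms on `ℂ³`. -/
def opC (c : ℂ) (e : Fin 3 → Module.Dual ℂ E × ConjDual E) (a : E → FormAlg E) (z : E) :
    FormAlg E :=
  ∑ i, ι ℂ (e i) * vdC c i a z

theorem delLocal_eq_opC : delLocal = opC (-I) (fun i => (coordForm i, 0)) := by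
  funext a z
  rw [delLocal, opC, vdZ_eq_vdC]
  rfl

theorem delbarLocal_eq_opC : delbarLocal = opC I (fun i => (0, coordFormBar i)) := rfl

theorem opC_congr {c : ℂ} {e : Fin 3 → Module.Dual ℂ E × ConjDual E} {a b : E → FormAlg E} {z : E}
    (h : a =ᶠ[𝓝 z] b) : opC c e a z = opC c e b z :=
  Finset.sum_congr rfl fun i _ => by rw [vdC_congr h]

section Change

variable {t : E → E} {z : E}

theorem formPull_fderiv_ι (f : E →L[ℂ] E) (m : Module.Dual ℂ E × ConjDual E) :
    formPull f.toLinearMap (ι ℂ m) =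
      ∑ j, m.1 (Pi.single j 1) • ∑ i, f (Pi.single i 1) j • hol (coordForm i) +
      ∑ j, m.2 (Pi.single j 1) • ∑ i, starRingEnd ℂ (f (Pi.single i 1) j) •
        antihol (coordFormBar i) := by
  conv_lhs => rw [ι_eq_hol_add_antihol, dual_eq_sum m.1, conjDual_eq_sum m.2]
  simp only [hol_sum, antihol_sum, hol_smul, antihol_smul, map_add, map_sum, map_smul,
    formPull_coordForm, formPull_coordFormBar]

theorem contDiffAt_conj {f : E → ℂ} (hf : ContDiffAt ℝ ∞ f z) :
    ContDiffAt ℝ ∞ (fun w => starRingEnd ℂ (f w)) z :=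
  (conjCLE : ℂ →L[ℝ] ℂ).contDiff.contDiffAt.comp z hf

theorem smoothAt_formPull_fderiv_ι (ht : ContDiffAt ℂ ∞ t z)
    (m : Module.Dual ℂ E × ConjDual E) :
    SmoothAt (fun w => formPull (fderiv ℂ t w).toLinearMap (ι ℂ m)) z := by
  simp only [formPull_fderiv_ι]
  exact (smoothAt_sum_smul (h := fun i j w => fderiv ℂ t w (Pi.single i 1) j)
    (contDiffAt_component ht) _ _).add
    (smoothAt_sum_smul (h := fun i j w => starRingEnd ℂ (fderiv ℂ t w (Pi.single i 1) j))
      (fun i j => contDiffAt_conj (contDiffAt_component ht i j)) _ _)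

/-- For `c = ±i` one of the two factors `(1 ± c i)/2` is zero: `∂` sees only the holomorphic
covectors and `∂̄` only the conjugate ones. -/
theorem vdC_formPull_fderiv_ι (ht : ContDiffAt ℂ ∞ t z) (c : ℂ) (k : Fin 3)
    (m : Module.Dual ℂ E × ConjDual E) :
    vdC c k (fun w => formPull (fderiv ℂ t w).toLinearMap (ι ℂ m)) z =
      ∑ i, (∑ j, m.1 (Pi.single j 1) * ((1 + c * I) / 2 *
        fderiv ℂ (fderiv ℂ t) z (Pi.single k 1) (Pi.single i 1) j)) • hol (coordForm i) +
      ∑ i, (∑ j, m.2 (Pi.single j 1) * ((1 - c * I) / 2 * starRingEnd ℂ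
        (fderiv ℂ (fderiv ℂ t) z (Pi.single k 1) (Pi.single i 1) j))) •
        antihol (coordFormBar i) := by
  simp only [formPull_fderiv_ι]
  rw [vdC_add (smoothAt_sum_smul (h := fun i j w => fderiv ℂ t w (Pi.single i 1) j)
    (contDiffAt_component ht) _ _)
    (smoothAt_sum_smul (h := fun i j w => starRingEnd ℂ (fderiv ℂ t w (Pi.single i 1) j))
      (fun i j => contDiffAt_conj (contDiffAt_component ht i j)) _ _),
    vdC_sum_smul (h := fun i j w => fderiv ℂ t w (Pi.single i 1) j)
      (contDiffAt_component ht),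
    vdC_sum_smul (h := fun i j w => starRingEnd ℂ (fderiv ℂ t w (Pi.single i 1) j))
      (fun i j => contDiffAt_conj (contDiffAt_component ht i j))]
  have h1 : ∀ i j, dC c k (fun w => fderiv ℂ t w (Pi.single i 1) j) z = (1 + c * I) / 2 *
      fderiv ℂ (fderiv ℂ t) z (Pi.single k 1) (Pi.single i 1) j := fun i j => by
    obtain ⟨f', hf', hk⟩ := hasFDerivAt_component ht i j
    rw [dC_holomorphic hf', hk]
  have h2 : ∀ i j, dC c k (fun w => starRingEnd ℂ (fderiv ℂ t w (Pi.single i 1) j)) z =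
      (1 - c * I) / 2 * starRingEnd ℂ
        (fderiv ℂ (fderiv ℂ t) z (Pi.single k 1) (Pi.single i 1) j) := fun i j => by
    obtain ⟨f', hf', hk⟩ := hasFDerivAt_component ht i j
    rw [dC_conj hf', hk]
  simp only [h1, h2]

/-! ### Families of algebra maps commuting with first-order operators -/

section AlgHoms

variable {P : E → FormAlg E →ₐ[ℂ] FormAlg E}

theorem smoothAt_algHom (hP : ∀ m, SmoothAt (fun w => P w (ι ℂ m)) z) (x : FormAlg E) :
    SmoothAt (fun w => P w x) z := by
  induction x using exterior_induction with
  | one => simpa using SmoothAt.const _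
  | smul r x hx =>
    simp only [map_smul]
    exact hx.smul contDiffAt_const
  | add x y hx hy => simp only [map_add]; exact hx.add hy
  | ι_mul m x hx =>
    simp only [map_mul]
    exact (hP m).mul hx

/-- A family of algebra maps which maps the generators to closed forms maps constant forms to
closed forms. -/
theorem opC_algHom_const {c : ℂ} {e : Fin 3 → Module.Dual ℂ E × ConjDual E}
    (hP : ∀ m, SmoothAt (fun w => P w (ι ℂ m)) z)
    (hm : ∀ m, ∃ m', P z (ι ℂ m) = ι ℂ m')
    (h : ∀ m, opC c e (fun w => P w (ι ℂ m)) z = 0)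
    (x : FormAlg E) : opC c e (fun w => P w x) z = 0 := by
  induction x using exterior_induction with
  | one => simp [opC, vdC_const]
  | smul r x hx =>
    have h5 : ∀ i, vdC c i (fun w => P w (r • x)) z = r • vdC c i (fun w => P w x) z := fun i => by
      simp only [map_smul]
      exact vdC_const_smul r (smoothAt_algHom hP x)
    simp only [opC, h5, mul_smul_comm, ← Finset.smul_sum]
    exact (congrArg (r • ·) hx).trans (smul_zero r)
  | add x y hx hy =>
    have h5 : ∀ i, vdC c i (fun w => P w (x + y)) z =
        vdC c i (fun w => P w x) z + vdC c i (fun w => P w y) z := fun i => by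
      simp only [map_add]
      exact vdC_add (smoothAt_algHom hP x) (smoothAt_algHom hP y)
    simp only [opC, h5, mul_add, Finset.sum_add_distrib]
    exact (congrArg₂ (· + ·) hx hy).trans (add_zero 0)
  | ι_mul m x hx =>
    obtain ⟨m', hm'⟩ := hm m
    have h5 : ∀ i, vdC c i (fun w => P w (ι ℂ m * x)) z =
        vdC c i (fun w => P w (ι ℂ m)) z * P z x + ι ℂ m' * vdC c i (fun w => P w x) z :=
      fun i => by
        simp only [map_mul]
        rw [vdC_mul (hP m) (smoothAt_algHom hP x), hm']
    have h6 := h m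
    rw [opC] at h6 hx ⊢
    simp only [h5, mul_add, ← mul_assoc, Finset.sum_add_distrib, ← Finset.sum_mul, h6,
      zero_mul, zero_add, ι_mul_ι (e _)]
    simp only [neg_mul, mul_assoc, Finset.sum_neg_distrib, ← Finset.mul_sum, hx, mul_zero, neg_zero]

/-- The product rule gives a term in which only `P` is differentiated, zero by `opC_algHom_const`,
and a chain-rule term, whose coefficients are those by which `P` transforms the covectors `e`. -/
theorem opC_algHom {c : ℂ} (hc : c ^ 2 = -1) {e : Fin 3 → Module.Dual ℂ E × ConjDual E}
    (ht : ContDiffAt ℂ ∞ t z) (hP : ∀ m, SmoothAt (fun w => P w (ι ℂ m)) z)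
    (hm : ∀ m, ∃ m', P z (ι ℂ m) = ι ℂ m')
    (h : ∀ m, opC c e (fun w => P w (ι ℂ m)) z = 0)
    (h' : ∀ j, P z (ι ℂ (e j)) = ∑ i, twist c (fderiv ℂ t z (Pi.single i 1) j) • ι ℂ (e i))
    {a : E → FormAlg E} (ha : SmoothAt a (t z)) :
    opC c e (fun w => P w (a (t w))) z = P z (opC c e a (t z)) := by
  have hr : ContDiffAt ℝ ∞ t z := ht.restrict_scalars ℝ
  have hat : SmoothAt (fun w => a (t w)) z := fun l => (ha l).comp z hr
  have hd : HasFDerivAt t (fderiv ℂ t z) z := (ht.differentiableAt (by simp)).hasFDerivAt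
  have h1 : ∀ i, vdC c i (fun w => P w (a (t w))) z = vdC c i (fun w => P w (a (t z))) z +
      ∑ j, twist c (fderiv ℂ t z (Pi.single i 1) j) • P z (vdC c j a (t z)) := fun i => by
    have := vdC_family (c := c) (i := i) (P := fun w => (P w).toLinearMap)
      (smoothAt_algHom hP) hat
    refine this.trans (congrArg₂ (· + ·) rfl ?_)
    rw [vdC_comp hc hd hr ha, map_sum]
    exact Finset.sum_congr rfl fun j _ => map_smul _ _ _
  have h2 := opC_algHom_const hP hm h (a (t z))
  rw [opC] at h2
  rw [opC, opC]
  simp only [h1, mul_add, Finset.sum_add_distrib, h2, zero_add, map_sum, map_mul, h',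
    Finset.mul_sum, Finset.sum_mul, mul_smul_comm, smul_mul_assoc]
  exact Finset.sum_comm

end AlgHoms

theorem delLocal_formPull (ht : ContDiffAt ℂ ∞ t z) {a : E → FormAlg E} (ha : SmoothAt a (t z)) :
    delLocal (fun w => formPull (fderiv ℂ t w).toLinearMap (a (t w))) z =
      formPull (fderiv ℂ t z).toLinearMap (delLocal a (t z)) := by
  rw [delLocal_eq_opC]
  have hs : IsSymmSndFDerivAt ℂ t z := ht.isSymmSndFDerivAt (by
    simpa using WithTop.coe_le_coe.2 (le_top : (2 : ℕ∞) ≤ ⊤))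
  refine opC_algHom (P := fun w => formPull (fderiv ℂ t w).toLinearMap) (by simp) ht
    (smoothAt_formPull_fderiv_ι ht) (fun m => ⟨_, formPull_ι _ m⟩) (fun m => ?_) (fun j => ?_) ha
  · have h0 : 1 - -I * I = 0 := by simp
    simp only [opC, vdC_formPull_fderiv_ι ht, h0, zero_div, zero_mul, mul_zero,
      Finset.sum_const_zero, zero_smul, add_zero]
    refine sum_symm_mul_eq_zero (H := fun k i => ∑ j, m.1 (Pi.single j 1) * ((1 + -I * I) / 2 *
      fderiv ℂ (fderiv ℂ t) z (Pi.single k 1) (Pi.single i 1) j))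
      (fun k i => ?_) fun i => ((coordForm i, 0) : Module.Dual ℂ E × ConjDual E)
    simp only [hs.eq (Pi.single k 1) (Pi.single i 1)]
  · simp only [twist_neg_I]
    exact formPull_coordForm _ j

theorem delbarLocal_formPull (ht : ContDiffAt ℂ ∞ t z) {a : E → FormAlg E}
    (ha : SmoothAt a (t z)) :
    delbarLocal (fun w => formPull (fderiv ℂ t w).toLinearMap (a (t w))) z =
      formPull (fderiv ℂ t z).toLinearMap (delbarLocal a (t z)) := by
  rw [delbarLocal_eq_opC]
  have hs : IsSymmSndFDerivAt ℂ t z := ht.isSymmSndFDerivAt (by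
    simpa using WithTop.coe_le_coe.2 (le_top : (2 : ℕ∞) ≤ ⊤))
  refine opC_algHom (P := fun w => formPull (fderiv ℂ t w).toLinearMap) (by simp) ht
    (smoothAt_formPull_fderiv_ι ht) (fun m => ⟨_, formPull_ι _ m⟩) (fun m => ?_) (fun j => ?_) ha
  · have h0 : 1 + I * I = 0 := by simp
    simp only [opC, vdC_formPull_fderiv_ι ht, h0, zero_div, zero_mul, mul_zero,
      Finset.sum_const_zero, zero_smul, zero_add]
    refine sum_symm_mul_eq_zero (H := fun k i => ∑ j, m.2 (Pi.single j 1) * ((1 - I * I) / 2 *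
      starRingEnd ℂ (fderiv ℂ (fderiv ℂ t) z (Pi.single k 1) (Pi.single i 1) j)))
      (fun k i => ?_) fun i => ((0, coordFormBar i) : Module.Dual ℂ E × ConjDual E)
    simp only [hs.eq (Pi.single k 1) (Pi.single i 1)]
  · simp only [twist_I]
    exact formPull_coordFormBar _ j

end Change

end Pullback

/-! # Charts -/

section Charts

open Filter Topology

variable {X : Type*} [TopologicalSpace X] [ChartedSpace E X] [hX : IsManifold 𝓘(ℂ, E) ∞ X]

variable {φ ψ : OpenPartialHomeomorph X E} {x : X}

include hX in
theorem exists_chart_deriv (hφ : φ ∈ atlas E X) (hx : x ∈ φ.source) :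
    ∃ e : T x ≃L[ℂ] E, chartD φ x = e ∧ chartDInv φ x = e.symm ∧
      (e.symm : E →L[ℂ] T x) = mfderiv 𝓘(ℂ, E) 𝓘(ℂ, E) φ.symm (φ x) := by
  have : IsManifold 𝓘(ℂ, E) 1 X := IsManifold.of_le (n := ∞) (by simp)
  have h := mdifferentiable_of_mem_atlas (I := 𝓘(ℂ, E)) hφ
  let e : T x ≃L[ℂ] E := (h.mfderiv hx).trans (NormedSpace.fromTangentSpace (𝕜 := ℂ) (φ x))
  have he : chartD φ x = e := rfl
  refine ⟨e, he, ?_, rfl⟩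
  rw [chartDInv, he, ContinuousLinearMap.inverse_equiv]

theorem chartDInv_comp_chartD (hφ : φ ∈ atlas E X) (hx : x ∈ φ.source) :
    (chartDInv φ x).toLinearMap ∘ₗ (chartD φ x).toLinearMap = LinearMap.id := by
  obtain ⟨e, h1, h2, -⟩ := exists_chart_deriv hφ hx
  rw [h1, h2]
  exact LinearMap.ext fun v => e.symm_apply_apply v

theorem chartD_comp_chartDInv (hφ : φ ∈ atlas E X) (hx : x ∈ φ.source) :
    (chartD φ x).toLinearMap ∘ₗ (chartDInv φ x).toLinearMap = LinearMap.id := by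
  obtain ⟨e, h1, h2, -⟩ := exists_chart_deriv hφ hx
  rw [h1, h2]
  exact LinearMap.ext fun v => e.apply_symm_apply v

theorem contDiffAt_transition (hφ : φ ∈ atlas E X) (hψ : ψ ∈ atlas E X) (hx : x ∈ φ.source)
    (hx' : x ∈ ψ.source) : ContDiffAt ℂ ∞ (ψ ∘ φ.symm) (φ x) := by
  have h1 : ContMDiffAt 𝓘(ℂ, E) 𝓘(ℂ, E) ∞ φ.symm (φ x) :=
    contMDiffOn_symm_of_mem_maximalAtlas (IsManifold.subset_maximalAtlas hφ) |>.contMDiffAt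
      (φ.open_target.mem_nhds (φ.map_source hx))
  have h2 : ContMDiffAt 𝓘(ℂ, E) 𝓘(ℂ, E) ∞ ψ (φ.symm (φ x)) := by
    rw [φ.left_inv hx]
    exact contMDiffAt_of_mem_maximalAtlas (IsManifold.subset_maximalAtlas hψ) hx'
  exact contMDiffAt_iff_contDiffAt.1 (h2.comp _ h1)

/-- Relates the calculus on `ℂ³` to the manifold derivatives with which local expressions are
defined. -/
theorem fderiv_transition (hφ : φ ∈ atlas E X) (hψ : ψ ∈ atlas E X) (hx : x ∈ φ.source)
    (hx' : x ∈ ψ.source) :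
    (fderiv ℂ (ψ ∘ φ.symm) (φ x)).toLinearMap =
      (chartD ψ x).toLinearMap ∘ₗ (chartDInv φ x).toLinearMap := by
  have hm : IsManifold 𝓘(ℂ, E) 1 X := IsManifold.of_le (n := ∞) (by simp)
  obtain ⟨e, h1, h2, h3⟩ := exists_chart_deriv hφ hx
  have h4 : mfderiv 𝓘(ℂ, E) 𝓘(ℂ, E) (ψ ∘ φ.symm) (φ x) =
      (mfderiv 𝓘(ℂ, E) 𝓘(ℂ, E) ψ (φ.symm (φ x))).comp
        (mfderiv 𝓘(ℂ, E) 𝓘(ℂ, E) φ.symm (φ x)) := by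
    refine mfderiv_comp (I' := 𝓘(ℂ, E)) _ ?_ ?_
    · rw [φ.left_inv hx]
      exact mdifferentiableAt_atlas hψ hx'
    · exact mdifferentiableAt_atlas_symm hφ (φ.map_source hx)
  rw [mfderiv_eq_fderiv, φ.left_inv hx] at h4
  rw [h2, h3]
  refine LinearMap.ext fun v => ?_
  exact DFunLike.congr_fun h4 v

variable {V W U : Type*} [AddCommGroup V] [Module ℂ V] [AddCommGroup W] [Module ℂ W]
  [AddCommGroup U] [Module ℂ U]

theorem formPull_formPull (f : V →ₗ[ℂ] W) (g : W →ₗ[ℂ] U) (x : FormAlg U) :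
    formPull f (formPull g x) = formPull (g ∘ₗ f) x :=
  DFunLike.congr_fun (ExteriorAlgebra.map_comp_map (g.dualMap.prodMap (conjPull g))
    (f.dualMap.prodMap (conjPull f))) x

theorem formPull_id (x : FormAlg V) : formPull LinearMap.id x = x :=
  DFunLike.congr_fun (ExteriorAlgebra.map_id (R := ℂ) (M := Module.Dual ℂ V × ConjDual V)) x

theorem polyMap_polyMap {f : V →ₗ[ℂ] W} {f' : W →ₗ[ℂ] V} (h : f' ∘ₗ f = LinearMap.id)
    (x : PolyAlg V) : polyMap f' f (polyMap f f' x) = x := by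
  have h1 : f'.prodMap (conjPull f) ∘ₗ f.prodMap (conjPull f') = LinearMap.id := by
    refine LinearMap.ext fun m => Prod.ext (LinearMap.congr_fun h m.1) ?_
    exact LinearMap.ext fun v => congrArg m.2 (LinearMap.congr_fun h v)
  have h2 := DFunLike.congr_fun (ExteriorAlgebra.map_comp_map (f.prodMap (conjPull f'))
    (f'.prodMap (conjPull f))) x
  refine h2.trans ?_
  rw [h1, ExteriorAlgebra.map_id]
  rfl

theorem formPull_injective {f : V →ₗ[ℂ] W} {f' : W →ₗ[ℂ] V} (h : f ∘ₗ f' = LinearMap.id) :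
    Function.Injective (formPull f) := fun x y hxy => by
  have h1 := congrArg (formPull f') hxy
  rwa [formPull_formPull, formPull_formPull, h, formPull_id, formPull_id] at h1

/-! ### Local expressions -/

/-- Smooth forms. -/
def SmoothForm (a : FormSection X) : Prop :=
  ∀ φ ∈ atlas E X, ∀ z ∈ φ.target, SmoothAt (localForm φ a) z

theorem formPull_localForm (hφ : φ ∈ atlas E X) (hx : x ∈ φ.source) (a : FormSection X) :
    formPull (chartD φ x).toLinearMap (localForm φ a (φ x)) = a x := by
  rw [localForm, φ.left_inv hx, formPull_formPull, chartDInv_comp_chartD hφ hx, formPull_id]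

omit hX in
theorem localPoly_apply (hx : x ∈ φ.source) (α : PolySection X) :
    localPoly φ α (φ x) =
      polyMap (chartD φ x).toLinearMap (chartDInv φ x).toLinearMap (α x) := by
  rw [localPoly, φ.left_inv hx]

theorem polyMap_localPoly (hφ : φ ∈ atlas E X) (hx : x ∈ φ.source) (α : PolySection X) :
    polyMap (chartDInv φ x).toLinearMap (chartD φ x).toLinearMap (localPoly φ α (φ x)) = α x := by
  rw [localPoly_apply hx, polyMap_polyMap (chartDInv_comp_chartD hφ hx)]

theorem polySection_ext {α β : PolySection X}
    (h : ∀ x, localPoly (chartAt E x) α (chartAt E x x) =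
      localPoly (chartAt E x) β (chartAt E x x)) :
    α = β := funext fun x => by
  rw [← polyMap_localPoly (chart_mem_atlas E x) (mem_chart_source E x) α, h x,
    polyMap_localPoly (chart_mem_atlas E x) (mem_chart_source E x)]

/-- Change of charts for local expressions. -/
theorem localForm_eventuallyEq (hφ : φ ∈ atlas E X) (hψ : ψ ∈ atlas E X) (hx : x ∈ φ.source)
    (hx' : x ∈ ψ.source) (a : FormSection X) :
    localForm φ a =ᶠ[𝓝 (φ x)] fun w => formPull (fderiv ℂ (ψ ∘ φ.symm) w).toLinearMap
      (localForm ψ a ((ψ ∘ φ.symm) w)) := by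
  have h1 : ∀ᶠ w in 𝓝 (φ x), w ∈ φ.target := φ.open_target.mem_nhds (φ.map_source hx)
  have h2 : ∀ᶠ w in 𝓝 (φ x), φ.symm w ∈ ψ.source := by
    refine (φ.continuousAt_symm (φ.map_source hx)).eventually_mem ?_
    rw [φ.left_inv hx]
    exact ψ.open_source.mem_nhds hx'
  filter_upwards [h1, h2] with w hw hw'
  have hs := φ.map_target hw
  have h3 := fderiv_transition hφ hψ hs hw'
  rw [φ.right_inv hw] at h3
  rw [h3, ← formPull_formPull, Function.comp_apply, formPull_localForm hψ hw', localForm]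

/-- A first-order operator which commutes with holomorphic pullbacks does not depend on the
chart. -/
theorem localForm_opC {c : ℂ} {e : Fin 3 → Module.Dual ℂ E × ConjDual E}
    (hop : ∀ (t : E → E) (z : E) (a : E → FormAlg E), ContDiffAt ℂ ∞ t z → SmoothAt a (t z) →
      opC c e (fun w => formPull (fderiv ℂ t w).toLinearMap (a (t w))) z =
        formPull (fderiv ℂ t z).toLinearMap (opC c e a (t z)))
    (hφ : φ ∈ atlas E X) {a : FormSection X} (ha : SmoothForm a) {z : E}
    (hz : z ∈ φ.target) :
    localForm φ (fun x => formPull (chartD (chartAt E x) x).toLinearMap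
      (opC c e (localForm (chartAt E x) a) (chartAt E x x))) z = opC c e (localForm φ a) z := by
  set y := φ.symm z with hy
  have hys : y ∈ φ.source := φ.map_target hz
  have hyz : φ y = z := φ.right_inv hz
  -- The operator is defined at each point by the preferred chart there, which changes with `y`;
  -- hence the change of charts is made point by point.
  set χ := chartAt E y with hχ
  have hχa : χ ∈ atlas E X := chart_mem_atlas E y
  have hyχ : y ∈ χ.source := mem_chart_source E y
  have h1 : opC c e (localForm χ a) (χ y) = formPull (fderiv ℂ (φ ∘ χ.symm) (χ y)).toLinearMap
      (opC c e (localForm φ a) z) := by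
    have ht := contDiffAt_transition hχa hφ hyχ hys
    have hval : (φ ∘ χ.symm) (χ y) = z := by rw [Function.comp_apply, χ.left_inv hyχ, hyz]
    rw [opC_congr (localForm_eventuallyEq hχa hφ hyχ hys a),
      hop _ _ _ ht (by rw [hval]; exact ha φ hφ z hz), hval]
  have h2 : (chartD φ y).toLinearMap ∘ₗ (chartDInv χ y).toLinearMap ∘ₗ
      (chartD χ y).toLinearMap ∘ₗ (chartDInv φ y).toLinearMap = LinearMap.id := by
    rw [← LinearMap.comp_assoc (chartDInv φ y).toLinearMap, chartDInv_comp_chartD hχa hyχ,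
      LinearMap.id_comp, chartD_comp_chartDInv hφ hys]
  rw [localForm, ← hy, ← hχ, h1, fderiv_transition hχa hφ hyχ hys, formPull_formPull,
    formPull_formPull, LinearMap.comp_assoc, h2, formPull_id]

theorem localForm_del (hφ : φ ∈ atlas E X) {a : FormSection X} (ha : SmoothForm a) {z : E}
    (hz : z ∈ φ.target) : localForm φ (del a) z = delLocal (localForm φ a) z := by
  have h : del a = fun x => formPull (chartD (chartAt E x) x).toLinearMap
      (delLocal (localForm (chartAt E x) a) (chartAt E x x)) := rfl
  rw [h, delLocal_eq_opC]
  refine localForm_opC (fun t z a ht ha => ?_) hφ ha hz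
  rw [← delLocal_eq_opC]
  exact delLocal_formPull ht ha

theorem localForm_delbar (hφ : φ ∈ atlas E X) {a : FormSection X} (ha : SmoothForm a) {z : E}
    (hz : z ∈ φ.target) : localForm φ (delbar a) z = delbarLocal (localForm φ a) z := by
  have h : delbar a = fun x => formPull (chartD (chartAt E x) x).toLinearMap
      (delbarLocal (localForm (chartAt E x) a) (chartAt E x x)) := rfl
  rw [h, delbarLocal_eq_opC]
  refine localForm_opC (fun t z a ht ha => ?_) hφ ha hz
  rw [← delbarLocal_eq_opC]
  exact delbarLocal_formPull ht ha

end Charts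

/-! # The operators `∂̄` and `Δ` in coordinates -/

section LocalOperators

open Filter Topology Complex ExteriorAlgebra

/-- The derivative `∂/∂θ_i` with respect to the odd variable `θ_i = ∂/∂z^i`. -/
def dTheta (i : Fin 3) : PolyAlg E →ₗ[ℂ] PolyAlg E :=
  contr (coordForm i ∘ₗ LinearMap.fst ℂ E (ConjDual E))

/-- The variable `η^i = d z̄^i`. -/
def etaBar (i : Fin 3) : PolyAlg E := ι ℂ ((0 : E), coordFormBar i)

theorem delbarPolyLocal_eq (u : E → PolyAlg E) (z : E) :
    delbarPolyLocal u z = ∑ i, etaBar i * vdC I i u z := rfl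

/-- `Δ` in coordinates in which `Ω = s dz¹ ∧ dz² ∧ dz³`. -/
def deltaLocal (s : E → ℂ) (u : E → PolyAlg E) (z : E) : PolyAlg E :=
  (s z)⁻¹ • ∑ i, dTheta i (vdC (-I) i (fun w => s w • u w) z)

theorem dTheta_mul (i : Fin 3) (x y : PolyAlg E) :
    dTheta i (x * y) = dTheta i x * y + inv x * dTheta i y := contr_mul _ x y

theorem dTheta_etaBar_mul (i j : Fin 3) (x : PolyAlg E) :
    dTheta i (etaBar j * x) = -(etaBar j * dTheta i x) := by
  rw [dTheta, etaBar, contr_ι_mul]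
  simp

theorem dTheta_dTheta (i j : Fin 3) (x : PolyAlg E) :
    dTheta i (dTheta j x) = -dTheta j (dTheta i x) := contr_contr _ _ x

variable {s : E → ℂ} {U : Set E} {u v : E → PolyAlg E} {z : E}

theorem vdC_holomorphic_smul {F : Type*} [AddCommGroup F] [Module ℂ F] [Module.Finite ℂ F]
    (hU : IsOpen U) (hs : DifferentiableOn ℂ s U) (hz : z ∈ U) {u : E → F} (hu : SmoothAt u z)
    (i : Fin 3) : vdC I i (fun w => s w • u w) z = s z • vdC I i u z := by
  have h := hs.differentiableAt (hU.mem_nhds hz)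
  rw [vdC_smul ((contDiffAt_of_differentiableOn hU hs hz).restrict_scalars ℝ) hu,
    dC_holomorphic h.hasFDerivAt]
  simp

theorem smoothAt_delbarPolyLocal (hu : SmoothAt u z) : SmoothAt (delbarPolyLocal u) z :=
  SmoothAt.sum fun i _ => (SmoothAt.const _).mul (hu.vdC I i)

theorem delbarPolyLocal_congr (h : u =ᶠ[𝓝 z] v) : delbarPolyLocal u z = delbarPolyLocal v z := by
  simp only [delbarPolyLocal_eq, vdC_congr h]

theorem deltaLocal_congr (h : u =ᶠ[𝓝 z] v) : deltaLocal s u z = deltaLocal s v z := by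
  have h' : (fun w => s w • u w) =ᶠ[𝓝 z] fun w => s w • v w := by
    filter_upwards [h] with w hw
    rw [hw]
  simp only [deltaLocal, vdC_congr h']

theorem delbarPolyLocal_smul_add (hu : SmoothAt u z) (hv : SmoothAt v z) (r : ℂ) :
    delbarPolyLocal (fun w => r • u w + v w) z =
      r • delbarPolyLocal u z + delbarPolyLocal v z := by
  have h : ∀ i, vdC I i (fun w => r • u w + v w) z = r • vdC I i u z + vdC I i v z := fun i => by
    have hru : SmoothAt (fun w => r • u w) z := hu.linear (r • LinearMap.id)
    rw [vdC_add hru hv, vdC_const_smul r hu]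
  simp only [delbarPolyLocal_eq, h, mul_add, mul_smul_comm, Finset.sum_add_distrib,
    Finset.smul_sum]

theorem sum_antisymm_eq_zero {M : Type*} [AddCommGroup M] [Module ℂ M] {f : Fin 3 → Fin 3 → M}
    (h : ∀ i j, f i j = -f j i) : ∑ i, ∑ j, f i j = 0 := by
  have h1 : ∑ i, ∑ j, f i j = -∑ i, ∑ j, f i j := by
    conv_lhs => rw [Finset.sum_comm]
    simp only [← Finset.sum_neg_distrib]
    exact Finset.sum_congr rfl fun i _ => Finset.sum_congr rfl fun j _ => h j i
  have h2 : (2 : ℂ) • ∑ i, ∑ j, f i j = 0 := by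
    rw [two_smul]
    exact eq_neg_iff_add_eq_zero.1 h1
  exact (smul_eq_zero.1 h2).resolve_left two_ne_zero

theorem vdC_sum_linear {F : Type*} [AddCommGroup F] [Module ℂ F] [Module.Finite ℂ F]
    {c : ℂ} {j : Fin 3} (L : Fin 3 → F →ₗ[ℂ] F) {f : Fin 3 → E → F}
    (hf : ∀ i, SmoothAt (f i) z) :
    vdC c j (fun w => ∑ i, L i (f i w)) z = ∑ i, L i (vdC c j (f i) z) := by
  rw [vdC_sum fun i _ => (hf i).linear (L i)]
  exact Finset.sum_congr rfl fun i _ => vdC_linear (hf i) (L i)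

theorem delbarPolyLocal_delbarPolyLocal (hu : SmoothAt u z) :
    delbarPolyLocal (delbarPolyLocal u) z = 0 := by
  have h : ∀ j, vdC I j (delbarPolyLocal u) z = ∑ i, etaBar i * vdC I j (vdC I i u) z := fun j =>
    vdC_sum_linear (fun i => LinearMap.mulLeft ℂ (etaBar i)) fun i => hu.vdC I i
  rw [delbarPolyLocal_eq]
  simp only [h, Finset.mul_sum]
  refine sum_antisymm_eq_zero fun i j => ?_
  rw [vdC_vdC hu, ← mul_assoc, ← mul_assoc, etaBar, etaBar, ι_mul_ι, neg_mul]

theorem delbarPolyLocal_mul (hu : SmoothAt u z) (hv : SmoothAt v z) :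
    delbarPolyLocal (fun w => u w * v w) z =
      delbarPolyLocal u z * v z + inv (u z) * delbarPolyLocal v z := by
  simp only [delbarPolyLocal_eq, vdC_mul hu hv, mul_add, Finset.sum_add_distrib, Finset.sum_mul,
    Finset.mul_sum, ← mul_assoc, etaBar, ι_mul_eq _ (u z)]

section Delta

variable (hU : IsOpen U) (hs : DifferentiableOn ℂ s U) (hs0 : ∀ w ∈ U, s w ≠ 0) (hz : z ∈ U)

include hU hs hz

theorem contDiffAt_coefficient : ContDiffAt ℝ ∞ s z :=
  (contDiffAt_of_differentiableOn hU hs hz).restrict_scalars ℝ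

theorem smoothAt_smul_coefficient (hu : SmoothAt u z) : SmoothAt (fun w => s w • u w) z :=
  hu.smul (contDiffAt_coefficient hU hs hz)

include hs0

theorem smoothAt_deltaLocal (hu : SmoothAt u z) : SmoothAt (deltaLocal s u) z :=
  SmoothAt.smul ((contDiffAt_coefficient hU hs hz).inv (hs0 z hz)) (SmoothAt.sum fun i _ =>
    ((smoothAt_smul_coefficient hU hs hz hu).vdC (-I) i).linear (dTheta i))

omit hs in
theorem smul_deltaLocal_eventuallyEq : (fun w => s w • deltaLocal s u w) =ᶠ[𝓝 z]
    fun w => ∑ i, dTheta i (vdC (-I) i (fun w => s w • u w) w) := by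
  filter_upwards [hU.mem_nhds hz] with w hw
  rw [deltaLocal, smul_smul, mul_inv_cancel₀ (hs0 w hw), one_smul]

/-- The factors `s` and `s⁻¹` in the middle cancel; the `∂/∂z^i` commute while the `∂/∂θ_i`
anticommute. -/
theorem deltaLocal_deltaLocal (hu : SmoothAt u z) : deltaLocal s (deltaLocal s u) z = 0 := by
  have hsu := smoothAt_smul_coefficient hU hs hz hu
  rw [deltaLocal]
  have h : ∀ j, vdC (-I) j (fun w => s w • deltaLocal s u w) z =
      ∑ i, dTheta i (vdC (-I) j (vdC (-I) i (fun w => s w • u w)) z) := fun j => by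
    rw [vdC_congr (smul_deltaLocal_eventuallyEq hU hs0 hz)]
    exact vdC_sum_linear dTheta fun i => hsu.vdC (-I) i
  simp only [h, map_sum]
  rw [sum_antisymm_eq_zero, smul_zero]
  intro i j
  rw [vdC_vdC hsu, dTheta_dTheta]

/-- Both `s` and `s⁻¹` are holomorphic and pass through `∂̄`, so the sign comes only from moving
`∂/∂θ_i` past `η^j`. -/
theorem deltaLocal_delbarPolyLocal (hu : ∀ w ∈ U, SmoothAt u w) :
    deltaLocal s (delbarPolyLocal u) z + delbarPolyLocal (deltaLocal s u) z = 0 := by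
  have hsu := smoothAt_smul_coefficient hU hs hz (hu z hz)
  have h1 : ∀ i, vdC (-I) i (fun w => s w • delbarPolyLocal u w) z =
      ∑ j, etaBar j * vdC (-I) i (vdC I j (fun w => s w • u w)) z := fun i => by
    have h2 : (fun w => s w • delbarPolyLocal u w) =ᶠ[𝓝 z]
        fun w => ∑ j, etaBar j * vdC I j (fun w => s w • u w) w := by
      filter_upwards [hU.mem_nhds hz] with w hw
      simp only [delbarPolyLocal_eq, Finset.smul_sum, vdC_holomorphic_smul hU hs hw (hu w hw),
        mul_smul_comm]
    rw [vdC_congr h2]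
    exact vdC_sum_linear (fun i => LinearMap.mulLeft ℂ (etaBar i)) fun j => hsu.vdC I j
  have h3 : ∀ j, vdC I j (deltaLocal s u) z = (s z)⁻¹ •
      ∑ i, dTheta i (vdC I j (vdC (-I) i (fun w => s w • u w)) z) := fun j => by
    have h4 := vdC_holomorphic_smul hU (hs.inv hs0) hz (SmoothAt.sum fun i (_ : i ∈ Finset.univ) =>
      (hsu.vdC (-I) i).linear (dTheta i)) j
    refine h4.trans (congrArg _ ?_)
    exact vdC_sum_linear dTheta fun i => hsu.vdC (-I) i
  rw [delbarPolyLocal_eq]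
  rw [deltaLocal]
  simp only [h1, h3, map_sum, mul_smul_comm, ← Finset.smul_sum, ← smul_add, Finset.mul_sum,
    dTheta_etaBar_mul]
  rw [Finset.sum_comm, ← Finset.sum_add_distrib]
  simp only [← Finset.sum_add_distrib, vdC_vdC (c := -I) (c' := I) hsu, neg_add_cancel,
    Finset.sum_const_zero, smul_zero]

theorem deltaLocal_eq (hu : SmoothAt u z) :
    deltaLocal s u z = ∑ i, (dTheta i (vdC (-I) i u z) +
      ((s z)⁻¹ * dC (-I) i s z) • dTheta i (u z)) := by
  simp only [deltaLocal, vdC_smul (contDiffAt_coefficient hU hs hz) hu, map_add, map_smul,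
    Finset.smul_sum, smul_add, smul_smul, inv_mul_cancel₀ (hs0 z hz), one_smul]
  exact Finset.sum_congr rfl fun i _ => add_comm _ _

theorem deltaLocal_smul_add (hu : SmoothAt u z) (hv : SmoothAt v z) (r : ℂ) :
    deltaLocal s (fun w => r • u w + v w) z = r • deltaLocal s u z + deltaLocal s v z := by
  have hru : SmoothAt (fun w => r • u w) z := hu.linear (r • LinearMap.id)
  have h : ∀ i, vdC (-I) i (fun w => r • u w + v w) z =
      r • vdC (-I) i u z + vdC (-I) i v z := fun i => by
    rw [vdC_add hru hv, vdC_const_smul r hu]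
  rw [deltaLocal_eq hU hs hs0 hz (hru.add hv), deltaLocal_eq hU hs hs0 hz hu,
    deltaLocal_eq hU hs hs0 hz hv, Finset.smul_sum, ← Finset.sum_add_distrib]
  refine Finset.sum_congr rfl fun i _ => ?_
  simp only [h, map_add, map_smul, smul_add, smul_smul]
  rw [mul_comm r]
  abel

/-- By `deltaLocal_eq`, the coefficient `s` contributes only a first-order term in the `∂/∂θ_i`;
this is an odd derivation and drops out. The bracket is therefore of Schouten type and independent
of `Ω`. -/
theorem deltaLocal_mul (hu : SmoothAt u z) (hv : SmoothAt v z) :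
    deltaLocal s (fun w => inv (u w) * v w) z - deltaLocal s (fun w => inv (u w)) z * v z -
      u z * deltaLocal s v z =
    ∑ i, (vdC (-I) i u z * dTheta i (v z) - inv (dTheta i (u z)) * vdC (-I) i v z) := by
  have hu' : SmoothAt (fun w => inv (u w)) z :=
    hu.linear (inv : PolyAlg E →ₐ[ℂ] PolyAlg E).toLinearMap
  have h1 : ∀ i, vdC (-I) i (fun w => inv (u w)) z = inv (vdC (-I) i u z) := fun i =>
    vdC_linear hu (inv : PolyAlg E →ₐ[ℂ] PolyAlg E).toLinearMap
  have h2 : ∀ i, inv (dTheta i (u z)) = -dTheta i (inv (u z)) := fun i => inv_contr _ _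
  rw [deltaLocal_eq hU hs hs0 hz (hu'.mul hv), deltaLocal_eq hU hs hs0 hz hu',
    deltaLocal_eq hU hs hs0 hz hv, Finset.sum_mul, Finset.mul_sum, ← Finset.sum_sub_distrib,
    ← Finset.sum_sub_distrib]
  refine Finset.sum_congr rfl fun i _ => ?_
  rw [vdC_mul hu' hv, h1, h2]
  simp only [map_add, dTheta_mul, inv_inv, add_mul, mul_add, smul_add, mul_smul_comm,
    smul_mul_assoc]
  noncomm_ring

end Delta

end LocalOperators

/-! # The operators `∂̄` and `Δ` on a Calabi-Yau threefold -/

section Global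

open Filter Topology Complex ExteriorAlgebra

variable {X : Type*} [TopologicalSpace X] [ChartedSpace E X] [hX : IsManifold 𝓘(ℂ, E) ∞ X]

variable {φ ψ : OpenPartialHomeomorph X E} {x : X}

theorem exists_chartBasis (hφ : φ ∈ atlas E X) (hx : x ∈ φ.source) :
    ∃ b : Module.Basis (Fin 3) ℂ (T x), (∀ i, b i = chartDInv φ x (Pi.single i 1)) ∧
      ∀ i, b.coord i = coordForm i ∘ₗ (chartD φ x).toLinearMap := by
  obtain ⟨e, h1, h2, -⟩ := exists_chart_deriv hφ hx
  refine ⟨(Pi.basisFun ℂ (Fin 3)).map e.symm.toLinearEquiv, fun i => ?_, fun i => ?_⟩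
  · rw [h2]; simp
  · rw [h1]
    refine LinearMap.ext fun v => ?_
    simp [coordForm]

/-- The form `dz¹ ∧ dz² ∧ dz³` on `ℂ³`. -/
def stdTop : FormAlg E := topForm (Pi.basisFun ℂ (Fin 3))

theorem stdTop_eq : stdTop = hol (coordForm 0) * hol (coordForm 1) * hol (coordForm 2) := by
  have h : ∀ i, (Pi.basisFun ℂ (Fin 3)).coord i = coordForm i := fun i =>
    LinearMap.ext fun v => by simp [coordForm]
  rw [stdTop, topForm, h, h, h]

theorem rhoFibre_smul {V : Type*} [AddCommGroup V] [Module ℂ V] (r : ℂ) (Ω : FormAlg V)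
    (α : PolyAlg V) : rhoFibre (r • Ω) α = r • rhoFibre Ω α := by
  simp [rhoFibre]

theorem rhoFibre_stdTop_bijective : Function.Bijective (rhoFibre stdTop) := by
  have h := rhoFibre_bijective (Pi.basisFun ℂ (Fin 3)) one_ne_zero
  rwa [one_smul] at h

theorem hol_mul_stdTop (f : Module.Dual ℂ E) : hol f * stdTop = 0 := hol_mul_topForm _ f

/-- The local expression at a point of a chart, as an algebra map. -/
def localHom (φ : OpenPartialHomeomorph X E) (z : E) : PolySection X →ₐ[ℂ] PolyAlg E :=
  (polyMap (chartD φ (φ.symm z)).toLinearMap (chartDInv φ (φ.symm z)).toLinearMap).comp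
    (Pi.evalAlgHom ℂ (fun x : X => PolyAlg (T x)) (φ.symm z))

omit hX in
theorem localPoly_eq (φ : OpenPartialHomeomorph X E) (α : PolySection X) (z : E) :
    localPoly φ α z = localHom φ z α := rfl

omit hX in
theorem mem_smoothPoly {α : PolySection X} :
    α ∈ smoothPoly X ↔ ∀ φ ∈ atlas E X, ∀ z ∈ φ.target, SmoothAt (localPoly φ α) z := by
  refine ⟨fun h φ hφ z hz => ?_, fun h => ⟨fun φ hφ => ?_, fun x => trivial⟩⟩
  · exact (smoothOn_iff φ.open_target).1 (h.1 φ hφ) z hz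
  · exact (smoothOn_iff φ.open_target).2 (h φ hφ)

omit hX in
theorem mem_bidegree {p q : ℕ} {α : PolySection X} :
    α ∈ bidegree X p q ↔ α ∈ smoothPoly X ∧ ∀ x, α x ∈ polyBidegree (T x) p q :=
  ⟨fun h => ⟨⟨h.1, fun _ => trivial⟩, h.2⟩, fun h => ⟨h.1.1, h.2⟩⟩

omit hX in
theorem mem_ghost {n : ℕ} {α : PolySection X} :
    α ∈ ghost X n ↔ α ∈ smoothPoly X ∧ ∀ x, α x ∈ ⋀[ℂ]^n (T x × ConjDual (T x)) :=
  ⟨fun h => ⟨⟨h.1, fun _ => trivial⟩, h.2⟩, fun h => ⟨h.1.1, h.2⟩⟩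

theorem mem_polyBidegree_iff (hφ : φ ∈ atlas E X) (hx : x ∈ φ.source) {p q : ℕ}
    {α : PolySection X} :
    α x ∈ polyBidegree (T x) p q ↔ localPoly φ α (φ x) ∈ polyBidegree E p q := by
  refine ⟨fun h => ?_, fun h => ?_⟩
  · rw [localPoly_apply hx]
    exact polyMap_mem_polyBidegree _ _ h
  · rw [← polyMap_localPoly hφ hx α]
    exact polyMap_mem_polyBidegree _ _ h

theorem mem_exteriorPower_iff (hφ : φ ∈ atlas E X) (hx : x ∈ φ.source) {n : ℕ}
    {α : PolySection X} :
    α x ∈ ⋀[ℂ]^n (T x × ConjDual (T x)) ↔ localPoly φ α (φ x) ∈ ⋀[ℂ]^n (E × ConjDual E) := by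
  refine ⟨fun h => ?_, fun h => ?_⟩
  · rw [localPoly_apply hx]
    exact map_mem_exteriorPower _ h
  · rw [← polyMap_localPoly hφ hx α]
    exact map_mem_exteriorPower _ h

variable (X) in
/-- The algebra of smooth sections. -/
def smoothAlg : Subalgebra ℂ (PolySection X) where
  carrier := smoothPoly X
  add_mem' := (smoothPoly X).add_mem
  mul_mem' := by
    intro α β hα hβ
    refine mem_smoothPoly.2 fun φ hφ z hz => ?_
    have h : localPoly φ (α * β) = fun w => localPoly φ α w * localPoly φ β w :=
      funext fun w => map_mul (localHom φ w) α β
    rw [h]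
    exact (mem_smoothPoly.1 hα φ hφ z hz).mul (mem_smoothPoly.1 hβ φ hφ z hz)
  algebraMap_mem' := by
    intro r
    refine mem_smoothPoly.2 fun φ hφ z hz => ?_
    have h : localPoly φ (algebraMap ℂ (PolySection X) r) = fun _ => algebraMap ℂ _ r :=
      funext fun w => (localHom φ w).commutes r
    rw [h]
    exact SmoothAt.const _

namespace CalabiYau

variable (Y : CalabiYau X)

omit hX in
theorem exists_coefficient (hφ : φ ∈ atlas E X) : ∃ s : E → ℂ, DifferentiableOn ℂ s φ.target ∧
    (∀ z ∈ φ.target, s z ≠ 0) ∧ ∀ z ∈ φ.target, localForm φ Y.vol z = s z • stdTop := by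
  obtain ⟨s, h1, h2⟩ := Y.vol_holomorphic φ hφ
  refine ⟨s, h1, fun z hz => (h2 z hz).1, fun z hz => ?_⟩
  rw [(h2 z hz).2, stdTop_eq]

include hX in
theorem exists_vol_eq (x : X) : ∃ (b : Module.Basis (Fin 3) ℂ (T x)) (r : ℂ), r ≠ 0 ∧
    Y.vol x = r • topForm b := by
  have hφ := chart_mem_atlas E x
  have hx := mem_chart_source E x
  obtain ⟨s, -, h0, h⟩ := Y.exists_coefficient hφ
  obtain ⟨b, -, hb⟩ := exists_chartBasis hφ hx
  have hz := (chartAt E x).map_source hx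
  refine ⟨b, s (chartAt E x x), h0 _ hz, ?_⟩
  rw [← formPull_localForm hφ hx Y.vol, h _ hz, map_smul, stdTop_eq, topForm, map_mul, map_mul,
    formPull_hol, formPull_hol, formPull_hol, hb, hb, hb]

include hX in
theorem rhoFibre_vol_bijective (x : X) : Function.Bijective (rhoFibre (Y.vol x)) := by
  obtain ⟨b, r, hr, h⟩ := Y.exists_vol_eq x
  have hfin : Module.Finite ℂ (ConjDual (T x)) := inferInstanceAs (Module.Finite ℂ (ConjDual E))
  rw [h]
  exact rhoFibre_bijective b hr

include hX in
theorem rho_rhoInv (a : FormSection X) : Y.rho (Y.rhoInv a) = a := funext fun x =>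
  Function.rightInverse_invFun (Y.rhoFibre_vol_bijective x).2 (a x)

include hX in
theorem rho_injective : Function.Injective Y.rho := fun _ _ h => funext fun x =>
  (Y.rhoFibre_vol_bijective x).1 (congrFun h x)

include hX in
theorem rho_hat (f : FormSection X → FormSection X) (α : PolySection X) :
    Y.rho (Y.hat f α) = f (Y.rho α) := Y.rho_rhoInv _

theorem localForm_rho (hφ : φ ∈ atlas E X) {s : E → ℂ}
    (hs : ∀ z ∈ φ.target, localForm φ Y.vol z = s z • stdTop) (α : PolySection X) {z : E}
    (hz : z ∈ φ.target) :
    localForm φ (Y.rho α) z = s z • rhoFibre stdTop (localPoly φ α z) := by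
  rw [← rhoFibre_smul, ← hs z hz]
  exact formPull_rhoFibre (chartDInv_comp_chartD hφ (φ.map_target hz)) _ _

theorem localForm_rho_eventuallyEq (hφ : φ ∈ atlas E X) {s : E → ℂ}
    (hs : ∀ z ∈ φ.target, localForm φ Y.vol z = s z • stdTop) (α : PolySection X) {z : E}
    (hz : z ∈ φ.target) :
    localForm φ (Y.rho α) =ᶠ[𝓝 z] fun w => rhoFibre stdTop (s w • localPoly φ α w) := by
  filter_upwards [φ.open_target.mem_nhds hz] with w hw
  rw [Y.localForm_rho hφ hs α hw, map_smul]

theorem smoothForm_rho {α : PolySection X} (hα : α ∈ smoothPoly X) : SmoothForm (Y.rho α) := by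
  intro φ hφ z hz
  obtain ⟨s, h1, h0, hs⟩ := Y.exists_coefficient hφ
  refine SmoothAt.congr ?_ (Y.localForm_rho_eventuallyEq hφ hs α hz)
  exact (smoothAt_smul_coefficient φ.open_target h1 hz
    (mem_smoothPoly.1 hα φ hφ z hz)).linear (rhoFibre stdTop)

theorem localPoly_Delta (hφ : φ ∈ atlas E X) {s : E → ℂ} (h1 : DifferentiableOn ℂ s φ.target)
    (h0 : ∀ z ∈ φ.target, s z ≠ 0) (hs : ∀ z ∈ φ.target, localForm φ Y.vol z = s z • stdTop)
    {α : PolySection X} (hα : α ∈ smoothPoly X) {z : E} (hz : z ∈ φ.target) :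
    localPoly φ (Y.Delta α) z = deltaLocal s (localPoly φ α) z := by
  have hsu := smoothAt_smul_coefficient φ.open_target h1 hz (mem_smoothPoly.1 hα φ hφ z hz)
  have h2 : localForm φ (Y.rho (Y.Delta α)) z = localForm φ (del (Y.rho α)) z := by
    rw [Delta, rho_hat]
  rw [Y.localForm_rho hφ hs _ hz, localForm_del hφ (Y.smoothForm_rho hα) hz, delLocal_eq_opC,
    opC_congr (Y.localForm_rho_eventuallyEq hφ hs α hz), opC] at h2
  have h3 : ∀ i, ι ℂ ((coordForm i, 0) : Module.Dual ℂ E × ConjDual E) *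
      vdC (-I) i (fun w => rhoFibre stdTop (s w • localPoly φ α w)) z =
      rhoFibre stdTop (dTheta i (vdC (-I) i (fun w => s w • localPoly φ α w) z)) := fun i => by
    rw [vdC_linear hsu]
    exact hol_mul_rhoFibre (hol_mul_stdTop _) _
  simp only [h3, ← map_sum] at h2
  rw [← map_smul] at h2
  -- Both sides are now values of the constant map `rhoFibre stdTop`, which can be removed by
  -- injectivity.
  rw [deltaLocal, ← rhoFibre_stdTop_bijective.1 h2, smul_smul, inv_mul_cancel₀ (h0 z hz), one_smul]

/-- The holomorphic `s` passes through `∂̄`; the minus sign is that of moving `η` past the odd form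
`Ω`. -/
theorem localPoly_hat_delbar (hφ : φ ∈ atlas E X)
    {α : PolySection X} (hα : α ∈ smoothPoly X) {z : E} (hz : z ∈ φ.target) :
    localPoly φ (Y.hat delbar α) z = -delbarPolyLocal (localPoly φ α) z := by
  obtain ⟨s, h1, h0, hs⟩ := Y.exists_coefficient hφ
  have hu := mem_smoothPoly.1 hα φ hφ z hz
  have hsu := smoothAt_smul_coefficient φ.open_target h1 hz hu
  have h2 : localForm φ (Y.rho (Y.hat delbar α)) z = localForm φ (delbar (Y.rho α)) z := by
    rw [rho_hat]
  rw [Y.localForm_rho hφ hs _ hz, localForm_delbar hφ (Y.smoothForm_rho hα) hz,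
    delbarLocal_eq_opC, opC_congr (Y.localForm_rho_eventuallyEq hφ hs α hz), opC] at h2
  have h3 : ∀ i, ι ℂ ((0, coordFormBar i) : Module.Dual ℂ E × ConjDual E) *
      vdC I i (fun w => rhoFibre stdTop (s w • localPoly φ α w)) z =
      s z • rhoFibre stdTop (-(etaBar i * vdC I i (localPoly φ α) z)) := fun i => by
    rw [vdC_linear hsu, vdC_holomorphic_smul φ.open_target h1 hz hu, map_smul, mul_smul_comm,
      map_neg]
    exact congrArg (s z • ·) (antihol_mul_rhoFibre _ _ _)
  simp only [h3, ← Finset.smul_sum, ← map_sum, Finset.sum_neg_distrib] at h2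
  rw [delbarPolyLocal_eq]
  exact rhoFibre_stdTop_bijective.1 (smul_right_injective _ (h0 z hz) h2)

theorem hat_delbar {α : PolySection X} (hα : α ∈ smoothPoly X) :
    Y.hat delbar α = -delbarPoly α := by
  refine polySection_ext fun x => ?_
  have hφ := chart_mem_atlas E x
  have hx := mem_chart_source E x
  rw [Y.localPoly_hat_delbar hφ hα ((chartAt E x).map_source hx), localPoly_eq, map_neg,
    ← localPoly_eq, localPoly_apply hx, delbarPoly, polyMap_polyMap (chartD_comp_chartDInv hφ hx)]

-- Independence of the chart for `∂̄` on polyvectors is not proved directly: it is carried over from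
-- forms by `ρ`, which is where `Ω` enters.
include Y in
theorem localPoly_delbarPoly (hφ : φ ∈ atlas E X)
    {α : PolySection X} (hα : α ∈ smoothPoly X) {z : E} (hz : z ∈ φ.target) :
    localPoly φ (delbarPoly α) z = delbarPolyLocal (localPoly φ α) z := by
  have h := Y.localPoly_hat_delbar hφ hα hz
  rw [Y.hat_delbar hα, localPoly_eq, map_neg] at h
  exact neg_injective h

theorem Delta_mem {α : PolySection X} (hα : α ∈ smoothPoly X) : Y.Delta α ∈ smoothPoly X := by
  refine mem_smoothPoly.2 fun φ hφ z hz => ?_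
  obtain ⟨s, h1, h0, hs⟩ := Y.exists_coefficient hφ
  refine SmoothAt.congr (smoothAt_deltaLocal φ.open_target h1 h0 hz
    (mem_smoothPoly.1 hα φ hφ z hz)) ?_
  filter_upwards [φ.open_target.mem_nhds hz] with w hw
  exact Y.localPoly_Delta hφ h1 h0 hs hα hw

include Y in
theorem delbarPoly_mem {α : PolySection X} (hα : α ∈ smoothPoly X) :
    delbarPoly α ∈ smoothPoly X := by
  refine mem_smoothPoly.2 fun φ hφ z hz => ?_
  refine SmoothAt.congr (smoothAt_delbarPolyLocal (mem_smoothPoly.1 hα φ hφ z hz)) ?_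
  filter_upwards [φ.open_target.mem_nhds hz] with w hw
  exact Y.localPoly_delbarPoly hφ hα hw

theorem Delta_smul_add {α β : PolySection X} (hα : α ∈ smoothPoly X) (hβ : β ∈ smoothPoly X)
    (r : ℂ) : Y.Delta (r • α + β) = r • Y.Delta α + Y.Delta β := polySection_ext fun x => by
  have hφ := chart_mem_atlas E x
  have hz := (chartAt E x).map_source (mem_chart_source E x)
  obtain ⟨s, h1, h0, hs⟩ := Y.exists_coefficient hφ
  have h := deltaLocal_smul_add (chartAt E x).open_target h1 h0 hz
    (mem_smoothPoly.1 hα _ hφ _ hz) (mem_smoothPoly.1 hβ _ hφ _ hz) r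
  have h3 : localPoly (chartAt E x) (r • α + β) = fun w =>
      r • localPoly (chartAt E x) α w + localPoly (chartAt E x) β w := funext fun w => by
    simp only [localPoly_eq, map_add, map_smul]
  rw [Y.localPoly_Delta hφ h1 h0 hs ((smoothPoly X).add_mem ((smoothPoly X).smul_mem r hα) hβ) hz,
    h3, h, ← Y.localPoly_Delta hφ h1 h0 hs hα hz, ← Y.localPoly_Delta hφ h1 h0 hs hβ hz]
  simp only [localPoly_eq, map_add, map_smul]

include Y in
theorem delbarPoly_smul_add {α β : PolySection X} (hα : α ∈ smoothPoly X)
    (hβ : β ∈ smoothPoly X) (r : ℂ) :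
    delbarPoly (r • α + β) = r • delbarPoly α + delbarPoly β := polySection_ext fun x => by
  have hφ := chart_mem_atlas E x
  have hz := (chartAt E x).map_source (mem_chart_source E x)
  have h := delbarPolyLocal_smul_add (mem_smoothPoly.1 hα _ hφ _ hz)
    (mem_smoothPoly.1 hβ _ hφ _ hz) r
  have h3 : localPoly (chartAt E x) (r • α + β) = fun w =>
      r • localPoly (chartAt E x) α w + localPoly (chartAt E x) β w := funext fun w => by
    simp only [localPoly_eq, map_add, map_smul]
  rw [Y.localPoly_delbarPoly hφ ((smoothPoly X).add_mem ((smoothPoly X).smul_mem r hα) hβ) hz,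
    h3, h, ← Y.localPoly_delbarPoly hφ hα hz, ← Y.localPoly_delbarPoly hφ hβ hz]
  simp only [localPoly_eq, map_add, map_smul]

/-- `Δ` as an endomorphism of the smooth sections. -/
def deltaEnd : Module.End ℂ (smoothAlg X) :=
  IsLinearMap.mk' (fun α => ⟨Y.Delta α, Y.Delta_mem α.2⟩)
    { map_add := fun α β => Subtype.ext <| by
        simpa using Y.Delta_smul_add α.2 β.2 1
      map_smul := fun r α => Subtype.ext <| by
        have h0 : Y.Delta 0 = 0 := by
          simpa using Y.Delta_smul_add (smoothPoly X).zero_mem (smoothPoly X).zero_mem (-1)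
        simpa [h0] using Y.Delta_smul_add α.2 (smoothPoly X).zero_mem r }

/-- `∂̄` as an endomorphism of the smooth sections. -/
def delbarEnd : Module.End ℂ (smoothAlg X) :=
  IsLinearMap.mk' (fun α => ⟨delbarPoly α, Y.delbarPoly_mem α.2⟩)
    { map_add := fun α β => Subtype.ext <| by
        simpa using Y.delbarPoly_smul_add α.2 β.2 1
      map_smul := fun r α => Subtype.ext <| by
        have h0 : delbarPoly (0 : PolySection X) = 0 := by
          simpa using Y.delbarPoly_smul_add (smoothPoly X).zero_mem (smoothPoly X).zero_mem (-1)
        simpa [h0] using Y.delbarPoly_smul_add α.2 (smoothPoly X).zero_mem r }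

theorem coe_deltaEnd (α : smoothAlg X) : (Y.deltaEnd α : PolySection X) = Y.Delta α := rfl

theorem coe_delbarEnd (α : smoothAlg X) : (Y.delbarEnd α : PolySection X) = delbarPoly α := rfl

end CalabiYau

end Global

/-! # Odd second-order operators on superalgebras -/

section Superalgebra

variable {A : Type*} [Ring A] [Algebra ℂ A]

/-- The odd bracket of an operator `D` on an algebra with parity involution `ν`. -/
def bracket (ν : A →ₐ[ℂ] A) (D : Module.End ℂ A) (a b : A) : A :=
  D (ν a * b) - D (ν a) * b - a * D b

/-- An odd operator of square zero and of second order on a supercommutative algebra, with parity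
involution `ν`. -/
structure IsBV (ν : A →ₐ[ℂ] A) (D : Module.End ℂ A) : Prop where
  inv_inv : ∀ a, ν (ν a) = a
  comm_even : ∀ a b, ν a = a → a * b = b * a
  comm_odd : ∀ a b, ν a = -a → a * b = ν b * a
  anti : ∀ a, ν (D a) = -D (ν a)
  sq : ∀ a, D (D a) = 0
  bracket_mul_even : ∀ a b c, ν a = a →
    bracket ν D a (b * c) = bracket ν D a b * c + ν b * bracket ν D a c
  bracket_mul_odd : ∀ a b c, ν a = -a →
    bracket ν D a (b * c) = bracket ν D a b * c + b * bracket ν D a c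

variable {ν : A →ₐ[ℂ] A} {D D₁ D₂ S : Module.End ℂ A} {a b c : A}

theorem bracket_even (ha : ν a = a) : bracket ν D a b = D (a * b) - D a * b - a * D b := by
  rw [bracket, ha]

theorem bracket_odd (ha : ν a = -a) : bracket ν D a b = -D (a * b) + D a * b - a * D b := by
  rw [bracket, ha, neg_mul, map_neg, map_neg, neg_mul, sub_neg_eq_add]

theorem bracket_smul_add_left (r : ℂ) (a b c : A) :
    bracket ν D (r • a + b) c = r • bracket ν D a c + bracket ν D b c := by
  simp only [bracket, map_add, map_smul, add_mul, smul_mul_assoc, smul_sub]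
  abel

theorem bracket_smul_add_right (r : ℂ) (a b c : A) :
    bracket ν D c (r • a + b) = r • bracket ν D c a + bracket ν D c b := by
  simp only [bracket, map_add, map_smul, mul_add, mul_smul_comm, smul_sub]
  abel

theorem bracket_neg_left (a b : A) : bracket ν D (-a) b = -bracket ν D a b := by
  simp only [bracket, map_neg, neg_mul]
  abel

theorem bracket_neg_right (a b : A) : bracket ν D a (-b) = -bracket ν D a b := by
  simp only [bracket, map_neg, mul_neg]
  abel

/-- The bracket of a derivation vanishes. -/
theorem bracket_derivation (hν : ∀ a, ν (ν a) = a)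
    (hD : ∀ a b, D (a * b) = D a * b + ν a * D b) (a b : A) : bracket ν D a b = 0 := by
  rw [bracket, hD, hν]
  abel

/-- The failure of two odd operators to be derivations of each other's brackets is measured by
their anticommutator. -/
theorem bracket_anticommutator (hν : ∀ a, ν (ν a) = a) (h₁ : ∀ a, ν (D₁ a) = -D₁ (ν a))
    (h₂ : ∀ a, ν (D₂ a) = -D₂ (ν a)) (a b : A) :
    (D₁ (bracket ν D₂ a b) - bracket ν D₂ (D₁ a) b + bracket ν D₂ (ν a) (D₁ b)) +
      (D₂ (bracket ν D₁ a b) - bracket ν D₁ (D₂ a) b + bracket ν D₁ (ν a) (D₂ b)) =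
    (D₁ * D₂ + D₂ * D₁) (ν a * b) - (D₁ * D₂ + D₂ * D₁) (ν a) * b -
      ν a * (D₁ * D₂ + D₂ * D₁) b := by
  simp only [bracket, h₁, h₂, hν, map_sub, map_neg, LinearMap.add_apply, Module.End.mul_apply,
    neg_mul, add_mul, mul_add]
  abel

/-- The case of `bracket_anticommutator` in which the bracket of `S` and the anticommutator are both
zero. -/
theorem derivation_bracket (hν : ∀ a, ν (ν a) = a) (h₁ : ∀ a, ν (S a) = -S (ν a))
    (h₂ : ∀ a, ν (D a) = -D (ν a)) (hS : ∀ a b, S (a * b) = S a * b + ν a * S b)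
    (h : S * D + D * S = 0) (a b : A) :
    S (bracket ν D a b) = bracket ν D (S a) b - bracket ν D (ν a) (S b) := by
  have h3 := bracket_anticommutator hν h₁ h₂ a b
  simp only [h, bracket_derivation hν hS, map_zero, LinearMap.zero_apply, zero_mul, mul_zero,
    sub_zero, add_zero] at h3
  rw [eq_sub_iff_add_eq, ← sub_eq_zero, ← h3]
  abel

namespace IsBV

variable (h : IsBV ν D)

include h

theorem map_bracket (a b : A) :
    D (bracket ν D a b) = bracket ν D (D a) b - bracket ν D (ν a) (D b) := by
  simp only [bracket, h.anti, h.inv_inv, h.sq, map_sub, map_neg, neg_mul, mul_zero, zero_mul]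
  abel

theorem inv_bracket (a b : A) : ν (bracket ν D a b) = -bracket ν D (ν a) (ν b) := by
  simp only [bracket, map_sub, h.anti, map_mul, neg_mul, mul_neg]
  abel

theorem map_even (ha : ν a = a) : ν (D a) = -D a := by rw [h.anti, ha]

theorem map_odd (ha : ν a = -a) : ν (D a) = D a := by rw [h.anti, ha, map_neg, neg_neg]

theorem bracket_symm_even (ha : ν a = a) (hb : ν b = b) :
    bracket ν D b a = bracket ν D a b := by
  rw [bracket_even ha, bracket_even hb, h.comm_even b a hb, ← h.comm_even a (D b) ha,
    h.comm_even b (D a) hb]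
  abel

theorem bracket_symm_odd (hb : ν b = -b) (a : A) (ha : ν a = a ∨ ν a = -a) :
    bracket ν D b a = -bracket ν D a b := by
  rcases ha with ha | ha
  · rw [bracket_even ha, bracket_odd hb, h.comm_even a b ha, h.comm_even a _ ha,
      h.comm_odd b (D a) hb, h.map_even ha]
    noncomm_ring
  · rw [bracket_odd ha, bracket_odd hb, h.comm_odd a b ha, h.comm_even _ a (h.map_odd hb),
      h.comm_even _ b (h.map_odd ha), hb]
    simp only [neg_mul, map_neg]
    abel

/-- Expand the inner bracket. The operator `[a, ·]` is a derivation of the product by second order,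
and passing `D` through it costs `[D a, ·]`, again a derivation, whose contributions cancel. The
other parities differ only in signs. -/
theorem jacobi_even (ha : ν a = a) (hb : ν b = b) (c : A) :
    bracket ν D a (bracket ν D b c) =
      bracket ν D (bracket ν D a b) c - bracket ν D b (bracket ν D a c) := by
  have h1 : ν (bracket ν D a b) = -bracket ν D a b := by rw [h.inv_bracket, ha, hb]
  have h2 : ∀ x, bracket ν D a (D x) = bracket ν D (D a) x - D (bracket ν D a x) := fun x => by
    rw [h.map_bracket, ha]; abel
  have h3 : ∀ x y, bracket ν D a (x - y) = bracket ν D a x - bracket ν D a y := fun x y => by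
    rw [sub_eq_add_neg, ← neg_one_smul ℂ y, add_comm, bracket_smul_add_right]
    simp only [neg_smul, one_smul]
    abel
  rw [bracket_even hb, bracket_odd h1, bracket_even (b := bracket ν D a c) hb, h3, h3, h2,
    h.bracket_mul_even a b c ha, h.bracket_mul_even a (D b) c ha,
    h.bracket_mul_even a b (D c) ha, h2, h2, h.bracket_mul_odd (D a) b c (h.map_even ha),
    h.map_even hb, hb]
  simp only [map_add]
  noncomm_ring

theorem jacobi_even_odd (ha : ν a = a) (hb : ν b = -b) (c : A) :
    bracket ν D a (bracket ν D b c) =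
      bracket ν D (bracket ν D a b) c + bracket ν D b (bracket ν D a c) := by
  have h1 : ν (bracket ν D a b) = bracket ν D a b := by
    rw [h.inv_bracket, ha, hb, bracket_neg_right, neg_neg]
  have h2 : ∀ x, bracket ν D a (D x) = bracket ν D (D a) x - D (bracket ν D a x) := fun x => by
    rw [h.map_bracket, ha]; abel
  have h3 : ∀ x y, bracket ν D a (x + y) = bracket ν D a x + bracket ν D a y := fun x y => by
    simpa using bracket_smul_add_right (ν := ν) (D := D) 1 x y a
  rw [bracket_odd hb, bracket_even h1, bracket_odd (b := bracket ν D a c) hb, sub_eq_add_neg,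
    h3, h3, bracket_neg_right, bracket_neg_right, h2,
    h.bracket_mul_even a b c ha, h.bracket_mul_even a (D b) c ha,
    h.bracket_mul_even a b (D c) ha, h2, h2, h.bracket_mul_odd (D a) b c (h.map_even ha),
    h.map_odd hb, hb]
  simp only [map_add, neg_mul, map_neg]
  noncomm_ring

theorem jacobi_odd_even (ha : ν a = -a) (hb : ν b = b) (c : A) :
    bracket ν D a (bracket ν D b c) =
      bracket ν D (bracket ν D a b) c + bracket ν D b (bracket ν D a c) := by
  have h1 : ν (bracket ν D a b) = bracket ν D a b := by
    rw [h.inv_bracket, ha, hb, bracket_neg_left, neg_neg]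
  have h2 : ∀ x, bracket ν D a (D x) = D (bracket ν D a x) - bracket ν D (D a) x := fun x => by
    rw [h.map_bracket, ha, bracket_neg_left]; abel
  have h3 : ∀ x y, bracket ν D a (x + y) = bracket ν D a x + bracket ν D a y := fun x y => by
    simpa using bracket_smul_add_right (ν := ν) (D := D) 1 x y a
  rw [bracket_even hb, bracket_even h1, bracket_even (b := bracket ν D a c) hb, sub_eq_add_neg,
    sub_eq_add_neg, h3, h3, bracket_neg_right, bracket_neg_right, h2,
    h.bracket_mul_odd a b c ha, h.bracket_mul_odd a (D b) c ha,
    h.bracket_mul_odd a b (D c) ha, h2, h2, h.bracket_mul_even (D a) b c (h.map_odd ha), hb]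
  simp only [map_add]
  noncomm_ring

theorem jacobi_odd (ha : ν a = -a) (hb : ν b = -b) (c : A) :
    bracket ν D a (bracket ν D b c) =
      bracket ν D (bracket ν D a b) c + bracket ν D b (bracket ν D a c) := by
  have h1 : ν (bracket ν D a b) = -bracket ν D a b := by
    rw [h.inv_bracket, ha, hb, bracket_neg_right, bracket_neg_left, neg_neg]
  have h2 : ∀ x, bracket ν D a (D x) = D (bracket ν D a x) - bracket ν D (D a) x := fun x => by
    rw [h.map_bracket, ha, bracket_neg_left]; abel
  have h3 : ∀ x y, bracket ν D a (x + y) = bracket ν D a x + bracket ν D a y := fun x y => by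
    simpa using bracket_smul_add_right (ν := ν) (D := D) 1 x y a
  rw [bracket_odd hb, bracket_odd h1, bracket_odd (b := bracket ν D a c) hb, sub_eq_add_neg,
    h3, h3, bracket_neg_right, bracket_neg_right, h2,
    h.bracket_mul_odd a b c ha, h.bracket_mul_odd a (D b) c ha,
    h.bracket_mul_odd a b (D c) ha, h2, h2, h.bracket_mul_even (D a) b c (h.map_odd ha), hb]
  simp only [map_add]
  noncomm_ring

/-- Conjugation by an automorphism. -/
theorem neg_conj {τ τ' : A →ₐ[ℂ] A} (hτ : ∀ a, τ (τ' a) = a) (hτ' : ∀ a, τ' (τ a) = a)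
    (hν : ∀ a, τ (ν a) = ν (τ a)) {R : Module.End ℂ A} (hR : ∀ a, R a = -τ (D (τ' a))) :
    IsBV ν R ∧ ∀ a b, bracket ν R a b = -τ (bracket ν D (τ' a) (τ' b)) := by
  have hν' : ∀ a, τ' (ν a) = ν (τ' a) := fun a => by
    rw [← hτ' (ν (τ' a)), hν, hτ]
  have hb : ∀ a b, bracket ν R a b = -τ (bracket ν D (τ' a) (τ' b)) := fun a b => by
    simp only [bracket, hR, hν', map_sub, map_mul, hτ]
    noncomm_ring
  refine ⟨⟨h.inv_inv, h.comm_even, h.comm_odd, fun a => ?_, fun a => ?_, fun a b c ha => ?_,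
    fun a b c ha => ?_⟩, hb⟩
  · rw [hR, hR, map_neg, ← hν, h.anti, hν', map_neg]
  · rw [hR, hR, map_neg, hτ', map_neg, h.sq, neg_zero, map_zero, neg_zero]
  · have ha' : ν (τ' a) = τ' a := by rw [← hν', ha]
    simp only [hb, map_mul, h.bracket_mul_even _ _ _ ha', map_add, hν, hτ]
    noncomm_ring
  · have ha' : ν (τ' a) = -τ' a := by rw [← hν', ha, map_neg]
    simp only [hb, map_mul, h.bracket_mul_odd _ _ _ ha', map_add, hτ]
    noncomm_ring

end IsBV

end Superalgebra

/-! # Representations of `sl₂` -/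

section SlTwo

attribute [local instance 100] LieRing.ofAssociativeRing

variable {L : Type*} [Ring L] [Algebra ℂ L] {e f k d : L}

/-- A highest weight vector of weight one for the adjoint action is annihilated by the square of
the lowering operator. -/
theorem lie_lie_eq_zero_of_weight_one (hef : ⁅e, f⁆ = k) (hkf : ⁅k, f⁆ = (-2 : ℂ) • f)
    (hed : ⁅e, d⁆ = 0) (hkd : ⁅k, d⁆ = d) (hf : IsNilpotent f) : ⁅f, ⁅f, d⁆⁆ = 0 := by
  have hk : ∀ (c : ℂ) (y : L), ⁅k, y⁆ = c • y → ⁅k, ⁅f, y⁆⁆ = (c - 2) • ⁅f, y⁆ := fun c y hy => by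
    rw [leibniz_lie, hkf, hy, smul_lie, lie_smul, ← add_smul]
    congr 1
    ring
  have he : ∀ y : L, ⁅e, ⁅f, y⁆⁆ = ⁅k, y⁆ + ⁅f, ⁅e, y⁆⁆ := fun y => by
    rw [leibniz_lie, hef]
  -- The `f`-string through `[f, [f, d]]`; its members have weights `-3, -5, -7, …`.
  set y : ℕ → L := fun n => (LieAlgebra.ad ℂ L f ^ n) ⁅f, ⁅f, d⁆⁆ with hy
  have hy0 : y 0 = ⁅f, ⁅f, d⁆⁆ := by simp [hy]
  have hys : ∀ n, y (n + 1) = ⁅f, y n⁆ := fun n => by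
    simp only [hy, pow_succ', Module.End.mul_apply, LieAlgebra.ad_apply]
  have hky : ∀ n : ℕ, ⁅k, y n⁆ = (-3 - 2 * (n : ℂ)) • y n := fun n => by
    induction n with
    | zero =>
      rw [hy0]
      have h1 : ⁅k, d⁆ = (1 : ℂ) • d := by rw [one_smul, hkd]
      have h2 := hk _ _ (hk _ _ h1)
      rw [h2]
      congr 1
      norm_num
    | succ n ih =>
      rw [hys, hk _ _ ih]
      congr 1
      push_cast
      ring
  -- The contributions of `d`, of weight `1`, and of `[f, d]`, of weight `-1`, cancel. So `y 0`
  -- would be a primitive vector of negative weight.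
  have hey0 : ⁅e, y 0⁆ = 0 := by
    have h1 : ⁅k, d⁆ = (1 : ℂ) • d := by rw [one_smul, hkd]
    rw [hy0, he, hk _ _ h1, he, hed, hkd, lie_zero, add_zero, ← one_smul ℂ ⁅f, d⁆, smul_smul,
      ← add_smul]
    norm_num
  have hey : ∀ n : ℕ, ⁅e, y (n + 1)⁆ = (-((n + 1 : ℂ) * (n + 3))) • y n := fun n => by
    induction n with
    | zero =>
      rw [hys, he, hky, hey0, lie_zero, add_zero]
      norm_num
    | succ n ih =>
      rw [hys, he, hky, ih, lie_smul, ← hys, ← add_smul]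
      congr 1
      push_cast
      ring
  obtain ⟨N, hN⟩ := LieAlgebra.ad_nilpotent_of_nilpotent (R := ℂ) hf
  have hyN : y N = 0 := by simp [hy, hN]
  -- The coefficient `-(n+1)(n+3)` never vanishes, so a zero in the string propagates back to its
  -- beginning; nilpotency of `f` supplies a zero.
  have hdown : ∀ n, y n = 0 → y 0 = 0 := fun n => by
    induction n with
    | zero => exact id
    | succ n ih =>
      intro hn
      refine ih ?_
      have h1 := hey n
      rw [hn, lie_zero] at h1
      refine (smul_eq_zero.1 h1.symm).resolve_left (neg_ne_zero.2 (mul_ne_zero ?_ ?_))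
      · exact_mod_cast Nat.succ_ne_zero n
      · exact_mod_cast Nat.succ_ne_zero (n + 2)
  rw [← hy0]
  exact hdown N hyN

/-- The Weyl element carries a highest weight vector of weight one to its lowest weight
partner. -/
theorem weyl_mul {N : ℕ} (he : e ^ N = 0) (hf : f ^ N = 0) (hef : ⁅e, f⁆ = k)
    (hkf : ⁅k, f⁆ = (-2 : ℂ) • f) (hed : ⁅e, d⁆ = 0) (hkd : ⁅k, d⁆ = d) :
    expSum N (-e) * expSum N f * expSum N (-e) * d =
      ⁅f, d⁆ * (expSum N (-e) * expSum N f * expSum N (-e)) := by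
  have hne : (-e) ^ N = 0 := by rw [neg_pow, he, mul_zero]
  have h0 := lie_lie_eq_zero_of_weight_one hef hkf hed hkd ⟨N, hf⟩
  have hed' : e * d = d * e := sub_eq_zero.1 hed
  have h1 : expSum N (-e) * d = d * expSum N (-e) := by
    simpa using expSum_mul (b := 0) hne (by rw [neg_mul, mul_neg, add_zero, hed'])
      (Commute.zero_right _)
  have h2 : expSum N f * d = (d + ⁅f, d⁆) * expSum N f :=
    expSum_mul hf (by rw [Ring.lie_def]; abel) (sub_eq_zero.1 h0)
  have h3 : ⁅e, ⁅f, d⁆⁆ = d := by rw [leibniz_lie, hef, hkd, hed, lie_zero, add_zero]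
  have h4 : expSum N (-e) * ⁅f, d⁆ = (⁅f, d⁆ + -d) * expSum N (-e) := by
    refine expSum_mul hne ?_ ?_
    · have h5 : e * ⁅f, d⁆ - ⁅f, d⁆ * e = d := h3
      rw [neg_mul, mul_neg, sub_eq_iff_eq_add.1 h5]
      abel
    · exact (Commute.neg_left (Commute.neg_right hed'))
  -- The three factors move past `d` one after another: `d ↦ d`, then `d ↦ d + [f, d]`, then `d +
  -- [f, d] ↦ d + ([f, d] - d) = [f, d]`.
  calc _ = expSum N (-e) * (expSum N f * (expSum N (-e) * d)) := by simp only [mul_assoc]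
    _ = expSum N (-e) * ((d + ⁅f, d⁆) * (expSum N f * expSum N (-e))) := by
      rw [h1, ← mul_assoc (expSum N f), h2, mul_assoc]
    _ = (expSum N (-e) * d + expSum N (-e) * ⁅f, d⁆) * (expSum N f * expSum N (-e)) := by
      rw [← mul_assoc, mul_add]
    _ = ⁅f, d⁆ * expSum N (-e) * (expSum N f * expSum N (-e)) := by
      rw [h1, h4, ← add_mul]
      congr 2
      abel
    _ = _ := by simp only [mul_assoc]

end SlTwo

/-! # Fibrewise operators -/

section FibreOperators

open Filter Topology Complex ExteriorAlgebra

variable {z : E}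

theorem smoothAt_map {u : E → Module.End ℂ (E × ConjDual E)} {f : E → PolyAlg E}
    (hu : ∀ m, SmoothAt (fun w => u w m) z) (hf : SmoothAt f z) :
    SmoothAt (fun w => ExteriorAlgebra.map (u w) (f w)) z := by
  refine SmoothAt.family (P := fun w => (ExteriorAlgebra.map (u w)).toLinearMap) (fun x => ?_) hf
  simp only [AlgHom.toLinearMap_apply]
  induction x using exterior_induction with
  | one => simpa using SmoothAt.const _
  | smul r x hx =>
    simp only [map_smul]
    exact hx.smul contDiffAt_const
  | add x y hx hy => simp only [map_add]; exact hx.add hy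
  | ι_mul m x hx =>
    simp only [map_mul, map_apply_ι]
    exact ((hu m).linear (ι ℂ)).mul hx

theorem smoothAt_derExt {u : E → Module.End ℂ (E × ConjDual E)} {f : E → PolyAlg E}
    (hu : ∀ m, SmoothAt (fun w => u w m) z) (hf : SmoothAt f z) :
    SmoothAt (fun w => derExt (u w) (f w)) z := by
  refine SmoothAt.family (fun x => ?_) hf
  induction x using exterior_induction with
  | one => simpa using SmoothAt.const _
  | smul r x hx =>
    simp only [map_smul]
    exact hx.smul contDiffAt_const
  | add x y hx hy => simp only [map_add]; exact hx.add hy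
  | ι_mul m x hx =>
    simp only [derExt_ι_mul]
    exact (((hu m).linear (ι ℂ)).mul (SmoothAt.const _)).add ((SmoothAt.const _).mul hx)

theorem derExt_smul {M : Type*} [AddCommGroup M] [Module ℂ M] (r : ℂ) (u : Module.End ℂ M) :
    derExt (r • u) = r • derExt u := by
  refine LinearMap.ext fun x => ?_
  induction x using exterior_induction with
  | one => simp
  | smul r x hx => rw [map_smul, hx, map_smul]
  | add x y hx hy => rw [map_add, hx, hy, map_add]
  | ι_mul m x hx =>
    rw [derExt_ι_mul, hx]
    simp only [LinearMap.smul_apply, derExt_ι_mul, map_smul, smul_mul_assoc, mul_smul_comm,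
      smul_add]

/-- The endomorphism `(v, k) ↦ (Q k, P v)`. -/
def blockMap {V : Type*} [AddCommGroup V] [Module ℂ V] (P : V →ₗ[ℂ] ConjDual V)
    (Q : ConjDual V →ₗ[ℂ] V) : Module.End ℂ (V × ConjDual V) :=
  LinearMap.prod (Q ∘ₗ LinearMap.snd ℂ V (ConjDual V)) (P ∘ₗ LinearMap.fst ℂ V (ConjDual V))

theorem smoothAt_blockMap {P : E → E →ₗ[ℂ] ConjDual E} {Q : E → ConjDual E →ₗ[ℂ] E}
    (hP : ∀ v, SmoothAt (fun w => P w v) z) (hQ : ∀ k, SmoothAt (fun w => Q w k) z)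
    (m : E × ConjDual E) : SmoothAt (fun w => blockMap (P w) (Q w) m) z := by
  refine SmoothAt.congr (((hQ m.2).linear (LinearMap.inl ℂ E (ConjDual E))).add
    ((hP m.1).linear (LinearMap.inr ℂ E (ConjDual E)))) (Eventually.of_forall fun w => ?_)
  simp [blockMap]

theorem contDiffAt_det {n : ℕ} {M : E → Matrix (Fin n) (Fin n) ℂ}
    (hM : ∀ i j, ContDiffAt ℝ ∞ (fun w => M w i j) z) :
    ContDiffAt ℝ ∞ (fun w => (M w).det) z := by
  simp only [Matrix.det_apply']
  exact ContDiffAt.sum fun σ _ => contDiffAt_const.mul (contDiffAt_prod fun i _ => hM _ _)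

theorem contDiffAt_inv_apply {n : ℕ} {M : E → Matrix (Fin n) (Fin n) ℂ}
    (hM : ∀ i j, ContDiffAt ℝ ∞ (fun w => M w i j) z) (h : (M z).det ≠ 0) (i j : Fin n) :
    ContDiffAt ℝ ∞ (fun w => (M w)⁻¹ i j) z := by
  simp only [Matrix.inv_def, Ring.inverse_eq_inv', Matrix.smul_apply, smul_eq_mul,
    Matrix.adjugate_apply]
  refine ((contDiffAt_det hM).inv h).mul (contDiffAt_det fun i' j' => ?_)
  by_cases hi : i' = j
  · subst hi
    simpa using contDiffAt_const
  · simpa [Matrix.updateRow_ne hi] using hM i' j'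

/-- The inverse of a smooth family of isomorphisms is smooth. -/
theorem smoothAt_inverse {P : E → E →ₗ[ℂ] ConjDual E} {Q : E → ConjDual E →ₗ[ℂ] E}
    (hP : ∀ v, SmoothAt (fun w => P w v) z) (hPQ : ∀ᶠ w in 𝓝 z, ∀ k, P w (Q w k) = k)
    (k : ConjDual E) : SmoothAt (fun w => Q w k) z := by
  -- In coordinates `Q` is the inverse of the matrix `M` of the metric, so its entries are cofactors
  -- divided by the determinant.
  let M : E → Matrix (Fin 3) (Fin 3) ℂ := fun w =>
    Matrix.of fun j i => P w (Pi.single i 1) (Pi.single j 1)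
  let N : E → Matrix (Fin 3) (Fin 3) ℂ := fun w => Matrix.of fun i l => Q w (coordFormBar l) i
  have hM : ∀ j i, ContDiffAt ℝ ∞ (fun w => M w j i) z := fun j i =>
    hP (Pi.single i 1) { toFun := fun k => k (Pi.single j 1), map_add' := fun _ _ => rfl,
                         map_smul' := fun _ _ => rfl }
  have hMN : ∀ᶠ w in 𝓝 z, M w * N w = 1 := by
    filter_upwards [hPQ] with w hw
    ext j l
    have h1 := LinearMap.congr_fun (hw (coordFormBar l)) (Pi.single j 1)
    rw [vec_eq_sum (Q w (coordFormBar l)), map_sum] at h1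
    simp only [map_smul, LinearMap.sum_apply, LinearMap.smul_apply, smul_eq_mul] at h1
    rw [Matrix.mul_apply, Matrix.one_apply]
    simp only [M, N, Matrix.of_apply]
    rw [Finset.sum_congr rfl fun i _ => mul_comm _ _, h1]
    simp [coordFormBar, Pi.single_apply, eq_comm]
  have hdet : (M z).det ≠ 0 :=
    (Matrix.isUnit_det_of_right_inverse hMN.self_of_nhds).ne_zero
  have hN : ∀ i l, ContDiffAt ℝ ∞ (fun w => N w i l) z := fun i l => by
    refine (contDiffAt_inv_apply hM hdet i l).congr_of_eventuallyEq ?_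
    filter_upwards [hMN] with w hw
    rw [Matrix.inv_eq_right_inv hw]
  have hQ : (fun w => Q w k) = fun w => ∑ l, k (Pi.single l 1) •
      ∑ i, N w i l • (Pi.single i 1 : E) := funext fun w => by
    conv_lhs => rw [conjDual_eq_sum k, map_sum]
    refine Finset.sum_congr rfl fun l _ => ?_
    rw [map_smul]
    exact congrArg _ (vec_eq_sum _)
  rw [hQ]
  exact smoothAt_sum_smul (h := fun i l w => N w i l) hN _ _

variable {X : Type*} [TopologicalSpace X] [ChartedSpace E X] [hX : IsManifold 𝓘(ℂ, E) ∞ X]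

variable {φ : OpenPartialHomeomorph X E} {x : X}

/-! ### The operators of the metric on smooth sections -/

namespace CalabiYau

variable (Y : CalabiYau X)

/-- The metric in a chart. -/
def localMetric (φ : OpenPartialHomeomorph X E) (z : E) : E →ₗ[ℂ] ConjDual E :=
  conjPull (chartDInv φ (φ.symm z)).toLinearMap ∘ₗ (Y.metric (φ.symm z)).toLinearMap ∘ₗ
    (chartDInv φ (φ.symm z)).toLinearMap

/-- The inverse of the metric in a chart. -/
def localMetricInv (φ : OpenPartialHomeomorph X E) (z : E) : ConjDual E →ₗ[ℂ] E :=
  (chartD φ (φ.symm z)).toLinearMap ∘ₗ (Y.metric (φ.symm z)).symm.toLinearMap ∘ₗ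
    conjPull (chartD φ (φ.symm z)).toLinearMap

omit hX in
theorem smoothAt_localMetric (hφ : φ ∈ atlas E X) {z : E} (hz : z ∈ φ.target) (v : E) :
    SmoothAt (fun w => Y.localMetric φ w v) z := by
  have h : (fun w => Y.localMetric φ w v) = fun w => ∑ i, v i •
      ∑ j, Y.metric (φ.symm w) (chartDInv φ (φ.symm w) (Pi.single i 1))
        (chartDInv φ (φ.symm w) (Pi.single j 1)) • coordFormBar j := funext fun w => by
    conv_lhs => rw [vec_eq_sum v, map_sum]
    refine Finset.sum_congr rfl fun i _ => ?_
    rw [map_smul]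
    exact congrArg _ (conjDual_eq_sum _)
  rw [h]
  exact smoothAt_sum_smul (h := fun j i w => Y.metric (φ.symm w)
    (chartDInv φ (φ.symm w) (Pi.single i 1)) (chartDInv φ (φ.symm w) (Pi.single j 1)))
    (fun j i => (Y.metric_smooth φ hφ i j).contDiffAt (φ.open_target.mem_nhds hz)) _ _

theorem smoothAt_localMetricInv (hφ : φ ∈ atlas E X) {z : E} (hz : z ∈ φ.target)
    (k : ConjDual E) : SmoothAt (fun w => Y.localMetricInv φ w k) z := by
  refine smoothAt_inverse (fun v => Y.smoothAt_localMetric hφ hz v) ?_ k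
  filter_upwards [φ.open_target.mem_nhds hz] with w hw k
  have h1 := LinearMap.congr_fun (chartDInv_comp_chartD hφ (φ.map_target hw))
  have h2 := LinearMap.congr_fun (chartD_comp_chartDInv hφ (φ.map_target hw))
  simp only [LinearMap.comp_apply, LinearMap.id_apply] at h1 h2
  simp only [localMetric, localMetricInv, LinearMap.comp_apply, h1, LinearEquiv.coe_coe,
    LinearEquiv.apply_symm_apply]
  exact LinearMap.ext fun v => congrArg k (h2 v)

/-- The two scalars allow `eMap`, `fMap` and `jMap` to be treated at once, by the choices `(1, 0)`,
`(0, 1)` and `(-1, 1)`. -/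
theorem polyMap_blockMap (hφ : φ ∈ atlas E X) {z : E} (hz : z ∈ φ.target) (r s : ℂ) :
    ((chartD φ (φ.symm z)).toLinearMap.prodMap
        (conjPull (chartDInv φ (φ.symm z)).toLinearMap)) ∘ₗ
      blockMap (r • (Y.metric (φ.symm z)).toLinearMap)
        (s • (Y.metric (φ.symm z)).symm.toLinearMap) =
    blockMap (r • Y.localMetric φ z) (s • Y.localMetricInv φ z) ∘ₗ
      ((chartD φ (φ.symm z)).toLinearMap.prodMap
        (conjPull (chartDInv φ (φ.symm z)).toLinearMap)) := by
  have h1 := LinearMap.congr_fun (chartDInv_comp_chartD hφ (φ.map_target hz))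
  simp only [LinearMap.comp_apply, LinearMap.id_apply] at h1
  have h3 : ∀ k : ConjDual (T (φ.symm z)), conjPull (chartD φ (φ.symm z)).toLinearMap
      (conjPull (chartDInv φ (φ.symm z)).toLinearMap k) = k :=
    fun k => LinearMap.ext fun v => congrArg k (h1 v)
  refine LinearMap.ext fun m => Prod.ext ?_ ?_
  · simp [blockMap, localMetricInv, h3]
  · simp only [blockMap, localMetric, LinearMap.comp_apply, LinearMap.prod_apply,
      LinearMap.prodMap_apply, LinearMap.smul_apply, Function.prod_apply, LinearMap.fst_apply,
      map_smul]
    exact congrArg (fun v => r • conjPull _ (Y.metric _ v)) (h1 m.1).symm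

variable (X) in
/-- The endomorphism of the smooth sections given by endomorphisms of the fibres. -/
def _root_.KodairaSpencer.fibreEnd (L : (x : X) → Module.End ℂ (PolyAlg (T x)))
    (hL : ∀ α ∈ smoothPoly X, (fun x => L x (α x)) ∈ smoothPoly X) :
    Module.End ℂ (smoothAlg X) where
  toFun α := ⟨fun x => L x (α.1 x), hL α.1 α.2⟩
  map_add' _ _ := Subtype.ext <| funext fun x => map_add (L x) _ _
  map_smul' r _ := Subtype.ext <| funext fun x => map_smul (L x) r _

theorem smooth_map_blockMap (r s : ℂ) {α : PolySection X} (hα : α ∈ smoothPoly X) :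
    (fun x => ExteriorAlgebra.map (blockMap (r • (Y.metric x).toLinearMap)
      (s • (Y.metric x).symm.toLinearMap)) (α x)) ∈ smoothPoly X := by
  refine mem_smoothPoly.2 fun φ hφ z hz => ?_
  refine SmoothAt.congr (smoothAt_map (smoothAt_blockMap (P := fun w => r • Y.localMetric φ w)
    (Q := fun w => s • Y.localMetricInv φ w)
    (fun v => (Y.smoothAt_localMetric hφ hz v).linear (r • LinearMap.id))
    fun k => (Y.smoothAt_localMetricInv hφ hz k).linear (s • LinearMap.id))
    (mem_smoothPoly.1 hα φ hφ z hz)) ?_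
  filter_upwards [φ.open_target.mem_nhds hz] with w hw
  have h := DFunLike.congr_fun (congrArg ExteriorAlgebra.map (Y.polyMap_blockMap hφ hw r s))
    (α (φ.symm w))
  rw [← ExteriorAlgebra.map_comp_map, ← ExteriorAlgebra.map_comp_map] at h
  exact h

theorem smooth_derExt_blockMap (r s : ℂ) {α : PolySection X} (hα : α ∈ smoothPoly X) :
    (fun x => derExt (blockMap (r • (Y.metric x).toLinearMap)
      (s • (Y.metric x).symm.toLinearMap)) (α x)) ∈ smoothPoly X := by
  refine mem_smoothPoly.2 fun φ hφ z hz => ?_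
  refine SmoothAt.congr (smoothAt_derExt (smoothAt_blockMap (P := fun w => r • Y.localMetric φ w)
    (Q := fun w => s • Y.localMetricInv φ w)
    (fun v => (Y.smoothAt_localMetric hφ hz v).linear (r • LinearMap.id))
    fun k => (Y.smoothAt_localMetricInv hφ hz k).linear (s • LinearMap.id))
    (mem_smoothPoly.1 hα φ hφ z hz)) ?_
  filter_upwards [φ.open_target.mem_nhds hz] with w hw
  exact map_derExt (Y.polyMap_blockMap hφ hw r s) (α (φ.symm w))

omit hX in
/-- A natural operator on exterior algebras preserves smooth sections. -/
theorem _root_.KodairaSpencer.smooth_natural (L : (x : X) → Module.End ℂ (PolyAlg (T x)))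
    (L' : Module.End ℂ (PolyAlg E))
    (h : ∀ (x : X) (f : T x →ₗ[ℂ] E) (f' : E →ₗ[ℂ] T x) (y : PolyAlg (T x)),
      polyMap f f' (L x y) = L' (polyMap f f' y))
    {α : PolySection X} (hα : α ∈ smoothPoly X) : (fun x => L x (α x)) ∈ smoothPoly X := by
  refine mem_smoothPoly.2 fun φ hφ z hz => ?_
  exact SmoothAt.congr ((mem_smoothPoly.1 hα φ hφ z hz).linear L')
    (Eventually.of_forall fun w => h _ _ _ _)

variable (X) in
/-- The parity involution of the smooth sections. -/
def _root_.KodairaSpencer.invHom : smoothAlg X →ₐ[ℂ] smoothAlg X where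
  toFun α := ⟨fun x => inv (α.1 x), smooth_natural (fun _ => inv.toLinearMap) inv.toLinearMap
    (fun _ _ _ y => map_inv _ y) α.2⟩
  map_one' := Subtype.ext <| funext fun _ => map_one inv
  map_mul' _ _ := Subtype.ext <| funext fun _ => map_mul inv _ _
  map_zero' := Subtype.ext <| funext fun _ => map_zero inv
  map_add' _ _ := Subtype.ext <| funext fun _ => map_add inv _ _
  commutes' r := Subtype.ext <| funext fun _ => inv.commutes r

variable (X) in
/-- The reversal of the smooth sections. -/
def _root_.KodairaSpencer.revEnd : Module.End ℂ (smoothAlg X) :=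
  fibreEnd X (fun _ => rev) fun _ => smooth_natural _ rev fun _ _ _ y => map_rev _ y

variable (X) in
/-- The weight operator. -/
def _root_.KodairaSpencer.kEnd : Module.End ℂ (smoothAlg X) :=
  fibreEnd X (fun x => derExt (kMap (T x))) fun _ => smooth_natural _ (derExt (kMap E))
    fun _ f f' y => map_derExt (LinearMap.ext fun m => Prod.ext (by simp) (by simp)) y

/-- The raising operator. -/
def eEnd : Module.End ℂ (smoothAlg X) :=
  fibreEnd X (fun x => derExt (eMap (Y.metric x))) fun α hα => by
    have h : ∀ x, eMap (Y.metric x) = blockMap ((1 : ℂ) • (Y.metric x).toLinearMap)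
        ((0 : ℂ) • (Y.metric x).symm.toLinearMap) := fun x =>
      LinearMap.ext fun m => by simp [blockMap]
    simp only [h]
    exact Y.smooth_derExt_blockMap 1 0 hα

/-- The lowering operator. -/
def fEnd : Module.End ℂ (smoothAlg X) :=
  fibreEnd X (fun x => derExt (fMap (Y.metric x))) fun α hα => by
    have h : ∀ x, fMap (Y.metric x) = blockMap ((0 : ℂ) • (Y.metric x).toLinearMap)
        ((1 : ℂ) • (Y.metric x).symm.toLinearMap) := fun x =>
      LinearMap.ext fun m => by simp [blockMap]
    simp only [h]
    exact Y.smooth_derExt_blockMap 0 1 hα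

/-- The automorphism `v ↦ -g v`, `k ↦ g⁻¹ k` of the smooth sections. -/
def tau : smoothAlg X →ₐ[ℂ] smoothAlg X where
  toFun α := ⟨fun x => ExteriorAlgebra.map (jMap (Y.metric x)) (α.1 x), by
    have h : ∀ x, jMap (Y.metric x) = blockMap ((-1 : ℂ) • (Y.metric x).toLinearMap)
        ((1 : ℂ) • (Y.metric x).symm.toLinearMap) := fun x =>
      LinearMap.ext fun m => by simp [blockMap]
    simp only [h]
    exact Y.smooth_map_blockMap (-1) 1 α.2⟩
  map_one' := Subtype.ext <| funext fun _ => map_one _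
  map_mul' _ _ := Subtype.ext <| funext fun _ => map_mul _ _ _
  map_zero' := Subtype.ext <| funext fun _ => map_zero _
  map_add' _ _ := Subtype.ext <| funext fun _ => map_add _ _ _
  commutes' r := Subtype.ext <| funext fun x =>
    (ExteriorAlgebra.map (jMap (Y.metric x))).commutes r

omit hX in
theorem _root_.KodairaSpencer.smoothAlg_ext {α β : smoothAlg X} (h : ∀ x, α.1 x = β.1 x) :
    α = β := Subtype.ext (funext h)

theorem tau_tau (α : smoothAlg X) : Y.tau (Y.tau α) = invHom X α :=
  smoothAlg_ext fun x => map_jMap_jMap (Y.metric x) (α.1 x)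

omit hX in
theorem _root_.KodairaSpencer.invHom_invHom (α : smoothAlg X) : invHom X (invHom X α) = α :=
  smoothAlg_ext fun x => inv_inv (α.1 x)

theorem tau_invHom (α : smoothAlg X) : Y.tau (invHom X α) = invHom X (Y.tau α) :=
  smoothAlg_ext fun x => map_inv (jMap (Y.metric x)) (α.1 x)

theorem tau_revEnd (α : smoothAlg X) : Y.tau (revEnd X α) = revEnd X (Y.tau α) :=
  smoothAlg_ext fun x => map_rev (jMap (Y.metric x)) (α.1 x)

theorem lie_eEnd_fEnd : Y.eEnd * Y.fEnd - Y.fEnd * Y.eEnd = kEnd X :=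
  LinearMap.ext fun α => smoothAlg_ext fun x => by
    have h := LinearMap.congr_fun (derExt_commutator (eMap (Y.metric x)) (fMap (Y.metric x)))
      (α.1 x)
    rw [eMap_fMap] at h
    exact h

theorem lie_kEnd_fEnd : kEnd X * Y.fEnd - Y.fEnd * kEnd X = (-2 : ℂ) • Y.fEnd :=
  LinearMap.ext fun α => smoothAlg_ext fun x => by
    have h := LinearMap.congr_fun (derExt_commutator (kMap (T x)) (fMap (Y.metric x)))
      (α.1 x)
    have h2 : kMap (T x) * fMap (Y.metric x) - fMap (Y.metric x) * kMap (T x) =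
        (-2 : ℂ) • fMap (Y.metric x) := by
      refine LinearMap.ext fun m => Prod.ext ?_ ?_
      · simp only [LinearMap.sub_apply, Module.End.mul_apply, fMap_apply, kMap_apply,
          LinearMap.smul_apply, Prod.fst_sub, Prod.smul_fst]
        module
      · simp
    rw [h2, derExt_smul] at h
    exact h

omit hX in
theorem _root_.KodairaSpencer.fibreEnd_pow_apply {L : (x : X) → Module.End ℂ (PolyAlg (T x))}
    {hL : ∀ α ∈ smoothPoly X, (fun x => L x (α x)) ∈ smoothPoly X} (n : ℕ) (α : smoothAlg X)
    (x : X) : ((fibreEnd X L hL ^ n) α).1 x = (L x ^ n) (α.1 x) := by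
  induction n generalizing α with
  | zero => rfl
  | succ n ih =>
    rw [pow_succ, pow_succ, Module.End.mul_apply, Module.End.mul_apply, ih]
    rfl

omit hX in
theorem _root_.KodairaSpencer.expSum_fibreEnd_apply
    {L : (x : X) → Module.End ℂ (PolyAlg (T x))}
    {hL : ∀ α ∈ smoothPoly X, (fun x => L x (α x)) ∈ smoothPoly X} (N : ℕ) (α : smoothAlg X)
    (x : X) : (expSum N (fibreEnd X L hL) α).1 x = expSum N (L x) (α.1 x) := by
  let ev : smoothAlg X →ₗ[ℂ] PolyAlg (T x) :=
    (LinearMap.proj x : PolySection X →ₗ[ℂ] PolyAlg (T x)) ∘ₗ (smoothAlg X).val.toLinearMap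
  have h : ∀ n, ev ((fibreEnd X L hL ^ n) α) = (L x ^ n) (α.1 x) := fun n =>
    fibreEnd_pow_apply n α x
  have h2 : ev (expSum N (fibreEnd X L hL) α) = expSum N (L x) (α.1 x) := by
    simp only [expSum, LinearMap.sum_apply, LinearMap.smul_apply, map_sum, map_smul, h]
  exact h2

/-- The order of nilpotency of the raising and lowering operators. -/
def _root_.KodairaSpencer.nilOrder : ℕ := Module.finrank ℂ (PolyAlg E)

omit hX in
theorem derExt_pow_nilOrder {x : X} {u : Module.End ℂ (T x × ConjDual (T x))} (hu : u * u = 0) :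
    derExt u ^ nilOrder = 0 := by
  have hfin : Module.Finite ℂ (PolyAlg (T x)) := inferInstanceAs (Module.Finite ℂ (PolyAlg E))
  exact derExt_pow_eq_zero hu

theorem eEnd_pow : Y.eEnd ^ nilOrder = 0 := LinearMap.ext fun α => smoothAlg_ext fun x =>
  (fibreEnd_pow_apply _ _ _).trans
    (LinearMap.congr_fun (derExt_pow_nilOrder (eMap_sq (Y.metric x))) (α.1 x))

theorem fEnd_pow : Y.fEnd ^ nilOrder = 0 := LinearMap.ext fun α => smoothAlg_ext fun x =>
  (fibreEnd_pow_apply _ _ _).trans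
    (LinearMap.congr_fun (derExt_pow_nilOrder (fMap_sq (Y.metric x))) (α.1 x))

/-- The fibrewise factorisation `jMap_eq`, with each factor `1 + u` turned by `map_one_add` into the
exponential of a derivation. -/
theorem tau_eq : Y.tau.toLinearMap =
    expSum nilOrder (-Y.eEnd) * expSum nilOrder Y.fEnd * expSum nilOrder (-Y.eEnd) :=
  LinearMap.ext fun α => smoothAlg_ext fun x => by
    have hE := eMap_sq (Y.metric x)
    have h1 : ∀ β : smoothAlg X, (expSum nilOrder (-Y.eEnd) β).1 x =
        ExteriorAlgebra.map (1 + -eMap (Y.metric x)) (β.1 x) := fun β => by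
      have hE' : -eMap (Y.metric x) * -eMap (Y.metric x) = 0 :=
        (neg_mul_neg _ _).trans hE
      have h2 := LinearMap.congr_fun (map_one_add hE' (derExt_pow_nilOrder hE')) (β.1 x)
      rw [derExt_neg] at h2
      refine Eq.trans ?_ h2.symm
      have hL : ∀ α ∈ smoothPoly X, (fun x => (-derExt (eMap (Y.metric x))) (α x)) ∈
          smoothPoly X := fun α hα => (-Y.eEnd ⟨α, hα⟩).2
      exact expSum_fibreEnd_apply (hL := hL) nilOrder β x
    have h3 : ∀ β : smoothAlg X, (expSum nilOrder Y.fEnd β).1 x =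
        ExteriorAlgebra.map (1 + fMap (Y.metric x)) (β.1 x) := fun β => by
      have hF := fMap_sq (Y.metric x)
      have h2 := LinearMap.congr_fun (map_one_add hF (derExt_pow_nilOrder hF)) (β.1 x)
      exact (expSum_fibreEnd_apply nilOrder β x).trans h2.symm
    rw [Module.End.mul_apply, Module.End.mul_apply, h1, h3, h1]
    refine Eq.trans (DFunLike.congr_fun (congrArg ExteriorAlgebra.map (jMap_eq (Y.metric x)))
      (α.1 x)) ?_
    rw [Module.End.mul_eq_comp, Module.End.mul_eq_comp, ← ExteriorAlgebra.map_comp_map,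
      ← ExteriorAlgebra.map_comp_map]
    rfl

end CalabiYau

end FibreOperators

/-! # Identities for `∂̄` and `Δ` -/

section Identities

open Filter Topology Complex ExteriorAlgebra

section Fibre

variable {M : Type*} [AddCommGroup M] [Module ℂ M]

theorem mul_comm_of_even {x : ExteriorAlgebra ℂ M} (hx : inv x = x) (y : ExteriorAlgebra ℂ M) :
    x * y = y * x := by
  induction y using exterior_induction with
  | one => simp
  | smul r y hy => rw [mul_smul_comm, hy, smul_mul_assoc]
  | add y z hy hz => rw [mul_add, hy, hz, add_mul]
  | ι_mul m y hy =>
    have h := ι_mul_eq m x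
    rw [hx] at h
    rw [← mul_assoc, ← h, mul_assoc, hy, mul_assoc]

theorem mul_comm_of_odd {x : ExteriorAlgebra ℂ M} (hx : inv x = -x) (y : ExteriorAlgebra ℂ M) :
    x * y = inv y * x := by
  induction y using exterior_induction with
  | one => simp
  | smul r y hy => rw [mul_smul_comm, hy, map_smul, smul_mul_assoc]
  | add y z hy hz => rw [mul_add, hy, hz, map_add, add_mul]
  | ι_mul m y hy =>
    have h : x * ι ℂ m = -(ι ℂ m * x) := by rw [ι_mul_eq, hx, neg_mul, neg_neg]
    rw [← mul_assoc, h, neg_mul, mul_assoc, hy, map_mul, inv_ι, neg_mul, neg_mul, mul_assoc]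

/-- Reversal turns a left contraction into a right one; bringing it back to the left costs the
parity and a sign. -/
theorem rev_contr (d : Module.Dual ℂ M) (x : ExteriorAlgebra ℂ M) :
    rev (contr d x) = -contr d (rev (inv x)) := by
  induction x using exterior_induction with
  | one => simp
  | smul r x hx => simp [hx]
  | add x y hx hy => simp only [map_add, hx, hy, neg_add]
  | ι_mul m x hx =>
    have h : ∀ y : ExteriorAlgebra ℂ M, rev (inv y) = inv (rev y) := fun y =>
      CliffordAlgebra.reverse_involute y
    -- Applying `inv` turns the inductive hypothesis into the same formula for `inv x`, which is
    -- what the recursion of `rev` calls for.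
    have h2 := congrArg inv hx
    rw [← h, inv_contr, map_neg rev, map_neg inv, inv_contr, ← h, inv_inv, neg_neg,
      neg_eq_iff_eq_neg] at h2
    rw [contr_ι_mul, map_sub, map_smul, rev_ι_mul, inv_contr, map_neg, h2, map_mul, inv_ι,
      neg_mul, map_neg, map_neg, neg_neg, rev_ι_mul, inv_inv, contr_ι_mul]
    simp

end Fibre

variable {s : E → ℂ} {U : Set E} {u : E → PolyAlg E} {z : E}

theorem deltaLocal_mem {P Q : Submodule ℂ (PolyAlg E)} (h : ∀ i, ∀ y ∈ P, dTheta i y ∈ Q)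
    (hsu : SmoothAt (fun w => s w • u w) z) (hu : ∀ᶠ w in 𝓝 z, u w ∈ P) :
    deltaLocal s u z ∈ Q :=
  Q.smul_mem _ <| Q.sum_mem fun i _ => h i _ <| vdC_mem hsu P <|
    hu.mono fun _ hw => P.smul_mem _ hw

theorem delbarPolyLocal_mem {P Q : Submodule ℂ (PolyAlg E)} (h : ∀ i, ∀ y ∈ P, etaBar i * y ∈ Q)
    (hu : SmoothAt u z) (hP : ∀ᶠ w in 𝓝 z, u w ∈ P) : delbarPolyLocal u z ∈ Q :=
  Q.sum_mem fun i _ => h i _ (vdC_mem hu P hP)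

/-- A constant operator which commutes with the odd derivatives commutes with `Δ`. -/
theorem map_deltaLocal {L L' : Module.End ℂ (PolyAlg E)}
    (h : ∀ i y, L (dTheta i y) = dTheta i (L' y)) (hsu : SmoothAt (fun w => s w • u w) z) :
    L (deltaLocal s u z) = deltaLocal s (fun w => L' (u w)) z := by
  have h1 : (fun w => s w • L' (u w)) = fun w => L' (s w • u w) :=
    funext fun w => (map_smul L' _ _).symm
  have h2 : ∀ i, vdC (-I) i (fun w => L' (s w • u w)) z = L' (vdC (-I) i (fun w => s w • u w) z) :=
    fun i => vdC_linear hsu L'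
  rw [deltaLocal, deltaLocal, h1]
  simp only [h2]
  simp only [map_smul, map_sum, h]

theorem map_delbarPolyLocal {L L' : Module.End ℂ (PolyAlg E)}
    (h : ∀ i y, L (etaBar i * y) = etaBar i * L' y) (hu : SmoothAt u z) :
    L (delbarPolyLocal u z) = delbarPolyLocal (fun w => L' (u w)) z := by
  simp only [delbarPolyLocal_eq, map_sum, h, vdC_linear hu L']

variable {X : Type*} [TopologicalSpace X] [ChartedSpace E X] [hX : IsManifold 𝓘(ℂ, E) ∞ X]

omit hX in
theorem smoothAt_localPoly {φ : OpenPartialHomeomorph X E} (hφ : φ ∈ atlas E X)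
    (α : smoothAlg X) {z : E} (hz : z ∈ φ.target) : SmoothAt (localPoly φ α) z :=
  mem_smoothPoly.1 α.2 φ hφ z hz

theorem smoothAlg_ext_local {α β : smoothAlg X} (h : ∀ φ ∈ atlas E X, ∀ z ∈ φ.target,
    localPoly φ α z = localPoly φ β z) : α = β :=
  Subtype.ext <| polySection_ext fun x => h _ (chart_mem_atlas E x) _
    ((chartAt E x).map_source (mem_chart_source E x))

omit hX in
theorem localPoly_add (φ : OpenPartialHomeomorph X E) (α β : smoothAlg X) (z : E) :
    localPoly φ (α + β : smoothAlg X) z = localPoly φ α z + localPoly φ β z :=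
  map_add (localHom φ z) _ _

omit hX in
theorem localPoly_neg (φ : OpenPartialHomeomorph X E) (α : smoothAlg X) (z : E) :
    localPoly φ (-α : smoothAlg X) z = -localPoly φ α z :=
  map_neg (localHom φ z) _

omit hX in
theorem localPoly_sub (φ : OpenPartialHomeomorph X E) (α β : smoothAlg X) (z : E) :
    localPoly φ (α - β : smoothAlg X) z = localPoly φ α z - localPoly φ β z :=
  map_sub (localHom φ z) _ _

omit hX in
theorem localPoly_zero (φ : OpenPartialHomeomorph X E) (z : E) :
    localPoly φ (0 : smoothAlg X) z = 0 :=
  map_zero (localHom φ z)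

omit hX in
theorem localPoly_mul (φ : OpenPartialHomeomorph X E) (α β : smoothAlg X) (z : E) :
    localPoly φ (α * β : smoothAlg X) z = localPoly φ α z * localPoly φ β z :=
  map_mul (localHom φ z) _ _

omit hX in
theorem localPoly_invHom (φ : OpenPartialHomeomorph X E) (α : smoothAlg X) (z : E) :
    localPoly φ (invHom X α) z = inv (localPoly φ α z) := map_inv _ _

omit hX in
theorem localPoly_revEnd (φ : OpenPartialHomeomorph X E) (α : smoothAlg X) (z : E) :
    localPoly φ (revEnd X α) z = rev (localPoly φ α z) := map_rev _ _

omit hX in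
theorem localPoly_kEnd (φ : OpenPartialHomeomorph X E) (α : smoothAlg X) (z : E) :
    localPoly φ (kEnd X α) z = derExt (kMap E) (localPoly φ α z) :=
  map_derExt (LinearMap.ext fun m => Prod.ext (by simp) (by simp)) _

namespace CalabiYau

variable (Y : CalabiYau X)

/-- The coefficient of the holomorphic volume form in a chart. -/
theorem exists_localPoly_deltaEnd {φ : OpenPartialHomeomorph X E} (hφ : φ ∈ atlas E X) :
    ∃ s : E → ℂ, DifferentiableOn ℂ s φ.target ∧ (∀ z ∈ φ.target, s z ≠ 0) ∧
      ∀ (α : smoothAlg X), ∀ z ∈ φ.target,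
        localPoly φ (Y.deltaEnd α) z = deltaLocal s (localPoly φ α) z := by
  obtain ⟨s, h1, h0, hs⟩ := Y.exists_coefficient hφ
  exact ⟨s, h1, h0, fun α z hz => Y.localPoly_Delta hφ h1 h0 hs α.2 hz⟩

theorem localPoly_delbarEnd {φ : OpenPartialHomeomorph X E} (hφ : φ ∈ atlas E X)
    (α : smoothAlg X) {z : E} (hz : z ∈ φ.target) :
    localPoly φ (Y.delbarEnd α) z = delbarPolyLocal (localPoly φ α) z :=
  Y.localPoly_delbarPoly hφ α.2 hz

theorem localPoly_deltaEnd_eventuallyEq {φ : OpenPartialHomeomorph X E} {s : E → ℂ}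
    (h : ∀ (α : smoothAlg X), ∀ z ∈ φ.target,
      localPoly φ (Y.deltaEnd α) z = deltaLocal s (localPoly φ α) z)
    (α : smoothAlg X) {z : E} (hz : z ∈ φ.target) :
    localPoly φ (Y.deltaEnd α) =ᶠ[𝓝 z] deltaLocal s (localPoly φ α) := by
  filter_upwards [φ.open_target.mem_nhds hz] with w hw using h α w hw

theorem localPoly_delbarEnd_eventuallyEq {φ : OpenPartialHomeomorph X E} (hφ : φ ∈ atlas E X)
    (α : smoothAlg X) {z : E} (hz : z ∈ φ.target) :
    localPoly φ (Y.delbarEnd α) =ᶠ[𝓝 z] delbarPolyLocal (localPoly φ α) := by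
  filter_upwards [φ.open_target.mem_nhds hz] with w hw using Y.localPoly_delbarEnd hφ α hw

theorem deltaEnd_deltaEnd (α : smoothAlg X) : Y.deltaEnd (Y.deltaEnd α) = 0 :=
  smoothAlg_ext_local fun φ hφ z hz => by
    obtain ⟨s, h1, h0, h⟩ := Y.exists_localPoly_deltaEnd hφ
    rw [h _ z hz, deltaLocal_congr (Y.localPoly_deltaEnd_eventuallyEq h α hz),
      deltaLocal_deltaLocal φ.open_target h1 h0 hz (smoothAt_localPoly hφ α hz), localPoly_zero]

theorem delbarEnd_delbarEnd (α : smoothAlg X) : Y.delbarEnd (Y.delbarEnd α) = 0 :=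
  smoothAlg_ext_local fun φ hφ z hz => by
    rw [Y.localPoly_delbarEnd hφ _ hz,
      delbarPolyLocal_congr (Y.localPoly_delbarEnd_eventuallyEq hφ α hz),
      delbarPolyLocal_delbarPolyLocal (smoothAt_localPoly hφ α hz), localPoly_zero]

theorem deltaEnd_delbarEnd (α : smoothAlg X) :
    Y.deltaEnd (Y.delbarEnd α) + Y.delbarEnd (Y.deltaEnd α) = 0 :=
  smoothAlg_ext_local fun φ hφ z hz => by
    obtain ⟨s, h1, h0, h⟩ := Y.exists_localPoly_deltaEnd hφ
    rw [localPoly_add, h _ z hz, Y.localPoly_delbarEnd hφ _ hz,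
      delbarPolyLocal_congr (Y.localPoly_deltaEnd_eventuallyEq h α hz),
      deltaLocal_congr (Y.localPoly_delbarEnd_eventuallyEq hφ α hz),
      deltaLocal_delbarPolyLocal φ.open_target h1 h0 hz
        fun w hw => smoothAt_localPoly hφ α hw, localPoly_zero]

theorem delbarEnd_mul (α β : smoothAlg X) :
    Y.delbarEnd (α * β) = Y.delbarEnd α * β + invHom X α * Y.delbarEnd β :=
  smoothAlg_ext_local fun φ hφ z hz => by
    have h : localPoly φ (α * β : smoothAlg X) = fun w => localPoly φ α w * localPoly φ β w :=
      funext fun w => localPoly_mul φ α β w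
    rw [localPoly_add, localPoly_mul, localPoly_mul, localPoly_invHom,
      Y.localPoly_delbarEnd hφ _ hz, Y.localPoly_delbarEnd hφ _ hz, Y.localPoly_delbarEnd hφ _ hz,
      h, delbarPolyLocal_mul (smoothAt_localPoly hφ α hz) (smoothAt_localPoly hφ β hz)]

/-- Allowing `l'` to differ from `l` gives anticommutation with the parity, the sign under reversal
and the weight from the same statement. -/
theorem map_deltaEnd {l l' : Module.End ℂ (smoothAlg X)} {L L' : Module.End ℂ (PolyAlg E)}
    (hl : ∀ (φ : OpenPartialHomeomorph X E) (α : smoothAlg X) (z : E),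
      localPoly φ (l α) z = L (localPoly φ α z))
    (hl' : ∀ (φ : OpenPartialHomeomorph X E) (α : smoothAlg X) (z : E),
      localPoly φ (l' α) z = L' (localPoly φ α z))
    (h : ∀ i y, L (dTheta i y) = dTheta i (L' y)) (α : smoothAlg X) :
    l (Y.deltaEnd α) = Y.deltaEnd (l' α) :=
  smoothAlg_ext_local fun φ hφ z hz => by
    obtain ⟨s, h1, h0, hs⟩ := Y.exists_localPoly_deltaEnd hφ
    have h2 : localPoly φ (l' α) = fun w => L' (localPoly φ α w) := funext fun w => hl' φ α w
    rw [hl, hs _ z hz, hs _ z hz, h2, map_deltaLocal h (smoothAt_smul_coefficient φ.open_target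
      h1 hz (smoothAt_localPoly hφ α hz))]

theorem map_delbarEnd {l l' : Module.End ℂ (smoothAlg X)} {L L' : Module.End ℂ (PolyAlg E)}
    (hl : ∀ (φ : OpenPartialHomeomorph X E) (α : smoothAlg X) (z : E),
      localPoly φ (l α) z = L (localPoly φ α z))
    (hl' : ∀ (φ : OpenPartialHomeomorph X E) (α : smoothAlg X) (z : E),
      localPoly φ (l' α) z = L' (localPoly φ α z))
    (h : ∀ i y, L (etaBar i * y) = etaBar i * L' y) (α : smoothAlg X) :
    l (Y.delbarEnd α) = Y.delbarEnd (l' α) :=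
  smoothAlg_ext_local fun φ hφ z hz => by
    have h2 : localPoly φ (l' α) = fun w => L' (localPoly φ α w) := funext fun w => hl' φ α w
    rw [hl, Y.localPoly_delbarEnd hφ _ hz, Y.localPoly_delbarEnd hφ _ hz, h2,
      map_delbarPolyLocal h (smoothAt_localPoly hφ α hz)]

theorem invHom_deltaEnd (α : smoothAlg X) :
    invHom X (Y.deltaEnd α) = -Y.deltaEnd (invHom X α) := by
  rw [← map_neg]
  exact Y.map_deltaEnd (l := (invHom X).toLinearMap) (l' := -(invHom X).toLinearMap)
    (L := inv.toLinearMap) (L' := -inv.toLinearMap) (fun φ α z => localPoly_invHom φ α z)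
    (fun φ α z => (localPoly_neg φ _ z).trans (congrArg _ (localPoly_invHom φ α z)))
    (fun i y => (inv_contr _ _).trans (map_neg (dTheta i) _).symm) α

theorem invHom_delbarEnd (α : smoothAlg X) :
    invHom X (Y.delbarEnd α) = -Y.delbarEnd (invHom X α) := by
  rw [← map_neg]
  exact Y.map_delbarEnd (l := (invHom X).toLinearMap) (l' := -(invHom X).toLinearMap)
    (L := inv.toLinearMap) (L' := -inv.toLinearMap) (fun φ α z => localPoly_invHom φ α z)
    (fun φ α z => (localPoly_neg φ _ z).trans (congrArg _ (localPoly_invHom φ α z)))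
    (fun i y => by simp [etaBar]) α

theorem revEnd_deltaEnd (α : smoothAlg X) :
    revEnd X (Y.deltaEnd α) = -Y.deltaEnd (revEnd X (invHom X α)) := by
  rw [← map_neg]
  exact Y.map_deltaEnd (l := revEnd X) (l' := -(revEnd X ∘ₗ (invHom X).toLinearMap))
    (L := rev) (L' := -(rev ∘ₗ inv.toLinearMap)) (fun φ α z => localPoly_revEnd φ α z)
    (fun φ α z => (localPoly_neg φ _ z).trans (congrArg _ ((localPoly_revEnd φ _ z).trans
      (congrArg rev (localPoly_invHom φ α z)))))
    (fun i y => (rev_contr _ _).trans (map_neg (dTheta i) _).symm) α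

theorem revEnd_delbarEnd (α : smoothAlg X) :
    revEnd X (Y.delbarEnd α) = Y.delbarEnd (revEnd X (invHom X α)) :=
  Y.map_delbarEnd (l := revEnd X) (l' := revEnd X ∘ₗ (invHom X).toLinearMap)
    (L := rev) (L' := rev ∘ₗ inv.toLinearMap) (fun φ α z => localPoly_revEnd φ α z)
    (fun φ α z => (localPoly_revEnd φ _ z).trans (congrArg rev (localPoly_invHom φ α z)))
    (fun _ y => rev_ι_mul _ y) α

/-- `Δ` removes one vector, of weight `-1`; likewise `∂̄` adds one covector, of weight `+1`. Both
operators thus have weight one. -/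
theorem lie_kEnd_deltaEnd : kEnd X * Y.deltaEnd - Y.deltaEnd * kEnd X = Y.deltaEnd := by
  refine LinearMap.ext fun α => ?_
  have h : kEnd X (Y.deltaEnd α) = Y.deltaEnd (kEnd X α) + Y.deltaEnd α := by
    rw [← map_add]
    exact Y.map_deltaEnd (l := kEnd X) (l' := kEnd X + 1)
      (L := derExt (kMap E)) (L' := derExt (kMap E) + 1) (fun φ α z => localPoly_kEnd φ α z)
      (fun φ α z => (localPoly_add φ _ _ z).trans (congrArg (· + _) (localPoly_kEnd φ α z)))
      (fun i y => by
        have h1 : (coordForm i ∘ₗ LinearMap.fst ℂ E (ConjDual E)) ∘ₗ kMap E =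
            -(coordForm i ∘ₗ LinearMap.fst ℂ E (ConjDual E)) :=
          LinearMap.ext fun m => by simp
        have h2 : ∀ d : Module.Dual ℂ (E × ConjDual E), contr (-d) y = -contr d y := fun d => by
          simp [contr]
        rw [dTheta, derExt_contr, h1, h2, sub_neg_eq_add]
        exact (map_add (dTheta i) _ _).symm) α
  exact sub_eq_of_eq_add' h

theorem lie_kEnd_delbarEnd : kEnd X * Y.delbarEnd - Y.delbarEnd * kEnd X = Y.delbarEnd := by
  refine LinearMap.ext fun α => ?_
  have h : kEnd X (Y.delbarEnd α) = Y.delbarEnd (kEnd X α) + Y.delbarEnd α := by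
    rw [← map_add]
    exact Y.map_delbarEnd (l := kEnd X) (l' := kEnd X + 1)
      (L := derExt (kMap E)) (L' := derExt (kMap E) + 1) (fun φ α z => localPoly_kEnd φ α z)
      (fun φ α z => (localPoly_add φ _ _ z).trans (congrArg (· + _) (localPoly_kEnd φ α z)))
      (fun i y => by
        rw [etaBar, derExt_ι_mul, kMap_apply, neg_zero, LinearMap.add_apply, Module.End.one_apply,
          mul_add, add_comm]) α
  exact sub_eq_of_eq_add' h

end CalabiYau

end Identities

/-! # The bracket of `Δ`, bidegrees, and the Kähler form -/

section Kahler

open Filter Topology Complex ExteriorAlgebra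

variable {X : Type*} [TopologicalSpace X] [ChartedSpace E X] [hX : IsManifold 𝓘(ℂ, E) ∞ X]

namespace CalabiYau

variable (Y : CalabiYau X) {φ : OpenPartialHomeomorph X E} {z : E}

set_option maxHeartbeats 1000000 in
theorem localPoly_bracket (hφ : φ ∈ atlas E X) (hz : z ∈ φ.target) (α β : smoothAlg X) :
    localPoly φ (bracket (invHom X) Y.deltaEnd α β : smoothAlg X) z =
      ∑ i, (vdC (-I) i (localPoly φ α) z * dTheta i (localPoly φ β z) -
        inv (dTheta i (localPoly φ α z)) * vdC (-I) i (localPoly φ β) z) := by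
  obtain ⟨s, h1, h0, h⟩ := Y.exists_localPoly_deltaEnd hφ
  have h2 : localPoly φ (invHom X α) = fun w => inv (localPoly φ α w) :=
    funext fun w => localPoly_invHom φ α w
  have h3 : localPoly φ (invHom X α * β : smoothAlg X) =
      fun w => inv (localPoly φ α w) * localPoly φ β w :=
    funext fun w => by rw [localPoly_mul, localPoly_invHom]
  rw [bracket, localPoly_sub, localPoly_sub, localPoly_mul, localPoly_mul, h _ z hz, h _ z hz,
    h _ z hz, h2, h3, deltaLocal_mul φ.open_target h1 h0 hz (smoothAt_localPoly hφ α hz)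
    (smoothAt_localPoly hφ β hz)]

-- In a chart the bracket is bilinear in first derivatives of its arguments. Since `∂/∂z^i` and
-- `∂/∂θ_i` are derivations, so is the bracket in its second argument, and that is the second-order
-- property of `Δ`.
set_option maxHeartbeats 1000000 in
theorem isBV_deltaEnd : IsBV (invHom X) Y.deltaEnd where
  inv_inv := invHom_invHom
  comm_even α β h := smoothAlg_ext fun x =>
    mul_comm_of_even (congrFun (congrArg Subtype.val h) x) _
  comm_odd α β h := smoothAlg_ext fun x =>
    mul_comm_of_odd (congrFun (congrArg Subtype.val h) x) _
  anti := Y.invHom_deltaEnd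
  sq := Y.deltaEnd_deltaEnd
  bracket_mul_even α β γ hα := smoothAlg_ext_local fun φ hφ z hz => by
    have ha := smoothAt_localPoly hφ α hz
    have hb := smoothAt_localPoly hφ β hz
    have hc := smoothAt_localPoly hφ γ hz
    have h1 : ∀ w, inv (localPoly φ α w) = localPoly φ α w := fun w => by
      rw [← localPoly_invHom, hα]
    have h2 : ∀ i, inv (vdC (-I) i (localPoly φ α) z) = vdC (-I) i (localPoly φ α) z := fun i => by
      have h := vdC_linear (c := -I) (i := i) ha (inv : PolyAlg E →ₐ[ℂ] PolyAlg E).toLinearMap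
      simp only [AlgHom.toLinearMap_apply, h1] at h
      exact h.symm
    have h3 : ∀ i, inv (dTheta i (localPoly φ α z)) = -dTheta i (localPoly φ α z) := fun i => by
      rw [dTheta, inv_contr, h1]
    have h4 : localPoly φ (β * γ : smoothAlg X) = fun w => localPoly φ β w * localPoly φ γ w :=
      funext fun w => localPoly_mul φ β γ w
    simp only [localPoly_add, localPoly_mul, localPoly_invHom, Y.localPoly_bracket hφ hz]
    rw [h4, Finset.sum_mul, Finset.mul_sum, ← Finset.sum_add_distrib]
    refine Finset.sum_congr rfl fun i _ => ?_
    -- The coefficient formed from `α` must be moved past `β`; its parity is known because `α` has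
    -- one.
    have h5 := mul_comm_of_even (h2 i) (inv (localPoly φ β z))
    have h6 := mul_comm_of_odd (h3 i) (localPoly φ β z)
    rw [vdC_mul hb hc, dTheta_mul, h3, mul_add, mul_add, ← mul_assoc _ (inv _), h5, neg_mul,
      neg_mul, ← mul_assoc _ (localPoly φ β z), h6]
    noncomm_ring
  bracket_mul_odd α β γ hα := smoothAlg_ext_local fun φ hφ z hz => by
    have ha := smoothAt_localPoly hφ α hz
    have hb := smoothAt_localPoly hφ β hz
    have hc := smoothAt_localPoly hφ γ hz
    have h1 : ∀ w, inv (localPoly φ α w) = -localPoly φ α w := fun w => by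
      rw [← localPoly_invHom, hα, localPoly_neg]
    have h2 : ∀ i, inv (vdC (-I) i (localPoly φ α) z) = -vdC (-I) i (localPoly φ α) z := fun i => by
      have h := vdC_linear (c := -I) (i := i) ha (inv : PolyAlg E →ₐ[ℂ] PolyAlg E).toLinearMap
      have h' := vdC_linear (c := -I) (i := i) ha (-LinearMap.id : Module.End ℂ (PolyAlg E))
      simp only [AlgHom.toLinearMap_apply, h1, LinearMap.neg_apply, LinearMap.id_apply] at h h'
      rw [← h, h']
    have h3 : ∀ i, inv (dTheta i (localPoly φ α z)) = dTheta i (localPoly φ α z) := fun i => by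
      rw [dTheta, inv_contr, h1, map_neg, neg_neg]
    have h4 : localPoly φ (β * γ : smoothAlg X) = fun w => localPoly φ β w * localPoly φ γ w :=
      funext fun w => localPoly_mul φ β γ w
    simp only [localPoly_add, localPoly_mul, Y.localPoly_bracket hφ hz]
    rw [h4, Finset.sum_mul, Finset.mul_sum, ← Finset.sum_add_distrib]
    refine Finset.sum_congr rfl fun i _ => ?_
    have h5 := mul_comm_of_odd (h2 i) (inv (localPoly φ β z))
    have h6 := mul_comm_of_even (h3 i) (localPoly φ β z)
    rw [inv_inv] at h5
    rw [vdC_mul hb hc, dTheta_mul, h3, mul_add, mul_add, ← mul_assoc _ (inv _), h5,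
      ← mul_assoc _ (localPoly φ β z), h6]
    noncomm_ring

/-! ### Bidegrees -/

omit hX in
theorem localPoly_mem_polyBidegree {p q : ℕ} {α : PolySection X} (h : α ∈ bidegree X p q)
    (φ : OpenPartialHomeomorph X E) (z : E) : localPoly φ α z ∈ polyBidegree E p q :=
  polyMap_mem_polyBidegree _ _ (h.2 _)

omit hX in
theorem localPoly_mem_exteriorPower {n : ℕ} {α : PolySection X} (h : α ∈ ghost X n)
    (φ : OpenPartialHomeomorph X E) (z : E) :
    localPoly φ α z ∈ ⋀[ℂ]^n (E × ConjDual E) :=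
  map_mem_exteriorPower _ (h.2 _)

theorem localPoly_Delta_mem (hφ : φ ∈ atlas E X) (hz : z ∈ φ.target)
    {P Q : Submodule ℂ (PolyAlg E)}
    (h : ∀ i, ∀ y ∈ P, dTheta i y ∈ Q) {α : PolySection X} (hα : α ∈ smoothPoly X)
    (hP : ∀ z, localPoly φ α z ∈ P) : localPoly φ (Y.Delta α) z ∈ Q := by
  obtain ⟨s, h1, h0, hs⟩ := Y.exists_coefficient hφ
  rw [Y.localPoly_Delta hφ h1 h0 hs hα hz]
  exact deltaLocal_mem h (smoothAt_smul_coefficient φ.open_target h1 hz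
    (mem_smoothPoly.1 hα φ hφ z hz)) (Eventually.of_forall hP)

theorem Delta_mem_bidegree {p q : ℕ} {α : PolySection X} (hα : α ∈ bidegree X (p + 1) q) :
    Y.Delta α ∈ bidegree X p q := by
  have hs := (mem_bidegree.1 hα).1
  refine mem_bidegree.2 ⟨Y.Delta_mem hs, fun x => ?_⟩
  have hφ := chart_mem_atlas E x
  have hx := mem_chart_source E x
  exact (mem_polyBidegree_iff hφ hx).2 (Y.localPoly_Delta_mem hφ ((chartAt E x).map_source hx)
    (fun i y hy => contr_mem_polyBidegree _ hy) hs (localPoly_mem_polyBidegree hα _))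

theorem Delta_mem_ghost {n : ℕ} {α : PolySection X} (hα : α ∈ ghost X (n + 1)) :
    Y.Delta α ∈ ghost X n := by
  have hs := (mem_ghost.1 hα).1
  refine mem_ghost.2 ⟨Y.Delta_mem hs, fun x => ?_⟩
  have hφ := chart_mem_atlas E x
  have hx := mem_chart_source E x
  refine (mem_exteriorPower_iff hφ hx).2 (Y.localPoly_Delta_mem hφ ((chartAt E x).map_source hx)
    (fun i y hy => ?_) hs (localPoly_mem_exteriorPower hα _))
  rw [exteriorPower_eq] at hy ⊢
  exact (contr_mem _ hy).1

theorem Delta_eq_zero_of_bidegree {q : ℕ} {α : PolySection X} (hα : α ∈ bidegree X 0 q) :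
    Y.Delta α = 0 := by
  have hs := (mem_bidegree.1 hα).1
  refine polySection_ext fun x => ?_
  have hφ := chart_mem_atlas E x
  have hx := mem_chart_source E x
  refine Eq.trans ?_ (map_zero (localHom _ _)).symm
  exact (Submodule.mem_bot ℂ).1 (Y.localPoly_Delta_mem hφ ((chartAt E x).map_source hx)
    (fun i y hy => (Submodule.mem_bot ℂ).2 (contr_polyBidegree_zero _ hy)) hs
    (localPoly_mem_polyBidegree hα _))

theorem Delta_eq_zero_of_ghost {α : PolySection X} (hα : α ∈ ghost X 0) : Y.Delta α = 0 := by
  have hs := (mem_ghost.1 hα).1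
  refine polySection_ext fun x => ?_
  have hφ := chart_mem_atlas E x
  have hx := mem_chart_source E x
  refine Eq.trans ?_ (map_zero (localHom _ _)).symm
  refine (Submodule.mem_bot ℂ).1 (Y.localPoly_Delta_mem hφ ((chartAt E x).map_source hx)
    (fun i y hy => (Submodule.mem_bot ℂ).2 ?_) hs (localPoly_mem_exteriorPower hα _))
  rw [exteriorPower_eq] at hy
  exact (contr_mem _ hy).2 rfl

include Y in
theorem delbarPoly_mem_bidegree {p q : ℕ} {α : PolySection X} (hα : α ∈ bidegree X p q) :
    delbarPoly α ∈ bidegree X p (q + 1) := by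
  have hs := (mem_bidegree.1 hα).1
  refine mem_bidegree.2 ⟨Y.delbarPoly_mem hs, fun x => ?_⟩
  have hφ := chart_mem_atlas E x
  have hx := mem_chart_source E x
  have hz := (chartAt E x).map_source hx
  rw [mem_polyBidegree_iff hφ hx, Y.localPoly_delbarPoly hφ hs hz]
  exact delbarPolyLocal_mem (fun i y hy => ι_mul_mem_polyBidegree _ hy)
    (mem_smoothPoly.1 hs _ hφ _ hz) (Eventually.of_forall (localPoly_mem_polyBidegree hα _))

include Y in
theorem delbarPoly_mem_ghost {n : ℕ} {α : PolySection X} (hα : α ∈ ghost X n) :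
    delbarPoly α ∈ ghost X (n + 1) := by
  have hs := (mem_ghost.1 hα).1
  refine mem_ghost.2 ⟨Y.delbarPoly_mem hs, fun x => ?_⟩
  have hφ := chart_mem_atlas E x
  have hx := mem_chart_source E x
  have hz := (chartAt E x).map_source hx
  rw [mem_exteriorPower_iff hφ hx, Y.localPoly_delbarPoly hφ hs hz]
  refine delbarPolyLocal_mem (P := ⋀[ℂ]^n (E × ConjDual E)) (fun i y hy => ?_)
    (mem_smoothPoly.1 hs _ hφ _ hz) (Eventually.of_forall (localPoly_mem_exteriorPower hα _))
  rw [exteriorPower_eq, pow_succ']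
  rw [exteriorPower_eq] at hy
  exact Submodule.mul_mem_mul (Submodule.mem_map_of_mem Submodule.mem_top) hy

/-! ### The Kähler form -/

theorem localForm_omega (hφ : φ ∈ atlas E X) (hz : z ∈ φ.target) :
    localForm φ Y.omega z =
      I • ∑ i, hol (coordForm i) * antihol (Y.localMetric φ z (Pi.single i 1)) := by
  have hx := φ.map_target hz
  obtain ⟨b, hb, hb'⟩ := exists_chartBasis hφ hx
  have h1 : ∀ i, (b.coord i) ∘ₗ (chartDInv φ (φ.symm z)).toLinearMap = coordForm i := fun i => by
    rw [hb', LinearMap.comp_assoc, chartD_comp_chartDInv hφ hx, LinearMap.comp_id]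
  rw [localForm, omega, kahlerFibre_eq _ b, kahlerFibre, map_smul, map_sum]
  congr 1
  refine Finset.sum_congr rfl fun i _ => ?_
  rw [map_mul, formPull_hol, formPull_antihol, h1, hb]
  rfl

theorem smoothForm_omega : SmoothForm Y.omega := by
  intro φ hφ z hz
  refine SmoothAt.congr (f := fun z => I • ∑ i, hol (coordForm i) *
    antihol (Y.localMetric φ z (Pi.single i 1))) ?_ ?_
  · refine SmoothAt.smul contDiffAt_const (SmoothAt.sum fun i _ => (SmoothAt.const _).mul ?_)
    exact (Y.smoothAt_localMetric hφ hz _).linear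
      (ι ℂ ∘ₗ LinearMap.inr ℂ (Module.Dual ℂ E) (ConjDual E))
  · filter_upwards [φ.open_target.mem_nhds hz] with w hw using Y.localForm_omega hφ hw

/-- The automorphism which multiplies the holomorphic covectors by two. -/
def scaleHol : FormAlg E →ₐ[ℂ] FormAlg E :=
  ExteriorAlgebra.map (LinearMap.prodMap ((2 : ℂ) • LinearMap.id) LinearMap.id)

theorem scaleHol_hol (f : Module.Dual ℂ E) : scaleHol (hol f) = (2 : ℂ) • hol f := by
  rw [scaleHol, hol, map_apply_ι, ← map_smul]
  simp

theorem scaleHol_antihol (k : ConjDual E) : scaleHol (antihol k) = antihol k := by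
  rw [scaleHol, antihol, map_apply_ι]
  simp

/-- The hypothesis is only `∂ω + ∂̄ω = 0`. The summands have types `(2,1)` and `(1,2)`, and doubling
the holomorphic covectors multiplies them by `4` and `2`, which separates them. -/
theorem del_omega_eq_zero_and : del Y.omega = 0 ∧ delbar Y.omega = 0 := by
  have key : ∀ x, delLocal (localForm (chartAt E x) Y.omega) (chartAt E x x) = 0 ∧
      delbarLocal (localForm (chartAt E x) Y.omega) (chartAt E x x) = 0 := by
    intro x
    have hφ := chart_mem_atlas E x
    have hx := mem_chart_source E x
    have hz := (chartAt E x).map_source hx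
    set w := localForm (chartAt E x) Y.omega with hw
    have hsm : SmoothAt w (chartAt E x x) := Y.smoothForm_omega _ hφ _ hz
    have h1 : delLocal w (chartAt E x x) + delbarLocal w (chartAt E x x) = 0 := by
      have h := congrFun Y.kahler x
      refine formPull_injective (chartD_comp_chartDInv hφ hx) ?_
      rw [map_add, map_zero]
      exact h
    have h2 : ∀ c i, scaleHol (vdC c i w (chartAt E x x)) =
        (2 : ℂ) • vdC c i w (chartAt E x x) := by
      intro c i
      have h3 : (fun v => scaleHol.toLinearMap (w v)) =ᶠ[𝓝 (chartAt E x x)]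
          fun v => (2 : ℂ) • w v := by
        filter_upwards [(chartAt E x).open_target.mem_nhds hz] with v hv
        rw [hw, Y.localForm_omega hφ hv]
        simp only [AlgHom.toLinearMap_apply, map_smul, map_sum, map_mul, scaleHol_hol,
          scaleHol_antihol, smul_mul_assoc, ← Finset.smul_sum]
        rw [smul_comm]
      have h4 := vdC_linear (c := c) (i := i) hsm scaleHol.toLinearMap
      rw [vdC_congr h3, vdC_const_smul _ hsm] at h4
      exact h4.symm
    have h5 : scaleHol (delLocal w (chartAt E x x)) = (4 : ℂ) • delLocal w (chartAt E x x) := by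
      rw [delLocal_eq_opC, opC, map_sum, Finset.smul_sum]
      refine Finset.sum_congr rfl fun i _ => ?_
      have h6 := scaleHol_hol (coordForm i)
      rw [hol] at h6
      rw [map_mul, h2, h6, smul_mul_smul_comm]
      norm_num
    have h7 : scaleHol (delbarLocal w (chartAt E x x)) =
        (2 : ℂ) • delbarLocal w (chartAt E x x) := by
      rw [delbarLocal_eq_opC, opC, map_sum, Finset.smul_sum]
      refine Finset.sum_congr rfl fun i _ => ?_
      have h6 := scaleHol_antihol (coordFormBar i)
      rw [antihol] at h6
      rw [map_mul, h2, h6, mul_smul_comm]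
    have h8 := congrArg scaleHol h1
    rw [map_add, map_zero, h5, h7] at h8
    have h9 : (2 : ℂ) • delLocal w (chartAt E x x) = 0 := by
      have h10 : (4 : ℂ) • delLocal w (chartAt E x x) + (2 : ℂ) • delbarLocal w (chartAt E x x) -
        (2 : ℂ) • (delLocal w (chartAt E x x) + delbarLocal w (chartAt E x x)) = 0 := by
          rw [h8, h1, smul_zero, sub_zero]
      rw [← h10]
      module
    have h11 := (smul_eq_zero.1 h9).resolve_left two_ne_zero
    rw [h11, zero_add] at h1
    exact ⟨h11, h1⟩
  constructor
  · funext x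
    rw [del, (key x).1, map_zero]
    rfl
  · funext x
    rw [delbar, (key x).2, map_zero]
    rfl

theorem opC_mul_of_comm {c : ℂ} {e : Fin 3 → Module.Dual ℂ E × ConjDual E} {w a : E → FormAlg E}
    (hw : SmoothAt w z) (ha : SmoothAt a z) (h : ∀ y, w z * y = y * w z) :
    opC c e (fun v => w v * a v) z = opC c e w z * a z + w z * opC c e a z := by
  simp only [opC, vdC_mul hw ha, mul_add, Finset.sum_add_distrib, Finset.sum_mul, Finset.mul_sum,
    ← mul_assoc, h (ι ℂ _)]

omit hX in
theorem localForm_mul (φ : OpenPartialHomeomorph X E) (a b : FormSection X) (z : E) :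
    localForm φ (a * b) z = localForm φ a z * localForm φ b z := map_mul _ _ _

/-- An even closed form commutes with the differential. Taking `op` as a parameter covers `∂` and
`∂̄`. -/
theorem omega_mul (op : FormSection X → FormSection X) {c : ℂ}
    {e : Fin 3 → Module.Dual ℂ E × ConjDual E}
    (hop : ∀ a x, op a x = formPull (chartD (chartAt E x) x).toLinearMap
      (opC c e (localForm (chartAt E x) a) (chartAt E x x)))
    (hω : op Y.omega = 0) {a : FormSection X} (ha : SmoothForm a) :
    op (Y.omega * a) = Y.omega * op a := funext fun x => by
  have hφ := chart_mem_atlas E x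
  have hx := mem_chart_source E x
  have hz := (chartAt E x).map_source hx
  have h1 : localForm (chartAt E x) (Y.omega * a) = fun w =>
      localForm (chartAt E x) Y.omega w * localForm (chartAt E x) a w :=
    funext fun w => localForm_mul _ _ _ w
  have h2 : ∀ y, localForm (chartAt E x) Y.omega (chartAt E x x) * y =
      y * localForm (chartAt E x) Y.omega (chartAt E x x) := fun y => by
    rw [Y.localForm_omega hφ hz, smul_mul_assoc, mul_smul_comm, Finset.sum_mul, Finset.mul_sum]
    exact congrArg _ (Finset.sum_congr rfl fun i _ => commute_ι_mul_ι _ _ y)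
  rw [hop, h1, opC_mul_of_comm (Y.smoothForm_omega _ hφ _ hz) (ha _ hφ _ hz) h2, map_add, map_mul,
    ← hop, hω, map_mul, formPull_localForm hφ hx Y.omega, Pi.mul_apply, hop a]
  simp

theorem hol_mul_vol (x : X) (f : Module.Dual ℂ (T x)) : hol f * Y.vol x = 0 := by
  obtain ⟨b, r, -, h⟩ := Y.exists_vol_eq x
  rw [h, mul_smul_comm, hol_mul_topForm, smul_zero]

theorem omega_mul_rho (α : smoothAlg X) : Y.omega * Y.rho α = Y.rho (I • Y.eEnd α : smoothAlg X) :=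
  funext fun x => (kahlerFibre_mul_rhoFibre (Y.metric x) (tangentBasis x) (Y.hol_mul_vol x)
    (α.1 x)).trans (map_smul (rhoFibre (Y.vol x)) _ _).symm

theorem rho_deltaEnd (α : smoothAlg X) : Y.rho (Y.deltaEnd α) = del (Y.rho α) :=
  Y.rho_hat del _

theorem rho_delbarEnd (α : smoothAlg X) :
    Y.rho (-Y.delbarEnd α : smoothAlg X) = delbar (Y.rho α) := by
  rw [← Y.rho_hat delbar α.1, Y.hat_delbar α.2]
  rfl

/-- This is the Kähler condition `∂ω = 0` in `sl₂` form: multiplication by `ω` commutes with `∂`,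
and `ρ` transports this to `e` and `Δ`. -/
theorem lie_eEnd_deltaEnd : Y.eEnd * Y.deltaEnd - Y.deltaEnd * Y.eEnd = 0 :=
  LinearMap.ext fun α => by
    have h1 := Y.omega_mul del (fun a x => by rw [del, delLocal_eq_opC])
      Y.del_omega_eq_zero_and.1 (Y.smoothForm_rho α.2)
    rw [Y.omega_mul_rho, ← Y.rho_deltaEnd, ← Y.rho_deltaEnd, Y.omega_mul_rho] at h1
    have h2 := Subtype.ext (Y.rho_injective h1)
    rw [map_smul] at h2
    exact sub_eq_zero.2 (smul_right_injective _ I_ne_zero h2).symm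

theorem lie_eEnd_delbarEnd : Y.eEnd * Y.delbarEnd - Y.delbarEnd * Y.eEnd = 0 :=
  LinearMap.ext fun α => by
    have h1 := Y.omega_mul delbar (fun a x => by rw [delbar, delbarLocal_eq_opC])
      Y.del_omega_eq_zero_and.2 (Y.smoothForm_rho α.2)
    rw [Y.omega_mul_rho, ← Y.rho_delbarEnd, ← Y.rho_delbarEnd, Y.omega_mul_rho] at h1
    have h2 := Subtype.ext (Y.rho_injective h1)
    rw [map_smul, map_neg, smul_neg, neg_inj] at h2
    exact sub_eq_zero.2 (smul_right_injective _ I_ne_zero h2).symm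

attribute [local instance 100] LieRing.ofAssociativeRing

/-- `Δ` commutes with `e` and has weight one, so the Weyl element carries it to `[f, Δ]`. -/
theorem tau_deltaEnd (α : smoothAlg X) :
    Y.tau (Y.deltaEnd α) = (Y.fEnd * Y.deltaEnd - Y.deltaEnd * Y.fEnd) (Y.tau α) := by
  have h := weyl_mul (e := Y.eEnd) (f := Y.fEnd) (k := kEnd X) (d := Y.deltaEnd) Y.eEnd_pow
    Y.fEnd_pow Y.lie_eEnd_fEnd Y.lie_kEnd_fEnd Y.lie_eEnd_deltaEnd Y.lie_kEnd_deltaEnd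
  rw [← tau_eq] at h
  exact LinearMap.congr_fun h α

theorem tau_delbarEnd (α : smoothAlg X) :
    Y.tau (Y.delbarEnd α) = (Y.fEnd * Y.delbarEnd - Y.delbarEnd * Y.fEnd) (Y.tau α) := by
  have h := weyl_mul (e := Y.eEnd) (f := Y.fEnd) (k := kEnd X) (d := Y.delbarEnd) Y.eEnd_pow
    Y.fEnd_pow Y.lie_eEnd_fEnd Y.lie_kEnd_fEnd Y.lie_eEnd_delbarEnd Y.lie_kEnd_delbarEnd
  rw [← tau_eq] at h
  exact LinearMap.congr_fun h α

end CalabiYau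

end Kahler

/-! # The adjoint operators and the second bracket -/

section Graded

variable {A : Type*} [Ring A] [Algebra ℂ A] {ν : A →ₐ[ℂ] A} {D S : Module.End ℂ A} {a b c : A}
  {m n : ℕ}

theorem even_or_odd_of_homogeneous (h : ν a = (-1 : ℂ) ^ n • a) :
    ((-1 : ℂ) ^ n = 1 ∧ ν a = a) ∨ ((-1 : ℂ) ^ n = -1 ∧ ν a = -a) := by
  rcases neg_one_pow_eq_or ℂ n with hn | hn
  · exact Or.inl ⟨hn, by rw [h, hn, one_smul]⟩
  · exact Or.inr ⟨hn, by rw [h, hn, neg_one_smul]⟩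

theorem neg_one_pow_succ_mul_succ (m n : ℕ) : (-1 : ℂ) ^ ((m + 1) * (n + 1)) =
    if (-1 : ℂ) ^ m = 1 ∧ (-1 : ℂ) ^ n = 1 then -1 else 1 := by
  have h1 : (-1 : ℂ) ≠ 1 := by norm_num
  rcases Nat.even_or_odd m with hm | hm <;> rcases Nat.even_or_odd n with hn | hn
  · rw [if_pos ⟨hm.neg_one_pow, hn.neg_one_pow⟩]
    exact (hm.add_one.mul hn.add_one).neg_one_pow
  · rw [if_neg fun h => h1 (hn.neg_one_pow.symm.trans h.2)]
    exact (hn.add_one.mul_left _).neg_one_pow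
  · rw [if_neg fun h => h1 (hm.neg_one_pow.symm.trans h.1)]
    exact (hm.add_one.mul_right _).neg_one_pow
  · rw [if_neg fun h => h1 (hm.neg_one_pow.symm.trans h.1)]
    exact (hm.add_one.mul_right _).neg_one_pow

theorem bracket_eq (ha : ν a = (-1 : ℂ) ^ n • a) (b : A) :
    bracket ν D a b = (-1 : ℂ) ^ n • D (a * b) - (-1 : ℂ) ^ n • (D a * b) - a * D b := by
  rw [bracket, ha, smul_mul_assoc, map_smul, map_smul, smul_mul_assoc]

theorem derivation_bracket_of_homogeneous (hν : ∀ a, ν (ν a) = a)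
    (h₁ : ∀ a, ν (S a) = -S (ν a))
    (h₂ : ∀ a, ν (D a) = -D (ν a)) (hS : ∀ a b, S (a * b) = S a * b + ν a * S b)
    (h : S * D + D * S = 0) (ha : ν a = (-1 : ℂ) ^ n • a) (b : A) :
    S (bracket ν D a b) = bracket ν D (S a) b + (-1 : ℂ) ^ (n + 1) • bracket ν D a (S b) := by
  have h3 : bracket ν D (ν a) (S b) = (-1 : ℂ) ^ n • bracket ν D a (S b) := by
    rw [ha]
    simpa [bracket] using bracket_smul_add_left (ν := ν) (D := D) ((-1 : ℂ) ^ n) a 0 (S b)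
  rw [derivation_bracket hν h₁ h₂ hS h, h3, pow_succ, mul_neg_one, neg_smul, sub_eq_add_neg]

namespace IsBV

variable (h : IsBV ν D)

include h

theorem map_bracket_of_homogeneous (ha : ν a = (-1 : ℂ) ^ n • a) (b : A) :
    D (bracket ν D a b) = bracket ν D (D a) b + (-1 : ℂ) ^ (n + 1) • bracket ν D a (D b) := by
  have h3 : bracket ν D (ν a) (D b) = (-1 : ℂ) ^ n • bracket ν D a (D b) := by
    rw [ha]
    simpa [bracket] using bracket_smul_add_left (ν := ν) (D := D) ((-1 : ℂ) ^ n) a 0 (D b)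
  rw [h.map_bracket, h3, pow_succ, mul_neg_one, neg_smul, sub_eq_add_neg]

theorem bracket_symm (ha : ν a = (-1 : ℂ) ^ m • a) (hb : ν b = (-1 : ℂ) ^ n • b) :
    bracket ν D b a = -((-1 : ℂ) ^ ((m + 1) * (n + 1)) • bracket ν D a b) := by
  have h1 : (-1 : ℂ) ≠ 1 := by norm_num
  rw [neg_one_pow_succ_mul_succ]
  rcases even_or_odd_of_homogeneous ha with ⟨hm, ha⟩ | ⟨hm, ha⟩ <;>
    rcases even_or_odd_of_homogeneous hb with ⟨hn, hb⟩ | ⟨hn, hb⟩ <;> simp only [hm, hn, h1]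
  · rw [h.bracket_symm_even ha hb]; simp
  · rw [h.bracket_symm_odd hb a (Or.inl ha)]; simp
  · rw [h.bracket_symm_odd ha b (Or.inl hb)]; simp
  · rw [h.bracket_symm_odd hb a (Or.inr ha)]; simp

theorem jacobi (ha : ν a = (-1 : ℂ) ^ m • a) (hb : ν b = (-1 : ℂ) ^ n • b) (c : A) :
    bracket ν D a (bracket ν D b c) = bracket ν D (bracket ν D a b) c +
      (-1 : ℂ) ^ ((m + 1) * (n + 1)) • bracket ν D b (bracket ν D a c) := by
  have h1 : (-1 : ℂ) ≠ 1 := by norm_num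
  rw [neg_one_pow_succ_mul_succ]
  rcases even_or_odd_of_homogeneous ha with ⟨hm, ha⟩ | ⟨hm, ha⟩ <;>
    rcases even_or_odd_of_homogeneous hb with ⟨hn, hb⟩ | ⟨hn, hb⟩ <;> simp only [hm, hn, h1]
  · rw [h.jacobi_even ha hb]; simp [sub_eq_add_neg]
  · rw [h.jacobi_even_odd ha hb]; simp
  · rw [h.jacobi_odd_even ha hb]; simp
  · rw [h.jacobi_odd ha hb]; simp

theorem bracket_mul (ha : ν a = (-1 : ℂ) ^ m • a) (hb : ν b = (-1 : ℂ) ^ n • b) (c : A) :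
    bracket ν D a (b * c) = bracket ν D a b * c +
      (-1 : ℂ) ^ ((m + 1) * n) • (b * bracket ν D a c) := by
  rw [pow_mul, pow_succ]
  rcases even_or_odd_of_homogeneous ha with ⟨hm, ha⟩ | ⟨hm, ha⟩
  · rw [hm, one_mul, h.bracket_mul_even a b c ha, hb, smul_mul_assoc]
  · rw [hm, neg_one_mul, neg_neg, one_pow, one_smul, h.bracket_mul_odd a b c ha]

/-- The effect of an anti-automorphism on the bracket. -/
theorem rev_bracket {ρ : Module.End ℂ A} (hρ : ∀ a b, ρ (a * b) = ρ b * ρ a)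
    (hρν : ∀ a, ρ (ν a) = ν (ρ a)) (hD : ∀ a, ρ (D a) = -D (ρ (ν a))) (a b : A) :
    ρ (bracket ν D a b) = -bracket ν D (ρ b) (ρ a) := by
  simp only [bracket, map_sub, hD, map_mul, hρ, h.inv_inv, hρν]
  noncomm_ring

end IsBV

section Conjugation

variable {τ τ' : A →ₐ[ℂ] A} {d R : Module.End ℂ A}

theorem conj_derivation (hτ : ∀ a, τ (τ' a) = a) (hν : ∀ a, τ (ν a) = ν (τ a))
    (hd : ∀ a b, d (a * b) = d a * b + ν a * d b) (hS : ∀ a, S a = -τ (d (τ' a))) (a b : A) :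
    S (a * b) = S a * b + ν a * S b := by
  simp only [hS, map_mul, hd, map_add, hτ, hν]
  noncomm_ring

theorem conj_anti (hν : ∀ a, τ (ν a) = ν (τ a)) (hν' : ∀ a, τ' (ν a) = ν (τ' a))
    (hd : ∀ a, ν (d a) = -d (ν a)) (hS : ∀ a, S a = -τ (d (τ' a))) (a : A) :
    ν (S a) = -S (ν a) := by
  rw [hS, hS, map_neg, ← hν, hd, hν', map_neg]

theorem conj_anticommutator (hτ' : ∀ a, τ' (τ a) = a) (hS : ∀ a, S a = -τ (d (τ' a)))
    (hR : ∀ a, R a = -τ (D (τ' a))) (h : ∀ a, D (d a) + d (D a) = 0) (a : A) :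
    R (S a) + S (R a) = 0 := by
  simp only [hS, hR, map_neg, hτ', neg_neg]
  rw [← map_add, h, map_zero]

/-- The bracket of the conjugate of `D` by `τ`, in terms of the composite of `τ` with an
anti-automorphism `ρ`. -/
theorem conj_bracket (hD : IsBV ν D) {ρ T : Module.End ℂ A} (hτν : ∀ a, τ (ν a) = ν (τ a))
    (hτ' : ∀ a, τ' a = ν (τ a))
    (hR : ∀ a b, bracket ν R a b = -τ (bracket ν D (τ' a) (τ' b)))
    (hρ : ∀ a b, ρ (a * b) = ρ b * ρ a) (hρν : ∀ a, ρ (ν a) = ν (ρ a)) (hρρ : ∀ a, ρ (ρ a) = a)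
    (hρD : ∀ a, ρ (D a) = -D (ρ (ν a))) (hτρ : ∀ a, τ (ρ a) = ρ (τ a))
    (hT : ∀ a, T a = (-Complex.I) • τ (ρ a))
    (ha : ν a = (-1 : ℂ) ^ m • a) (hb : ν b = (-1 : ℂ) ^ n • b) :
    bracket ν R a b = (Complex.I * (-1 : ℂ) ^ (m * n + 1)) • T (bracket ν D (T a) (T b)) := by
  have hs : ∀ (r s : ℂ) (a b : A), bracket ν D (r • a) (s • b) =
      (r * s) • bracket ν D a b := fun r s a b => by
    simp only [bracket, map_smul, smul_mul_assoc, mul_smul_comm, smul_sub, smul_smul]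
    rw [mul_comm s r]
  have h1 : ∀ {k : ℕ} {c : A}, ν c = (-1 : ℂ) ^ k • c → ν (τ c) = (-1 : ℂ) ^ k • τ c :=
    fun hc => by rw [← hτν, hc, map_smul]
  rw [hR, hτ', hτ', h1 ha, h1 hb, hT, hT, hT, hs, hs, map_smul, map_smul,
    hD.rev_bracket hρ hρν hρD, ← hτρ, ← hτρ, hρρ, hρρ, hD.bracket_symm (h1 ha) (h1 hb), neg_neg]
  simp only [map_smul, smul_smul, ← neg_smul]
  congr 1
  -- Only scalars are left: `-i` from each of the three stars, the given `i`, and the signs from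
  -- parity and from exchanging the two arguments.
  have hp : (-1 : ℂ) ^ (m * n + 1) * (-1) ^ (m * n + 1) = 1 := by rw [← mul_pow]; simp
  have h3 : (-1 : ℂ) ^ ((m + 1) * (n + 1)) = (-1) ^ (m * n + 1) * ((-1) ^ m * (-1) ^ n) := by
    ring
  have h4 : Complex.I * Complex.I * (Complex.I * Complex.I) = 1 := by simp
  rw [h3]
  linear_combination ((-1 : ℂ) ^ m * (-1) ^ n) * hp +
    ((-1 : ℂ) ^ m * (-1) ^ n * ((-1) ^ (m * n + 1) * (-1) ^ (m * n + 1))) * h4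

end Conjugation

theorem neg_anticommutator_apply {N : Type*} [AddCommGroup N] [Module ℂ N]
    {L D₁ D₂ : Module.End ℂ N} (h : L = -(D₁ * D₂ + D₂ * D₁)) (a : N) :
    L a = -D₁ (D₂ a) + -D₂ (D₁ a) := by
  rw [h, ← neg_add]
  rfl

section Ring

variable {L : Type*} [Ring L] {f d d' : L}

/-- By the Leibniz rule `[f, d²]` is the anticommutator of `d` with `[f, d]`. The next lemma does
the same for `[f, d d' + d' d]`. -/
theorem anticommutator_lie_self {r : L} (hr : r = -(f * d - d * f)) (h : d * d = 0) :
    d * r + r * d = 0 := by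
  subst hr
  have h1 : d * -(f * d - d * f) + -(f * d - d * f) * d = d * d * f - f * (d * d) := by
    noncomm_ring
  rw [h1, h, zero_mul, mul_zero, sub_zero]

theorem anticommutator_lie {r s : L} (hr : r = -(f * d - d * f)) (hs : s = -(f * d' - d' * f))
    (h : d * d' + d' * d = 0) : d * s + s * d = -(d' * r + r * d') := by
  subst hr hs
  have h1 : (d * -(f * d' - d' * f) + -(f * d' - d' * f) * d) +
      (d' * -(f * d - d * f) + -(f * d - d * f) * d') =
      (d * d' + d' * d) * f - f * (d * d' + d' * d) := by
    noncomm_ring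
  rw [eq_neg_iff_add_eq_zero, h1, h, zero_mul, mul_zero, sub_zero]

end Ring

end Graded

section Adjoint

open Filter Topology Complex ExteriorAlgebra

variable {X : Type*} [TopologicalSpace X] [ChartedSpace E X] [hX : IsManifold 𝓘(ℂ, E) ∞ X]

namespace CalabiYau

variable (Y : CalabiYau X)

theorem starHat_apply (α : PolySection X) (x : X) :
    Y.starHat α x = (-I) • ExteriorAlgebra.map (jMap (Y.metric x)) (rev (α x)) := by
  refine (Y.rhoFibre_vol_bijective x).1 ?_
  have h1 : rhoFibre (Y.vol x) (Y.starHat α x) = Y.star (Y.rho α) x :=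
    congrFun (Y.rho_hat Y.star α) x
  obtain ⟨b, r, hr, h⟩ := Y.exists_vol_eq x
  have h2 : Y.omega x = kahlerFibre b (Y.metric x) := kahlerFibre_eq _ _ _
  rw [h1, star, h2, map_smul]
  refine hodgeFibre_rhoFibre (Y.metric x) ?_ ?_ (antihol_mul_volume b (Y.metric x)) (α x)
  · rw [h, map_smul, hodgeFibre_topForm, smul_comm]
  · rw [h, map_smul, inv_topForm, smul_neg]

/-- The transported Hodge star as an endomorphism of the smooth sections. -/
def starEnd : Module.End ℂ (smoothAlg X) := (-I) • (Y.tau.toLinearMap ∘ₗ revEnd X)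

theorem starHat_coe (α : smoothAlg X) : Y.starHat α = (Y.starEnd α : smoothAlg X) :=
  funext fun x => Y.starHat_apply _ x

/-- The inverse of `tau`. -/
def tauInv : smoothAlg X →ₐ[ℂ] smoothAlg X := (invHom X).comp Y.tau

theorem tau_tauInv (α : smoothAlg X) : Y.tau (Y.tauInv α) = α := by
  rw [tauInv, AlgHom.comp_apply, tau_invHom, tau_tau, invHom_invHom]

theorem tauInv_tau (α : smoothAlg X) : Y.tauInv (Y.tau α) = α := by
  rw [tauInv, AlgHom.comp_apply, tau_tau, invHom_invHom]

omit hX in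
theorem _root_.KodairaSpencer.revEnd_revEnd (α : smoothAlg X) : revEnd X (revEnd X α) = α :=
  smoothAlg_ext fun _ => CliffordAlgebra.reverse_reverse _

omit hX in
theorem _root_.KodairaSpencer.revEnd_invHom (α : smoothAlg X) :
    revEnd X (invHom X α) = invHom X (revEnd X α) :=
  smoothAlg_ext fun _ => CliffordAlgebra.reverse_involute _

omit hX in
theorem _root_.KodairaSpencer.revEnd_mul (α β : smoothAlg X) :
    revEnd X (α * β) = revEnd X β * revEnd X α :=
  smoothAlg_ext fun _ => CliffordAlgebra.reverse.map_mul _ _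

theorem starEnd_apply (α : smoothAlg X) : Y.starEnd α = (-I) • Y.tau (revEnd X α) := rfl

/-- `R` as an endomorphism of the smooth sections. -/
def rEnd : Module.End ℂ (smoothAlg X) := -(Y.fEnd * Y.deltaEnd - Y.deltaEnd * Y.fEnd)

/-- `S` as an endomorphism of the smooth sections. -/
def sEnd : Module.End ℂ (smoothAlg X) := -(Y.fEnd * Y.delbarEnd - Y.delbarEnd * Y.fEnd)

/-- `R` now has two descriptions. As a conjugate of `Δ` it inherits the algebraic structure; as a
commutator with `f` it yields the anticommutators with `Δ` and `∂̄`. -/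
theorem rEnd_apply (α : smoothAlg X) : Y.rEnd α = -Y.tau (Y.deltaEnd (Y.tauInv α)) := by
  rw [tau_deltaEnd, tau_tauInv]
  rfl

theorem sEnd_apply (α : smoothAlg X) : Y.sEnd α = -Y.tau (Y.delbarEnd (Y.tauInv α)) := by
  rw [tau_delbarEnd, tau_tauInv]
  rfl

theorem R_eq (α : smoothAlg X) : Y.R α = -Y.starHat (Y.Delta (Y.starHat α)) := by
  refine Y.rho_injective ?_
  have h1 : Y.rho (-Y.starHat (Y.Delta (Y.starHat α))) =
      -Y.rho (Y.starHat (Y.Delta (Y.starHat α))) :=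
    funext fun x => map_neg (rhoFibre (Y.vol x)) _
  rw [h1, R, starHat, Delta, rho_hat, rho_hat, rho_hat, rho_hat]
  rfl

/-- The sign of the adjoint cancels that of `hat_delbar`, so no minus sign appears, in contrast to
`R_eq`. -/
theorem S_eq (α : smoothAlg X) : Y.S α = Y.starHat (delbarPoly (Y.starHat α)) := by
  refine Y.rho_injective ?_
  have h1 : Y.rho (Y.starHat (Y.hat delbar (Y.starHat α))) =
      -Y.rho (Y.starHat (delbarPoly (Y.starHat α))) := by
    rw [starHat_coe, Y.hat_delbar (Y.starEnd α).2]
    have h2 : ∀ β : smoothAlg X, Y.starHat (-β : smoothAlg X) = -Y.starHat β := fun β => by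
      rw [starHat_coe, starHat_coe, map_neg]
      rfl
    have h3 := h2 (Y.delbarEnd (Y.starEnd α))
    refine (congrArg Y.rho h3).trans ?_
    exact funext fun x => map_neg (rhoFibre (Y.vol x)) _
  have h2 : Y.rho (Y.S α) = Y.delDagger (Y.rho α) := Y.rho_hat _ _
  have h3 : Y.rho (Y.starHat (Y.hat delbar (Y.starHat α))) =
      Y.star (delbar (Y.star (Y.rho α))) := by
    rw [starHat, rho_hat, rho_hat, rho_hat]
  rw [h2, delDagger, ← h3, h1]
  exact neg_neg _

theorem revEnd_invHom_tau_revEnd (α : smoothAlg X) :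
    revEnd X (invHom X (Y.tau (revEnd X α))) = Y.tauInv α := by
  rw [tau_revEnd, revEnd_invHom, revEnd_revEnd]
  rfl

/-- The two stars contribute `(-i)² = -1`. The two reversals cancel after passing through `Δ`,
leaving a sign and the parity, which completes the second `τ` to `τ⁻¹`. -/
theorem R_coe (α : smoothAlg X) : Y.R α = (Y.rEnd α : smoothAlg X) := by
  have h : -Y.starEnd (Y.deltaEnd (Y.starEnd α)) = Y.rEnd α := by
    simp only [starEnd_apply, map_smul, revEnd_deltaEnd, revEnd_invHom_tau_revEnd, rEnd_apply,
      smul_smul]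
    simp
  rw [← h, R_eq, starHat_coe, ← coe_deltaEnd, starHat_coe]
  rfl

theorem S_coe (α : smoothAlg X) : Y.S α = (Y.sEnd α : smoothAlg X) := by
  have h : Y.starEnd (Y.delbarEnd (Y.starEnd α)) = Y.sEnd α := by
    simp only [starEnd_apply, map_smul, revEnd_delbarEnd, revEnd_invHom_tau_revEnd, sEnd_apply,
      smul_smul]
    simp
  rw [← h, S_eq, starHat_coe, ← Y.coe_delbarEnd, starHat_coe]

theorem isBV_rEnd_and : IsBV (invHom X) Y.rEnd ∧ ∀ α β, bracket (invHom X) Y.rEnd α β =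
    -Y.tau (bracket (invHom X) Y.deltaEnd (Y.tauInv α) (Y.tauInv β)) :=
  Y.isBV_deltaEnd.neg_conj Y.tau_tauInv Y.tauInv_tau Y.tau_invHom Y.rEnd_apply

theorem isBV_rEnd : IsBV (invHom X) Y.rEnd := Y.isBV_rEnd_and.1

theorem tauInv_invHom (α : smoothAlg X) : Y.tauInv (invHom X α) = invHom X (Y.tauInv α) :=
  congrArg (invHom X) (Y.tau_invHom α)

theorem invHom_sEnd (α : smoothAlg X) : invHom X (Y.sEnd α) = -Y.sEnd (invHom X α) :=
  conj_anti Y.tau_invHom Y.tauInv_invHom Y.invHom_delbarEnd Y.sEnd_apply α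

theorem sEnd_mul (α β : smoothAlg X) :
    Y.sEnd (α * β) = Y.sEnd α * β + invHom X α * Y.sEnd β :=
  conj_derivation Y.tau_tauInv Y.tau_invHom Y.delbarEnd_mul Y.sEnd_apply α β

theorem sEnd_sEnd (α : smoothAlg X) : Y.sEnd (Y.sEnd α) = 0 := by
  simp only [sEnd_apply, map_neg, tauInv_tau, delbarEnd_delbarEnd, map_zero, neg_zero]

theorem rEnd_sEnd (α : smoothAlg X) : Y.rEnd (Y.sEnd α) + Y.sEnd (Y.rEnd α) = 0 :=
  conj_anticommutator Y.tauInv_tau Y.sEnd_apply Y.rEnd_apply Y.deltaEnd_delbarEnd α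

theorem deltaEnd_rEnd : Y.deltaEnd * Y.rEnd + Y.rEnd * Y.deltaEnd = 0 :=
  anticommutator_lie_self (L := Module.End ℂ (smoothAlg X)) (r := Y.rEnd) (f := Y.fEnd) rfl
    (LinearMap.ext Y.deltaEnd_deltaEnd)

/-- The two expressions of the Laplacian agree: this is `[f, Δ ∂̄ + ∂̄ Δ] = 0` written out. -/
theorem deltaEnd_sEnd : Y.deltaEnd * Y.sEnd + Y.sEnd * Y.deltaEnd =
    -(Y.delbarEnd * Y.rEnd + Y.rEnd * Y.delbarEnd) :=
  anticommutator_lie (L := Module.End ℂ (smoothAlg X)) (r := Y.rEnd) (s := Y.sEnd) (f := Y.fEnd)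
    rfl rfl (LinearMap.ext Y.deltaEnd_delbarEnd)

/-- The transported Laplacian as an endomorphism of the smooth sections. -/
def laplacianEnd : Module.End ℂ (smoothAlg X) := Y.deltaEnd * Y.sEnd + Y.sEnd * Y.deltaEnd

theorem laplacianEnd_eq :
    Y.laplacianEnd = -(Y.delbarEnd * Y.rEnd + Y.rEnd * Y.delbarEnd) :=
  Y.deltaEnd_sEnd

theorem laplacianHat_eq_coe (α : smoothAlg X) : Y.laplacianHat α =
    (-Y.delbarEnd (Y.rEnd α) + -Y.rEnd (Y.delbarEnd α) : smoothAlg X) := by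
  refine Y.rho_injective ?_
  have h1 : ∀ β : smoothAlg X, Y.delbarDagger (Y.rho β) = Y.rho (Y.rEnd β) := fun β => by
    rw [← R_coe]
    exact (Y.rho_hat Y.delbarDagger (β : PolySection X)).symm
  have h2 : Y.delbarDagger (Y.rho α) = Y.rho (Y.rEnd α) := h1 α
  have h3 : delbar (Y.rho α) = Y.rho (-Y.delbarEnd α : smoothAlg X) := (rho_delbarEnd Y α).symm
  have h4 : delbar (Y.rho (Y.rEnd α)) = Y.rho (-Y.delbarEnd (Y.rEnd α) : smoothAlg X) :=
    (rho_delbarEnd Y (Y.rEnd α)).symm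
  have h5 : Y.delbarDagger (Y.rho (-Y.delbarEnd α : smoothAlg X)) =
      Y.rho (-Y.rEnd (Y.delbarEnd α) : smoothAlg X) := by
    rw [← map_neg Y.rEnd]
    exact h1 (-Y.delbarEnd α)
  rw [laplacianHat, rho_hat, laplacian]
  refine (congrArg₂ (· + ·) ((congrArg delbar h2).trans h4)
    ((congrArg Y.delbarDagger h3).trans h5)).trans ?_
  exact funext fun x => (map_add (rhoFibre (Y.vol x)) _ _).symm

theorem laplacianHat_coe (α : smoothAlg X) :
    Y.laplacianHat α = (Y.laplacianEnd α : smoothAlg X) := by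
  rw [laplacianHat_eq_coe, neg_anticommutator_apply Y.laplacianEnd_eq]

theorem starEnd_bracket {m n : ℕ} {α β : smoothAlg X} (hα : invHom X α = (-1 : ℂ) ^ m • α)
    (hβ : invHom X β = (-1 : ℂ) ^ n • β) : bracket (invHom X) Y.rEnd α β =
      (I * (-1 : ℂ) ^ (m * n + 1)) •
        Y.starEnd (bracket (invHom X) Y.deltaEnd (Y.starEnd α) (Y.starEnd β)) :=
  conj_bracket Y.isBV_deltaEnd Y.tau_invHom (fun _ => rfl) Y.isBV_rEnd_and.2 revEnd_mul
    revEnd_invHom revEnd_revEnd Y.revEnd_deltaEnd Y.tau_revEnd Y.starEnd_apply hα hβ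

end CalabiYau

end Adjoint

/-! # The dGBV algebra of smooth sections -/

section Abstract

/-! ### Mixed identities for two odd operators -/

section Mixed

variable {A : Type*} [Ring A] [Algebra ℂ A] {ν : A →ₐ[ℂ] A} {D₁ D₂ : Module.End ℂ A} {a : A}
  {n : ℕ}

theorem bracket_smul_left (r : ℂ) (a b : A) : bracket ν D₁ (r • a) b = r • bracket ν D₁ a b := by
  simpa [bracket] using bracket_smul_add_left (ν := ν) (D := D₁) r a 0 b

theorem bracket_anticommutator_of_homogeneous (hν : ∀ a, ν (ν a) = a)
    (h₁ : ∀ a, ν (D₁ a) = -D₁ (ν a)) (h₂ : ∀ a, ν (D₂ a) = -D₂ (ν a))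
    (ha : ν a = (-1 : ℂ) ^ n • a) (b : A) :
    (D₁ (bracket ν D₂ a b) - bracket ν D₂ (D₁ a) b + (-1 : ℂ) ^ n • bracket ν D₂ a (D₁ b)) +
      (D₂ (bracket ν D₁ a b) - bracket ν D₁ (D₂ a) b + (-1 : ℂ) ^ n • bracket ν D₁ a (D₂ b)) =
    (-1 : ℂ) ^ n • ((D₁ * D₂ + D₂ * D₁) (a * b) - (D₁ * D₂ + D₂ * D₁) a * b -
      a * (D₁ * D₂ + D₂ * D₁) b) := by
  have h := bracket_anticommutator hν h₁ h₂ a b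
  rw [ha] at h
  simpa only [bracket_smul_left, smul_mul_assoc, map_smul, smul_sub] using h

theorem bracket_anticommutator_eq_neg (hν : ∀ a, ν (ν a) = a)
    (h₁ : ∀ a, ν (D₁ a) = -D₁ (ν a)) (h₂ : ∀ a, ν (D₂ a) = -D₂ (ν a))
    (h : D₁ * D₂ + D₂ * D₁ = 0) (ha : ν a = (-1 : ℂ) ^ n • a) (b : A) :
    D₁ (bracket ν D₂ a b) - bracket ν D₂ (D₁ a) b + (-1 : ℂ) ^ n • bracket ν D₂ a (D₁ b) =
      -D₂ (bracket ν D₁ a b) + bracket ν D₁ (D₂ a) b -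
        (-1 : ℂ) ^ n • bracket ν D₁ a (D₂ b) := by
  have h3 := bracket_anticommutator_of_homogeneous hν h₁ h₂ ha b
  simp only [h, LinearMap.zero_apply, zero_mul, mul_zero, sub_zero, smul_zero] at h3
  rw [eq_neg_of_add_eq_zero_left h3]
  abel

theorem derivation_bracket_of_anticommutator (hν : ∀ a, ν (ν a) = a)
    (h₁ : ∀ a, ν (D₁ a) = -D₁ (ν a)) (h₂ : ∀ a, ν (D₂ a) = -D₂ (ν a))
    (hD : ∀ a b, D₁ (a * b) = D₁ a * b + ν a * D₁ b) {L : Module.End ℂ A}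
    (h : D₁ * D₂ + D₂ * D₁ = L) (ha : ν a = (-1 : ℂ) ^ n • a) (b : A) :
    D₁ (bracket ν D₂ a b) - bracket ν D₂ (D₁ a) b + (-1 : ℂ) ^ n • bracket ν D₂ a (D₁ b) =
      (-1 : ℂ) ^ n • (L (a * b) - L a * b - a * L b) := by
  have h3 := bracket_anticommutator_of_homogeneous hν h₁ h₂ ha b
  simpa only [h, bracket_derivation hν hD, map_zero, smul_zero, sub_zero, add_zero] using h3

end Mixed

variable {M : Type*} [Ring M] [Algebra ℂ M] {𝒜 : Subalgebra ℂ M} {𝓑 : ℕ → Submodule ℂ M}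
  {ν : 𝒜 →ₐ[ℂ] 𝒜} {D' d' : Module.End ℂ 𝒜} {br : M → M → M} {D d : M → M}

theorem coe_bracket_eq (hbr : ∀ a b : 𝒜, br a b = (bracket ν D' a b : 𝒜))
    (hD : ∀ a : 𝒜, D a = (D' a : 𝒜)) {n : ℕ} (a b : 𝒜) (ha : ν a = (-1 : ℂ) ^ n • a) :
    br a b = (-1 : ℂ) ^ n • D ((a : M) * b) - (-1 : ℂ) ^ n • (D a * b) - a * D b := by
  rw [hbr, bracket_eq ha, hD, hD b, ← Subalgebra.coe_mul, hD]
  rfl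

/-- The operators of the theorem act on all sections but are linear endomorphisms only on the smooth
ones; here identities in the subalgebra are read back in the ambient algebra. -/
theorem isDGBVAlgebra_of_isBV (hbr : ∀ a b : 𝒜, br a b = (bracket ν D' a b : 𝒜))
    (hD : ∀ a : 𝒜, D a = (D' a : 𝒜)) (hd : ∀ a : 𝒜, d a = (d' a : 𝒜))
    (h : IsBV ν D') (d_anti : ∀ a, ν (d' a) = -d' (ν a))
    (d_mul : ∀ a b, d' (a * b) = d' a * b + ν a * d' b) (d_d : ∀ a, d' (d' a) = 0)
    (D_d : ∀ a, D' (d' a) + d' (D' a) = 0) (iSup_eq : ⨆ n, 𝓑 n = Subalgebra.toSubmodule 𝒜)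
    (indep : iSupIndep 𝓑) (one_mem : 1 ∈ 𝓑 0)
    (mul_mem : ∀ m n, ∀ α ∈ 𝓑 m, ∀ β ∈ 𝓑 n, α * β ∈ 𝓑 (m + n))
    (mul_comm : ∀ m n, ∀ α ∈ 𝓑 m, ∀ β ∈ 𝓑 n, β * α = (-1 : ℂ) ^ (m * n) • (α * β))
    (hν : ∀ n, ∀ a : 𝒜, (a : M) ∈ 𝓑 n → ν a = (-1 : ℂ) ^ n • a)
    (d_mem : ∀ n, ∀ α ∈ 𝓑 n, d α ∈ 𝓑 (n + 1)) (D_mem : ∀ n, ∀ α ∈ 𝓑 (n + 1), D α ∈ 𝓑 n)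
    (D_zero : ∀ α ∈ 𝓑 0, D α = 0) :
    IsDGBVAlgebra (Subalgebra.toSubmodule 𝒜) 𝓑 br D d := by
  have hle : ∀ {n α}, α ∈ 𝓑 n → α ∈ 𝒜 := fun hα =>
    (iSup_eq.le (Submodule.mem_iSup_of_mem _ hα) : _ ∈ Subalgebra.toSubmodule 𝒜)
  have hDd : d' * D' + D' * d' = 0 := LinearMap.ext fun a => by
    rw [add_comm]; exact D_d a
  have br_eq : ∀ n, ∀ α ∈ 𝓑 n, ∀ β ∈ 𝒜,
      br α β = (-1 : ℂ) ^ n • D (α * β) - (-1 : ℂ) ^ n • (D α * β) - α * D β :=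
    fun n α hα β hβ => coe_bracket_eq hbr hD ⟨α, hle hα⟩ ⟨β, hβ⟩ (hν n ⟨α, hle hα⟩ hα)
  refine
    { iSup_eq := iSup_eq
      iSupIndep := indep
      one_mem := one_mem
      mul_mem := mul_mem
      mul_comm := mul_comm
      d_linear := ?_
      d_mem := d_mem
      d_d := ?_
      d_mul := ?_
      D_linear := ?_
      D_mem := D_mem
      D_zero := D_zero
      D_D := ?_
      D_d := ?_
      br_linear_left := ?_
      br_linear_right := ?_
      br_mem := ?_
      br_zero := ?_
      br_eq := br_eq
      br_symm := ?_
      br_jacobi := ?_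
      br_mul := ?_
      D_br := ?_
      d_br := ?_ }
  · intro c α hα β hβ
    lift α to 𝒜 using hα
    lift β to 𝒜 using hβ
    have := congrArg (Subtype.val : 𝒜 → M) ((map_add d' (c • α) β).trans
      (congrArg (· + d' β) (map_smul d' c α)))
    rw [hd, hd]
    exact (hd (c • α + β)).trans this
  · intro α hα
    lift α to 𝒜 using hα
    rw [hd, hd, d_d]
    rfl
  · intro n α hα β hβ
    have h1 := hα
    lift α to 𝒜 using hle hα
    lift β to 𝒜 using hβ
    rw [← Subalgebra.coe_mul, hd, d_mul, hν n α h1, hd, hd, smul_mul_assoc]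
    rfl
  · intro c α hα β hβ
    lift α to 𝒜 using hα
    lift β to 𝒜 using hβ
    have := congrArg (Subtype.val : 𝒜 → M) ((map_add D' (c • α) β).trans
      (congrArg (· + D' β) (map_smul D' c α)))
    rw [hD, hD]
    exact (hD (c • α + β)).trans this
  · intro α hα
    lift α to 𝒜 using hα
    rw [hD, hD, h.sq]
    rfl
  · intro α hα
    lift α to 𝒜 using hα
    rw [hD, hd, hD, hd]
    exact congrArg (Subtype.val : 𝒜 → M) (D_d α)
  · intro c α hα β hβ γ hγ
    lift α to 𝒜 using hα
    lift β to 𝒜 using hβ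
    lift γ to 𝒜 using hγ
    rw [hbr, hbr]
    exact (hbr (c • α + β) γ).trans
      (congrArg (Subtype.val : 𝒜 → M) (bracket_smul_add_left c α β γ))
  · intro c α hα β hβ γ hγ
    lift α to 𝒜 using hα
    lift β to 𝒜 using hβ
    lift γ to 𝒜 using hγ
    rw [hbr, hbr]
    exact (hbr γ (c • α + β)).trans
      (congrArg (Subtype.val : 𝒜 → M) (bracket_smul_add_right c α β γ))
  · intro m n k hk α hα β hβ
    rw [br_eq m α hα β (hle hβ)]
    have h1 : D (α * β) ∈ 𝓑 k := D_mem k _ (hk ▸ mul_mem m n α hα β hβ)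
    -- In degree zero there is no degree below to land in; there `D` vanishes.
    have h2 : D α * β ∈ 𝓑 k := by
      cases m with
      | zero => rw [D_zero α hα, zero_mul]; exact Submodule.zero_mem _
      | succ m =>
        have h3 := mul_mem m n _ (D_mem m α hα) β hβ
        rwa [show m + n = k by omega] at h3
    have h3 : α * D β ∈ 𝓑 k := by
      cases n with
      | zero => rw [D_zero β hβ, mul_zero]; exact Submodule.zero_mem _
      | succ n =>
        have h3 := mul_mem m n α hα _ (D_mem n β hβ)
        rwa [show m + n = k by omega] at h3
    exact Submodule.sub_mem _ (Submodule.sub_mem _ (Submodule.smul_mem _ _ h1)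
      (Submodule.smul_mem _ _ h2)) h3
  · intro α hα β hβ
    rw [br_eq 0 α hα β (hle hβ), D_zero α hα, D_zero β hβ, D_zero _ (mul_mem 0 0 α hα β hβ)]
    simp
  · intro m n α hα β hβ
    have h1 := hα
    have h2 := hβ
    lift α to 𝒜 using hle hα
    lift β to 𝒜 using hle hβ
    rw [hbr, hbr, h.bracket_symm (hν m α h1) (hν n β h2)]
    rfl
  · intro m n α hα β hβ γ hγ
    have h1 := hα
    have h2 := hβ
    lift α to 𝒜 using hle hα
    lift β to 𝒜 using hle hβ
    lift γ to 𝒜 using hγ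
    rw [hbr, hbr, hbr, hbr, hbr, hbr, h.jacobi (hν m α h1) (hν n β h2)]
    rfl
  · intro m n α hα β hβ γ hγ
    have h1 := hα
    have h2 := hβ
    lift α to 𝒜 using hle hα
    lift β to 𝒜 using hle hβ
    lift γ to 𝒜 using hγ
    rw [← Subalgebra.coe_mul, hbr, hbr, hbr, h.bracket_mul (hν m α h1) (hν n β h2)]
    rfl
  · intro n α hα β hβ
    have h1 := hα
    lift α to 𝒜 using hle hα
    lift β to 𝒜 using hβ
    rw [hbr, hD, hD, hD, hbr, hbr, h.map_bracket_of_homogeneous (hν n α h1)]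
    rfl
  · intro n α hα β hβ
    have h1 := hα
    lift α to 𝒜 using hle hα
    lift β to 𝒜 using hβ
    rw [hbr, hd, hd, hd, hbr, hbr,
      derivation_bracket_of_homogeneous h.inv_inv d_anti h.anti d_mul hDd (hν n α h1)]
    rfl

end Abstract

/-! ### Transfer of the mixed identities from a subalgebra -/

section Coe

variable {M : Type*} [Ring M] [Algebra ℂ M] {𝒜 : Subalgebra ℂ M} {ν : 𝒜 →ₐ[ℂ] 𝒜}
  {D₁ D₂ L : Module.End ℂ 𝒜} {br₁ br₂ : M → M → M} {d₁ d₂ l : M → M}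
  (hd₁ : ∀ a : 𝒜, d₁ a = (D₁ a : 𝒜)) (hd₂ : ∀ a : 𝒜, d₂ a = (D₂ a : 𝒜))
  (hl : ∀ a : 𝒜, l a = (L a : 𝒜)) {n : ℕ}

include hd₁

theorem coe_derivation_bracket (hl : ∀ a : 𝒜, l a = (L a : 𝒜))
    (hbr₂ : ∀ a b : 𝒜, br₂ a b = (bracket ν D₂ a b : 𝒜))
    (hν : ∀ a, ν (ν a) = a) (h₁ : ∀ a, ν (D₁ a) = -D₁ (ν a)) (h₂ : ∀ a, ν (D₂ a) = -D₂ (ν a))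
    (hD : ∀ a b, D₁ (a * b) = D₁ a * b + ν a * D₁ b) (h : D₁ * D₂ + D₂ * D₁ = L) (a b : 𝒜)
    (ha : ν a = (-1 : ℂ) ^ n • a) :
    d₁ (br₂ a b) - br₂ (d₁ a) b + (-1 : ℂ) ^ n • br₂ a (d₁ b) =
      (-1 : ℂ) ^ n • (l ((a : M) * b) - l a * b - a * l b) := by
  rw [hbr₂, hd₁, hd₁, hd₁, hbr₂, hbr₂, ← Subalgebra.coe_mul, hl, hl, hl]
  exact congrArg (Subtype.val : 𝒜 → M)
    (derivation_bracket_of_anticommutator hν h₁ h₂ hD h ha b)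

theorem coe_neg_derivation_bracket (hl : ∀ a : 𝒜, l a = (L a : 𝒜))
    (hbr₂ : ∀ a b : 𝒜, br₂ a b = (bracket ν D₂ a b : 𝒜))
    (hν : ∀ a, ν (ν a) = a) (h₁ : ∀ a, ν (D₁ a) = -D₁ (ν a)) (h₂ : ∀ a, ν (D₂ a) = -D₂ (ν a))
    (hD : ∀ a b, D₁ (a * b) = D₁ a * b + ν a * D₁ b) (h : L = -(D₁ * D₂ + D₂ * D₁)) (a b : 𝒜)
    (ha : ν a = (-1 : ℂ) ^ n • a) :
    -d₁ (br₂ a b) + br₂ (d₁ a) b - (-1 : ℂ) ^ n • br₂ a (d₁ b) =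
      (-1 : ℂ) ^ n • (l ((a : M) * b) - l a * b - a * l b) := by
  -- The anticommutator is `-L`, so the positive version is used with `-L` and all signs are
  -- reversed.
  have h3 := coe_derivation_bracket (L := -L) (l := -l) hd₁ (fun a => congrArg Neg.neg (hl a)) hbr₂
    hν h₁ h₂ hD (neg_eq_iff_eq_neg.2 h).symm a b ha
  rw [← neg_inj, ← sub_eq_zero] at h3 ⊢
  rw [← neg_eq_zero, ← h3]
  simp only [Pi.neg_apply, neg_mul, mul_neg, smul_sub, smul_neg]
  abel

include hd₂

theorem coe_bracket_anticommutator_eq_neg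
    (hbr₁ : ∀ a b : 𝒜, br₁ a b = (bracket ν D₁ a b : 𝒜))
    (hbr₂ : ∀ a b : 𝒜, br₂ a b = (bracket ν D₂ a b : 𝒜))
    (hν : ∀ a, ν (ν a) = a) (h₁ : ∀ a, ν (D₁ a) = -D₁ (ν a)) (h₂ : ∀ a, ν (D₂ a) = -D₂ (ν a))
    (h : D₁ * D₂ + D₂ * D₁ = 0) (a b : 𝒜) (ha : ν a = (-1 : ℂ) ^ n • a) :
    d₁ (br₂ a b) - br₂ (d₁ a) b + (-1 : ℂ) ^ n • br₂ a (d₁ b) =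
      -d₂ (br₁ a b) + br₁ (d₂ a) b - (-1 : ℂ) ^ n • br₁ a (d₂ b) := by
  rw [hbr₂, hbr₁, hd₁, hd₁, hd₁, hd₂, hd₂, hd₂, hbr₂, hbr₂, hbr₁, hbr₁]
  exact congrArg (Subtype.val : 𝒜 → M) (bracket_anticommutator_eq_neg hν h₁ h₂ h ha b)

include hl

theorem coe_eq_anticommutator (h : L = D₁ * D₂ + D₂ * D₁) (a : 𝒜) :
    l a = d₁ (d₂ a) + d₂ (d₁ a) := by
  rw [hl, h, hd₂, hd₁, hd₁, hd₂]
  rfl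

theorem coe_eq_neg_anticommutator (h : L = -(D₁ * D₂ + D₂ * D₁)) (a : 𝒜) :
    l a = -d₁ (d₂ a) - d₂ (d₁ a) := by
  rw [hl, h, hd₂, hd₁, hd₁, hd₂, ← neg_add']
  rfl

end Coe

/-! ### The grading of smooth sections by ghost number -/

section Sections

variable {X : Type*} [TopologicalSpace X] [ChartedSpace E X]

theorem oddBracket_coe {D : PolySection X → PolySection X} {D' : Module.End ℂ (smoothAlg X)}
    (h : ∀ α : smoothAlg X, D α = (D' α : smoothAlg X)) (α β : smoothAlg X) :
    oddBracket D α β = (bracket (invHom X) D' α β : smoothAlg X) := by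
  have h1 : oddBracket D α β = D (invHom X α * β : smoothAlg X) - D (invHom X α : smoothAlg X) * β -
    α * D β := rfl
  rw [h1, h, h, h]
  rfl

theorem invHom_of_mem_ghost {n : ℕ} {α : smoothAlg X} (hα : (α : PolySection X) ∈ ghost X n) :
    invHom X α = (-1 : ℂ) ^ n • α := by
  refine smoothAlg_ext fun x => ?_
  have h := (mem_ghost.1 hα).2 x
  rw [exteriorPower_eq] at h
  exact inv_of_mem h

theorem mul_mem_ghost {m n : ℕ} {α β : PolySection X} (hα : α ∈ ghost X m) (hβ : β ∈ ghost X n) :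
    α * β ∈ ghost X (m + n) := by
  refine mem_ghost.2 ⟨(smoothAlg X).mul_mem (mem_ghost.1 hα).1 (mem_ghost.1 hβ).1, fun x => ?_⟩
  have h1 := (mem_ghost.1 hα).2 x
  have h2 := (mem_ghost.1 hβ).2 x
  rw [exteriorPower_eq] at h1 h2 ⊢
  rw [pow_add]
  exact Submodule.mul_mem_mul h1 h2

theorem mul_comm_of_mem_ghost {m n : ℕ} {α β : PolySection X} (hα : α ∈ ghost X m)
    (hβ : β ∈ ghost X n) : β * α = (-1 : ℂ) ^ (m * n) • (α * β) := by
  funext x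
  have h1 := (mem_ghost.1 hα).2 x
  have h2 := (mem_ghost.1 hβ).2 x
  rw [exteriorPower_eq] at h1 h2
  exact graded_comm h1 h2

theorem one_mem_ghost : (1 : PolySection X) ∈ ghost X 0 :=
  mem_ghost.2 ⟨(smoothAlg X).one_mem, fun x => by
    rw [exteriorPower_eq, pow_zero]
    exact Submodule.one_le.1 le_rfl⟩

theorem exists_finset_sum_component : ∃ s : Finset ℕ, ∀ (x : X) (y : PolyAlg (T x)),
    ∑ n ∈ s, component n y = y := by
  obtain ⟨s, hs⟩ := exists_sum_component (M := E × ConjDual E)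
  refine ⟨s, fun x y => ?_⟩
  -- Each tangent space is `E` by definition, so the finite set of degrees found for `E` serves all
  -- fibres.
  let f : E →ₗ[ℂ] T x := LinearMap.id
  let f' : T x →ₗ[ℂ] E := LinearMap.id
  have h : polyMap f f' (polyMap f' f y) = y := polyMap_polyMap (LinearMap.ext fun _ => rfl) y
  have h2 := congrArg (polyMap f f') (hs (polyMap f' f y))
  rw [map_sum, h] at h2
  refine Eq.trans (Finset.sum_congr rfl fun n _ => ?_) h2
  rw [polyMap, map_component, ← polyMap, h]

theorem iSup_ghost : ⨆ n, ghost X n = smoothPoly X := by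
  refine le_antisymm (iSup_le fun n α hα => (mem_ghost.1 hα).1) fun α hα => ?_
  obtain ⟨s, hs⟩ := exists_finset_sum_component (X := X)
  let g : ℕ → PolySection X := fun n x => component n (α x)
  have h : ∑ n ∈ s, g n = α := funext fun x => (Finset.sum_apply x s g).trans (hs x (α x))
  rw [← h]
  refine Submodule.sum_mem _ fun n _ => Submodule.mem_iSup_of_mem n (mem_ghost.2 ⟨?_, fun x => ?_⟩)
  · exact smooth_natural (fun _ => component n) (component n)
      (fun _ _ _ y => map_component _ _ y) hα
  · exact component_mem n (α x)

/-- Evaluation at a point sends the ghost spaces to the exterior powers, which are independent in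
each fibre. -/
theorem iSupIndep_ghost : iSupIndep (ghost X) := by
  rw [iSupIndep_def]
  intro n
  rw [Submodule.disjoint_def]
  intro α hα h
  funext x
  let ev : PolySection X →ₗ[ℂ] PolyAlg (T x) := LinearMap.proj x
  have h1 : ev α ∈ ⨆ (j) (_ : j ≠ n), ⋀[ℂ]^j (T x × ConjDual (T x)) := by
    have h2 : (⨆ (j) (_ : j ≠ n), ghost X j) ≤
        (⨆ (j) (_ : j ≠ n), ⋀[ℂ]^j (T x × ConjDual (T x))).comap ev :=
      iSup₂_le fun j hj β hβ => Submodule.mem_iSup_of_mem j (Submodule.mem_iSup_of_mem hj (hβ.2 x))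
    exact h2 h
  exact Submodule.disjoint_def.1 (iSupIndep_def.1 iSupIndep_exteriorPower n) _ (hα.2 x) h1

end Sections

/-! ### Assembly on a Calabi-Yau threefold -/

section Global

variable {X : Type*} [TopologicalSpace X] [ChartedSpace E X] [hX : IsManifold 𝓘(ℂ, E) ∞ X]

namespace CalabiYau

variable (Y : CalabiYau X)

theorem starHat_mem {α : PolySection X} (hα : α ∈ smoothPoly X) : Y.starHat α ∈ smoothPoly X := by
  have h := Y.starHat_coe ⟨α, hα⟩
  exact h ▸ (Y.starEnd ⟨α, hα⟩).2

theorem starHat_mem_bidegree {p q : ℕ} {α : PolySection X} (hα : α ∈ bidegree X p q) :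
    Y.starHat α ∈ bidegree X q p := by
  refine mem_bidegree.2 ⟨Y.starHat_mem (mem_bidegree.1 hα).1, fun x => ?_⟩
  rw [starHat_apply]
  exact Submodule.smul_mem _ _ (jMap_mem_polyBidegree _ (hα.2 x))

theorem starHat_mem_ghost {n : ℕ} {α : PolySection X} (hα : α ∈ ghost X n) :
    Y.starHat α ∈ ghost X n := by
  refine mem_ghost.2 ⟨Y.starHat_mem (mem_ghost.1 hα).1, fun x => ?_⟩
  rw [starHat_apply]
  exact Submodule.smul_mem _ _ (map_mem_exteriorPower _ (rev_mem_exteriorPower (hα.2 x)))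

theorem starHat_zero : Y.starHat (0 : PolySection X) = 0 :=
  (Y.starHat_coe 0).trans (congrArg Subtype.val (map_zero Y.starEnd))

theorem R_eq_of_mem {α : PolySection X} (hα : α ∈ smoothPoly X) :
    Y.R α = -Y.starHat (Y.Delta (Y.starHat α)) := Y.R_eq ⟨α, hα⟩

theorem S_eq_of_mem {α : PolySection X} (hα : α ∈ smoothPoly X) :
    Y.S α = Y.starHat (delbarPoly (Y.starHat α)) := Y.S_eq ⟨α, hα⟩

theorem S_mem_bidegree {p q : ℕ} {α : PolySection X} (hα : α ∈ bidegree X p q) :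
    Y.S α ∈ bidegree X (p + 1) q := by
  rw [Y.S_eq_of_mem (mem_bidegree.1 hα).1]
  exact Y.starHat_mem_bidegree (Y.delbarPoly_mem_bidegree (Y.starHat_mem_bidegree hα))

theorem S_mem_ghost {n : ℕ} {α : PolySection X} (hα : α ∈ ghost X n) :
    Y.S α ∈ ghost X (n + 1) := by
  rw [Y.S_eq_of_mem (mem_ghost.1 hα).1]
  exact Y.starHat_mem_ghost (Y.delbarPoly_mem_ghost (Y.starHat_mem_ghost hα))

theorem R_mem_bidegree {p q : ℕ} {α : PolySection X} (hα : α ∈ bidegree X p (q + 1)) :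
    Y.R α ∈ bidegree X p q := by
  rw [Y.R_eq_of_mem (mem_bidegree.1 hα).1]
  exact Submodule.neg_mem _ (Y.starHat_mem_bidegree (Y.Delta_mem_bidegree
    (Y.starHat_mem_bidegree hα)))

theorem R_mem_ghost {n : ℕ} {α : PolySection X} (hα : α ∈ ghost X (n + 1)) :
    Y.R α ∈ ghost X n := by
  rw [Y.R_eq_of_mem (mem_ghost.1 hα).1]
  exact Submodule.neg_mem _ (Y.starHat_mem_ghost (Y.Delta_mem_ghost (Y.starHat_mem_ghost hα)))

theorem R_eq_zero_of_bidegree {p : ℕ} {α : PolySection X} (hα : α ∈ bidegree X p 0) :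
    Y.R α = 0 := by
  rw [Y.R_eq_of_mem (mem_bidegree.1 hα).1,
    Y.Delta_eq_zero_of_bidegree (Y.starHat_mem_bidegree hα), starHat_zero, neg_zero]

theorem R_eq_zero_of_ghost {α : PolySection X} (hα : α ∈ ghost X 0) : Y.R α = 0 := by
  rw [Y.R_eq_of_mem (mem_ghost.1 hα).1, Y.Delta_eq_zero_of_ghost (Y.starHat_mem_ghost hα),
    starHat_zero, neg_zero]

theorem Delta_coe (α : smoothAlg X) : Y.Delta α = (Y.deltaEnd α : smoothAlg X) := rfl

theorem delbarPoly_coe (α : smoothAlg X) :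
    delbarPoly (α : PolySection X) = (Y.delbarEnd α : smoothAlg X) := rfl

theorem starBracket_coe (α β : smoothAlg X) :
    Y.starBracket α β = (bracket (invHom X) Y.rEnd α β : smoothAlg X) :=
  oddBracket_coe Y.R_coe α β

theorem bulletBracket_coe (α β : smoothAlg X) :
    Y.bulletBracket α β = (bracket (invHom X) Y.deltaEnd α β : smoothAlg X) :=
  oddBracket_coe (fun _ => rfl) α β

theorem isDGBVAlgebra :
    IsDGBVAlgebra (smoothPoly X) (ghost X) Y.starBracket Y.R Y.S :=
  isDGBVAlgebra_of_isBV (𝒜 := smoothAlg X) Y.starBracket_coe Y.R_coe Y.S_coe Y.isBV_rEnd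
    Y.invHom_sEnd Y.sEnd_mul Y.sEnd_sEnd Y.rEnd_sEnd iSup_ghost iSupIndep_ghost one_mem_ghost
    (fun _ _ _ hα _ hβ => mul_mem_ghost hα hβ) (fun _ _ _ hα _ hβ => mul_comm_of_mem_ghost hα hβ)
    (fun _ _ hα => invHom_of_mem_ghost hα) (fun _ _ hα => Y.S_mem_ghost hα)
    (fun _ _ hα => Y.R_mem_ghost hα) (fun _ hα => Y.R_eq_zero_of_ghost hα)

theorem starBracket_eq {m n : ℕ} {α β : PolySection X} (hα : α ∈ ghost X m) (hβ : β ∈ ghost X n) :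
    Y.starBracket α β = (Complex.I * (-1 : ℂ) ^ (m * n + 1)) •
      Y.starHat (Y.bulletBracket (Y.starHat α) (Y.starHat β)) := by
  have h1 := hα
  have h2 := hβ
  lift α to smoothAlg X using (mem_ghost.1 hα).1
  lift β to smoothAlg X using (mem_ghost.1 hβ).1
  rw [starBracket_coe, starHat_coe, starHat_coe, bulletBracket_coe, starHat_coe,
    Y.starEnd_bracket (invHom_of_mem_ghost h1) (invHom_of_mem_ghost h2)]
  rfl

variable {n : ℕ} {α β : PolySection X} (hα : α ∈ ghost X n) (hβ : β ∈ smoothPoly X)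

include hα hβ

theorem bulletBracket_eq : Y.bulletBracket α β = (-1 : ℂ) ^ n • Y.Delta (α * β)
    - (-1 : ℂ) ^ n • (Y.Delta α * β) - α * Y.Delta β :=
  coe_bracket_eq Y.bulletBracket_coe Y.Delta_coe ⟨α, (mem_ghost.1 hα).1⟩ ⟨β, hβ⟩
    (invHom_of_mem_ghost hα)

theorem Delta_starBracket :
    Y.Delta (Y.starBracket α β) - Y.starBracket (Y.Delta α) β
        + (-1 : ℂ) ^ n • Y.starBracket α (Y.Delta β) =
      -Y.R (Y.bulletBracket α β) + Y.bulletBracket (Y.R α) β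
        - (-1 : ℂ) ^ n • Y.bulletBracket α (Y.R β) :=
  coe_bracket_anticommutator_eq_neg Y.Delta_coe Y.R_coe Y.bulletBracket_coe Y.starBracket_coe
    Y.isBV_rEnd.inv_inv Y.isBV_deltaEnd.anti Y.isBV_rEnd.anti Y.deltaEnd_rEnd
    ⟨α, (mem_ghost.1 hα).1⟩ ⟨β, hβ⟩ (invHom_of_mem_ghost hα)

/-- `S` is a derivation, so its own bracket drops out of the anticommutator identity for `(S, Δ)`,
leaving the Laplacian `ΔS + SΔ`. In `delbarPoly_starBracket` the derivation `∂̄` plays this part for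
`(∂̄, R)`. -/
theorem S_bulletBracket :
    Y.S (Y.bulletBracket α β) - Y.bulletBracket (Y.S α) β
        + (-1 : ℂ) ^ n • Y.bulletBracket α (Y.S β) =
      (-1 : ℂ) ^ n • (Y.laplacianHat (α * β) - Y.laplacianHat α * β - α * Y.laplacianHat β) :=
  coe_derivation_bracket Y.S_coe Y.laplacianHat_coe Y.bulletBracket_coe
    Y.isBV_rEnd.inv_inv Y.invHom_sEnd Y.isBV_deltaEnd.anti Y.sEnd_mul
    (add_comm (Y.sEnd * Y.deltaEnd) _)
    ⟨α, (mem_ghost.1 hα).1⟩ ⟨β, hβ⟩ (invHom_of_mem_ghost hα)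

theorem delbarPoly_starBracket :
    -delbarPoly (Y.starBracket α β) + Y.starBracket (delbarPoly α) β
        - (-1 : ℂ) ^ n • Y.starBracket α (delbarPoly β) =
      (-1 : ℂ) ^ n • (Y.laplacianHat (α * β) - Y.laplacianHat α * β - α * Y.laplacianHat β) :=
  coe_neg_derivation_bracket Y.delbarPoly_coe Y.laplacianHat_coe Y.starBracket_coe
    Y.isBV_rEnd.inv_inv Y.invHom_delbarEnd Y.isBV_rEnd.anti Y.delbarEnd_mul Y.laplacianEnd_eq
    ⟨α, (mem_ghost.1 hα).1⟩ ⟨β, hβ⟩ (invHom_of_mem_ghost hα)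

omit hα

theorem laplacianHat_eq_delbar :
    Y.laplacianHat β = -delbarPoly (Y.R β) - Y.R (delbarPoly β) :=
  coe_eq_neg_anticommutator Y.delbarPoly_coe Y.R_coe Y.laplacianHat_coe Y.laplacianEnd_eq ⟨β, hβ⟩

theorem laplacianHat_eq_Delta :
    Y.laplacianHat β = Y.Delta (Y.S β) + Y.S (Y.Delta β) :=
  coe_eq_anticommutator Y.Delta_coe Y.S_coe Y.laplacianHat_coe rfl ⟨β, hβ⟩

end CalabiYau

end Global

end KodairaSpencer

end

theorem mainTheorem4 {X : Type*} [TopologicalSpace X] [ChartedSpace E X]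
    [IsManifold 𝓘(ℂ, E) ∞ X] (Y : CalabiYau X) :
    -- the operators act on smooth sections, with the stated bidegrees
    (∀ p q, ∀ α ∈ bidegree X p q, delbarPoly α ∈ bidegree X p (q + 1)) ∧
    (∀ p q, ∀ α ∈ bidegree X (p + 1) q, Y.Delta α ∈ bidegree X p q) ∧
    (∀ q, ∀ α ∈ bidegree X 0 q, Y.Delta α = 0) ∧
    (∀ p q, ∀ α ∈ bidegree X p q, Y.S α ∈ bidegree X (p + 1) q) ∧
    (∀ p q, ∀ α ∈ bidegree X p (q + 1), Y.R α ∈ bidegree X p q) ∧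
    (∀ p, ∀ α ∈ bidegree X p 0, Y.R α = 0) ∧
    (∀ p q, ∀ α ∈ bidegree X p q, Y.starHat α ∈ bidegree X q p) ∧
    -- the dGBV algebra of the pair `(R, S)`
    IsDGBVAlgebra (smoothPoly X) (ghost X) Y.starBracket Y.R Y.S ∧
    -- the two brackets are related by the Hodge star
    (∀ m n, ∀ α ∈ ghost X m, ∀ β ∈ ghost X n,
      Y.starBracket α β = (Complex.I * (-1 : ℂ) ^ (m * n + 1)) •
        Y.starHat (Y.bulletBracket (Y.starHat α) (Y.starHat β))) ∧
    -- `[α • β]` is given by the formula that defines `[α ⋆ β]`, with `Δ` in place of `R`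
    (∀ n, ∀ α ∈ ghost X n, ∀ β ∈ smoothPoly X,
      Y.bulletBracket α β = (-1 : ℂ) ^ n • Y.Delta (α * β)
        - (-1 : ℂ) ^ n • (Y.Delta α * β) - α * Y.Delta β) ∧
    -- the mixed identity for `Δ` and `R`
    (∀ n, ∀ α ∈ ghost X n, ∀ β ∈ smoothPoly X,
      Y.Delta (Y.starBracket α β) - Y.starBracket (Y.Delta α) β
          + (-1 : ℂ) ^ n • Y.starBracket α (Y.Delta β) =
        -Y.R (Y.bulletBracket α β) + Y.bulletBracket (Y.R α) β
          - (-1 : ℂ) ^ n • Y.bulletBracket α (Y.R β)) ∧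
    -- the mixed identities for `S`, `∂̄` and the Laplacian
    (∀ n, ∀ α ∈ ghost X n, ∀ β ∈ smoothPoly X,
      Y.S (Y.bulletBracket α β) - Y.bulletBracket (Y.S α) β
          + (-1 : ℂ) ^ n • Y.bulletBracket α (Y.S β) =
        -delbarPoly (Y.starBracket α β) + Y.starBracket (delbarPoly α) β
          - (-1 : ℂ) ^ n • Y.starBracket α (delbarPoly β)) ∧
    (∀ n, ∀ α ∈ ghost X n, ∀ β ∈ smoothPoly X,
      -delbarPoly (Y.starBracket α β) + Y.starBracket (delbarPoly α) β
          - (-1 : ℂ) ^ n • Y.starBracket α (delbarPoly β) =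
        (-1 : ℂ) ^ n • (Y.laplacianHat (α * β) - Y.laplacianHat α * β
          - α * Y.laplacianHat β)) ∧
    -- the Laplacian in terms of the transported operators
    (∀ α ∈ smoothPoly X,
      Y.laplacianHat α = -delbarPoly (Y.R α) - Y.R (delbarPoly α) ∧
      Y.laplacianHat α = Y.Delta (Y.S α) + Y.S (Y.Delta α)) :=
  ⟨fun _ _ _ hα => Y.delbarPoly_mem_bidegree hα, fun _ _ _ hα => Y.Delta_mem_bidegree hα,
    fun _ _ hα => Y.Delta_eq_zero_of_bidegree hα, fun _ _ _ hα => Y.S_mem_bidegree hα,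
    fun _ _ _ hα => Y.R_mem_bidegree hα, fun _ _ hα => Y.R_eq_zero_of_bidegree hα,
    fun _ _ _ hα => Y.starHat_mem_bidegree hα, Y.isDGBVAlgebra,
    fun _ _ _ hα _ hβ => Y.starBracket_eq hα hβ, fun _ _ hα _ hβ => Y.bulletBracket_eq hα hβ,
    fun _ _ hα _ hβ => Y.Delta_starBracket hα hβ,
    fun _ _ hα _ hβ => (Y.S_bulletBracket hα hβ).trans (Y.delbarPoly_starBracket hα hβ).symm,
    fun _ _ hα _ hβ => Y.delbarPoly_starBracket hα hβ,
    fun _ hα => ⟨Y.laplacianHat_eq_delbar hα, Y.laplacianHat_eq_Delta hα⟩⟩
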